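/- Let $d\ge 1$ and let $\Gamma_0$ be the space of finite subsets (configurations) of $\mathbb R^d$, with the Lebesgue–Poisson measure $\lambda=\sum_{n\ge0}\frac1{n!}m^{(n)}$, where $m^{(n)}$ is the image of Lebesgue measure $(dx)^n$ on $n$-tuples of distinct points and $m^{(0)}=\delta_{\emptyset}$. For $f:\mathbb R^d\to\mathbb R$ let $e_\lambda(f,\eta)=\prod_{x\in\eta}f(x)$, $e_\lambda(f,\emptyset)=1$. For $c>0$ let $\mathcal L_c$ be the Banach space of measurable $G:\Gamma_0\to\mathbb R$ with $\|G\|_c=\int|G(\eta)|c^{|\eta|}d\lambda(\eta)<\infty$, and $\mathcal K_c$ the Banach space of measurable $k:\Gamma_0\to\mathbb R$ with $\|k\|_{\mathcal K_c}=\|c^{-|\cdot|}k\|_{L^\infty(\lambda)}<\infty$ (functions equal $\lambda$-a.e. are identified). Let $\phi:\mathbb R^d\to[0,\infty)$ be measurable, even and integrable, $\beta=\int\phi(x)\,dx$, and let $C>1$, $z>0$ satisfy $$z\le\min\{Ce^{-C\beta},\,2Ce^{-2C\beta}\},\qquad\text{and } z<C/2 \text{ if } C\beta=\ln 2.$$ On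 $\mathcal L_{2C}\subset\mathcal L_C$ let $$(\hat L_VG)(\eta)=-|\eta|G(\eta)+z\sum_{\xi\subset\eta}\int_{\mathbb R^d}G(\xi\cup x)\,e_\lambda(-\phi(x-\cdot),\eta\setminus\xi)\,dx,$$ and let $\hat L_V^*$ be the operator in $\mathcal K_C$ dual to the closure of $(\hat L_V,\mathcal L_{2C})$ in $\mathcal L_C$ with respect to the duality $\langle\langle G,k\rangle\rangle=\int Gk\,d\lambda$. Let $\alpha\in(z/C,1)$, let $\overline{\mathcal K_{\alpha C}}$ be the closure of $\mathcal K_{\alpha C}$ in $\mathcal K_C$, and let $A$ be the part of $\hat L_V^*$ in it: $D(A)=\{k\in D(\hat L_V^*)\cap\overline{\mathcal K_{\alpha C}}:\hat L_V^*k\in\overline{\mathcal K_{\alpha C}}\}$, $Ak=\hat L_V^*k$. Let $\rho_0:\mathbb R^d\to\mathbb R$ be measurable with $0\le\rho_0\le\alpha C$ a.e. Then: 1. The Cauchy problem $\frac{\partial}{\partial t}k_t=\hat L_V^*k_t$, $t\ge0$, is well-posed on $\overline{\mathcal K_{\alpha C}}$: $A$ is a densely defined (single-valued) operator in $\overline{\mathcal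 K_{\alpha C}}$, for every $k_0\in D(A)$ there is exactly one classical solution (continuously differentiable on $[0,\infty)$ in the norm of $\mathcal K_C$, with values in $D(A)$), and it depends continuously on $k_0$, uniformly for $t$ in bounded intervals. 2. The Vlasov-type equation $$\frac{\partial}{\partial t}\rho_t(x)=-\rho_t(x)+z\exp\Big\{-\int_{\mathbb R^d}\rho_t(y)\phi(x-y)\,dy\Big\},\qquad \rho_t(x)|_{t=0}=\rho_0(x),\qquad\text{for a.a. }x,$$ has a global (for all $t\ge0$) bounded nonnegative solution $\rho_t$, it is unique up to null sets, and $0\le\rho_t\le\alpha C$ a.e. for every $t\ge0$. 3. $k_t=e_\lambda(\rho_t)$ belongs to $\mathcal K_{\alpha C}$ for every $t\ge 0$ and is the classical solution of the Cauchy problem in 1 with $k_0=e_\lambda(\rho_0)$. -/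

import Mathlib

open MeasureTheory Set
open scoped ENNReal

noncomputable section

namespace Glauber

/-- The space `ℝ^d` with its Euclidean structure. -/
abbrev Pt (d : ℕ) : Type := EuclideanSpace ℝ (Fin d)

/-- The space `Γ₀` of finite configurations: finite subsets of `ℝ^d`. (Not reducible, so that it
carries its own σ-algebra, defined below, and not the one that Mathlib puts on `Finset`.) -/
def Conf (d : ℕ) : Type := Finset (Pt d)

/-- The set of `n`-tuples of pairwise distinct points. -/
abbrev Tup (d n : ℕ) : Type := {x : Fin n → Pt d // Function.Injective x}

/-- The symmetrization map, sending an `n`-tuple of distinct points to the `n`-point configuration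
formed by them. -/
def Tup.conf {d n : ℕ} (x : Tup d n) : Conf d :=
  (Finset.univ.map ⟨x.1, x.2⟩ : Finset (Pt d))

/-- The σ-algebra of `Γ₀`, the disjoint union of the symmetrizations of the spaces of `n`-tuples of
distinct points: a set is measurable iff its preimage in each of them is a Borel set. -/
instance instMeasurableSpaceConf (d : ℕ) : MeasurableSpace (Conf d) :=
  ⨅ n : ℕ, MeasurableSpace.map (Tup.conf (d := d) (n := n)) inferInstance

theorem measurable_conf (d n : ℕ) : Measurable (Tup.conf (d := d) (n := n)) :=
  fun _ hs => (MeasurableSpace.measurableSet_iInf.1 hs) n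

/-- The Lebesgue--Poisson measure `λ = ∑ₙ (1/n!) m⁽ⁿ⁾` on `Γ₀`, where `m⁽ⁿ⁾` is the image of the
Lebesgue measure `(dx)ⁿ` on the `n`-tuples of distinct points. -/
def lebesguePoisson (d : ℕ) : Measure (Conf d) :=
  Measure.sum fun n : ℕ =>
    ((n.factorial : ℝ≥0∞)⁻¹) •
      ((Measure.comap (Subtype.val : Tup d n → Fin n → Pt d) volume).map Tup.conf)

/-- The number `|η|` of points of a configuration. -/
def Conf.card {d : ℕ} (η : Conf d) : ℕ := Finset.card (α := Pt d) η

/-- The Lebesgue--Poisson exponent `e_λ(f, η) = ∏_{x ∈ η} f x`, with `e_λ(f, ∅) = 1`. -/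
def lpExp {d : ℕ} (f : Pt d → ℝ) (η : Conf d) : ℝ :=
  Finset.prod (ι := Pt d) η f

/-- The measure `λ_C`, with `dλ_C = C^{|η|} dλ`. -/
def lebesguePoissonWeighted (d : ℕ) (C : ℝ) : Measure (Conf d) :=
  (lebesguePoisson d).withDensity fun η => ENNReal.ofReal (C ^ η.card)

/-- The Banach space `𝓛_C = L¹(Γ₀, λ_C)` of quasi-observables, with norm
`∫ |G(η)| C^{|η|} dλ(η)`. -/
abbrev LSpace (d : ℕ) (C : ℝ) : Type := Lp ℝ 1 (lebesguePoissonWeighted d C)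

/-- `k ∈ 𝓚_C`, that is `k · C^{-|·|} ∈ L^∞(Γ₀, λ)`. -/
def MemK {d : ℕ} (C : ℝ) (k : Conf d → ℝ) : Prop :=
  MemLp (fun η => k η * (C ^ η.card)⁻¹) ∞ (lebesguePoisson d)

/-- The Banach space `𝓚_C` of functions `k` with `k · C^{-|·|} ∈ L^∞(Γ₀, λ)` and with norm
`‖k · C^{-|·|}‖_{L^∞(λ)}`. Its element `k` is stored as the class `u = k · C^{-|·|}` in `L^∞`, which
is an isometry; the function `k` itself is `KSpace.fn C u`. -/
abbrev KSpace (d : ℕ) : Type := Lp ℝ ∞ (lebesguePoisson d)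

/-- The function `k(η) = C^{|η|} u(η)` that an element `u` of `𝓚_C` stands for. -/
def KSpace.fn {d : ℕ} (C : ℝ) (u : KSpace d) : Conf d → ℝ := fun η => C ^ η.card * u η

/-- The subspace `𝓚_{αC}` of `𝓚_C`. -/
def subK (d : ℕ) (C α : ℝ) : Set (KSpace d) := {u | MemK (α * C) (u.fn C)}

/-- The closure of `𝓚_{αC}` in the norm of `𝓚_C`. -/
def closedSubK (d : ℕ) (C α : ℝ) : Set (KSpace d) := closure (subK d C α)

open Classical in
/-- The expression `(L̂_V G)(η) = -|η| G(η)
  + z ∑_{ξ ⊆ η} ∫ G(ξ ∪ x) e_λ(-φ(x - ·), η \ ξ) dx`. -/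
def vlasovExpr {d : ℕ} (φ : Pt d → ℝ) (z : ℝ) (G : Conf d → ℝ) (η : Conf d) : ℝ :=
  -(η.card : ℝ) * G η +
    z * ∑ ξ ∈ Finset.powerset (α := Pt d) η,
      ∫ x : Pt d, G (insert x ξ : Finset (Pt d)) *
        lpExp (fun y => -φ (x - y)) ((η : Finset (Pt d)) \ ξ : Finset (Pt d))

/-- The graph of the operator `L̂_V` in `𝓛_C` with domain `𝓛_{2C}`. -/
def vlasovGraph {d : ℕ} (φ : Pt d → ℝ) (z C : ℝ) : Set (LSpace d C × LSpace d C) :=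
  {p | Integrable (p.1 : Conf d → ℝ) (lebesguePoissonWeighted d (2 * C)) ∧
    (p.2 : Conf d → ℝ) =ᵐ[lebesguePoisson d] vlasovExpr φ z p.1}

/-- The graph of the operator `L̂_V^*` in `𝓚_C`: the dual of the closure of
`(L̂_V, 𝓛_{2C})` with respect to the duality `⟪G, k⟫ = ∫ G k dλ` of `𝓛_C` and `𝓚_C`. -/
def vlasovDualGraph {d : ℕ} (φ : Pt d → ℝ) (z C : ℝ) : Set (KSpace d × KSpace d) :=
  {q | ∀ p ∈ closure (vlasovGraph φ z C),
    ∫ η, p.2 η * q.1.fn C η ∂(lebesguePoisson d) =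
      ∫ η, p.1 η * q.2.fn C η ∂(lebesguePoisson d)}

/-- The graph of the part of an operator (given by its graph `A`) in the subspace `Y`. -/
def partGraph {X : Type*} (A : Set (X × X)) (Y : Set X) : Set (X × X) :=
  {q | q ∈ A ∧ q.1 ∈ Y ∧ q.2 ∈ Y}

/-- `u` is a classical solution on `[0, ∞)` of `u' = A u`, `u(0) = x₀`: it is continuously
differentiable in norm, takes values in the domain of `A` and satisfies the equation for every
`t ≥ 0` (at `t = 0` with the one-sided derivative). The operator `A` is given by its graph. -/
def IsClassicalSolution {X : Type*} [NormedAddCommGroup X] [NormedSpace ℝ X]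
    (A : Set (X × X)) (x₀ : X) (u : ℝ → X) : Prop :=
  u 0 = x₀ ∧ ∃ v : ℝ → X, ContinuousOn v (Ici 0) ∧
    ∀ t ∈ Ici (0 : ℝ), HasDerivWithinAt u (v t) (Ici 0) t ∧ (u t, v t) ∈ A

/-- Well-posedness of the abstract Cauchy problem `u' = A u`, `u(0) = x₀` on the closed subspace `Y`,
for an operator `A` in `Y` given by its graph: `A` is single-valued and densely defined in `Y`, there
is exactly one classical solution for every `x₀` in the domain of `A`, and it depends continuously
on `x₀`, uniformly for `t` in bounded intervals. -/
structure WellPosed {X : Type*} [NormedAddCommGroup X] [NormedSpace ℝ X]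
    (Y : Set X) (A : Set (X × X)) : Prop where
  mem : ∀ p ∈ A, p.1 ∈ Y ∧ p.2 ∈ Y
  single_valued : ∀ x y y', (x, y) ∈ A → (x, y') ∈ A → y = y'
  dense_domain : Y ⊆ closure (Prod.fst '' A)
  exists_solution : ∀ p ∈ A, ∃ u : ℝ → X, IsClassicalSolution A p.1 u
  unique_solution : ∀ (x₀ : X) (u w : ℝ → X),
    IsClassicalSolution A x₀ u → IsClassicalSolution A x₀ w → EqOn u w (Ici 0)
  continuous_dependence : ∀ T : ℝ, 0 ≤ T → ∃ M : ℝ, ∀ (x₀ : X) (u : ℝ → X),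
    IsClassicalSolution A x₀ u → ∀ t ∈ Icc 0 T, ‖u t‖ ≤ M * ‖x₀‖

/-- `ρ` is a global bounded nonnegative solution on `[0, ∞)` of the Vlasov-type equation
`∂ₜ ρₜ(x) = -ρₜ(x) + z exp(-∫ ρₜ(y) φ(x - y) dy)` with initial value `ρ₀`, for a.a. `x`. -/
structure IsVlasovSolution {d : ℕ} (φ : Pt d → ℝ) (z : ℝ) (ρ₀ : Pt d → ℝ)
    (ρ : ℝ → Pt d → ℝ) : Prop where
  measurable : ∀ t, 0 ≤ t → Measurable (ρ t)
  nonneg : ∀ t, 0 ≤ t → ∀ᵐ x, 0 ≤ ρ t x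
  bounded : ∃ B : ℝ, ∀ t, 0 ≤ t → ∀ᵐ x, ρ t x ≤ B
  initial : ∀ᵐ x, ρ 0 x = ρ₀ x
  equation : ∀ᵐ x, ∀ t, 0 ≤ t →
    HasDerivWithinAt (fun s => ρ s x)
      (-ρ t x + z * Real.exp (-∫ y, ρ t y * φ (x - y))) (Ici 0) t

end Glauber

end

/-! Dividing by `C ^ |η|` turns 𝓚_C into L^∞(λ), graded by N = |η|. The formulas of Mecke and Minlos
turn the pairing of the birth part of L̂_V G with k, and that of G with the dual birth part of k,
into one triple integral of G(w ∪ x) ∏ⱼ(-φ(x - yⱼ)) k(w ∪ y) over x, w, y (`integral_birth_mul`).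
Hence the dual of the closure is explicit, with maximal domain (`mem_vlasovDualGraph_iff`): it sends
k to -|η| k(η) + z ∑_{x ∈ η} ∫ k(η \ x ∪ y) ∏ⱼ(-φ(x - yⱼ)) dλ(y).

In L^∞ this reads -N + B. At grade n, B u sees u only in grades at least n - 1 and is bounded by n z
e^{Cβ} / C times the supremum of |u| there, because ∫ C^{|y|} ∏ⱼ φ(x - yⱼ) dλ(y) = e^{Cβ}. The
smallness z e^{Cβ} ≤ C makes this at most n: death balances birth in every grade (`Dominated`). B is
stored as (1 + N) S, with S a bounded linear map.

The closure of 𝓚_{αC} consists of the u that tend to 0 uniformly as N → ∞, whatever α in (0, 1) is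
(`closedSubK_eq_vanishing`). Away from finitely many grades such a u is small, so a maximum
principle applies and the part of -N + B there is dissipative (`gradedGraph_dissipative`). The
resolvent equation (1 + hN) u = y + h B u is a borderline contraction; it is solved by damping B,
keeping the solutions under an envelope of order n^{-2} that does not depend on the damping, and
passing to the limit (`gradedGraph_range`). Truncations give density of the domain, and
Hille–Yosida, proved by Yosida approximation, gives well-posedness.

The Vlasov-type equation is solved by iterating Duhamel's formula, a contraction with factor 1/2 in
the supremum norm weighted by e^{-2zβt}; the interval [0, αC] is invariant because z ≤ αC. The same
weight gives uniqueness.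

For k = e_λ(ρ) the integral over y is exp(-∫ ρ(y) φ(x - y) dy), so L̂_V^* e_λ(ρ) is the derivative
of e_λ at ρ along the right hand side of the Vlasov-type equation (`dual_lpExp`). Since ρ_t ≤ αC
with α < 1, the velocity in L^∞ and its Lipschitz constant in time are controlled by n αⁿ and n² αⁿ,
which are bounded. This upgrades pointwise derivatives to derivatives in norm. -/

namespace Glauber

open Filter Topology

/-! ### Dissipative evolutions and exponentials of bounded generators -/

section HilleYosida

variable {X : Type*} [NormedAddCommGroup X] [NormedSpace ℝ X]

/-- A `C¹` curve whose velocity is dissipative up to an error `δ` grows at most linearly with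
rate `δ`. -/
theorem norm_le_of_dissipative {u v : ℝ → X} {δ : ℝ} (hv : ContinuousOn v (Ici 0))
    (hu : ∀ t ∈ Ici (0 : ℝ), HasDerivWithinAt u (v t) (Ici 0) t)
    (hd : ∀ t ∈ Ici (0 : ℝ), ∀ h : ℝ, 0 < h → ‖u t‖ ≤ ‖u t - h • v t‖ + h * δ)
    {t : ℝ} (ht : 0 ≤ t) : ‖u t‖ ≤ ‖u 0‖ + δ * t := by
  have hcont : ContinuousOn u (Ici 0) := fun s hs => (hu s hs).continuousWithinAt
  refine image_le_of_liminf_slope_right_le_deriv_boundary (f := fun s => ‖u s‖)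
    (B := fun s => ‖u 0‖ + δ * s) (B' := fun _ => δ) (a := 0) (b := t) ?_ (by simp) (by fun_prop)
    ?_ ?_ ⟨ht, le_refl t⟩
  · exact (hcont.mono Icc_subset_Ici_self).norm
  · intro x _
    have : HasDerivAt (fun s : ℝ => ‖u 0‖ + δ * s) δ x := by
      simpa using ((hasDerivAt_id x).const_mul δ).const_add ‖u 0‖
    exact this.hasDerivWithinAt
  · intro x hx r hr
    refine Eventually.frequently ?_
    have hx0 : (0 : ℝ) ≤ x := hx.1
    have hsub : Ioi x ⊆ Ici (0 : ℝ) := fun y hy => hx0.trans (le_of_lt hy)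
    have h1 : Tendsto (slope u x) (𝓝[>] x) (𝓝 (v x)) := by
      have := (hu x hx0).mono hsub
      rwa [hasDerivWithinAt_iff_tendsto_slope' (by simp)] at this
    have h2 : Tendsto v (𝓝[>] x) (𝓝 (v x)) := (hv x hx0).mono_left (nhdsWithin_mono _ hsub)
    have h3 : Tendsto (fun y => ‖slope u x y - v y‖) (𝓝[>] x) (𝓝 0) := by
      simpa using (h1.sub h2).norm
    filter_upwards [h3.eventually_lt_const (sub_pos.2 hr), self_mem_nhdsWithin] with y hy hxy
    have hxy' : 0 < y - x := sub_pos.2 hxy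
    -- Dissipativity is used at the later time y with step y - x, as in backward Euler: u y - (y -
    -- x) • v y is u x up to o(y - x), because the slope and v y both tend to v x.
    have h4 := hd y (hsub hxy) (y - x) hxy'
    have h5 : u y - (y - x) • v y = u x + (y - x) • (slope u x y - v y) := by
      rw [slope_def_module, smul_sub, smul_smul, mul_inv_cancel₀ hxy'.ne', one_smul]
      abel
    have h6 : ‖u y - (y - x) • v y‖ ≤ ‖u x‖ + (y - x) * ‖slope u x y - v y‖ := by
      rw [h5]
      refine (norm_add_le _ _).trans ?_
      rw [norm_smul, Real.norm_of_nonneg hxy'.le]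
    rw [slope_def_field, div_lt_iff₀ hxy']
    nlinarith

/-- The bounded operator `c (J - 1)` with `J` a contraction is dissipative. -/
theorem norm_le_norm_sub_smul_of_contraction {J : X →L[ℝ] X} (hJ : ‖J‖ ≤ 1) {c : ℝ} (hc : 0 ≤ c)
    (x : X) {h : ℝ} (hh : 0 ≤ h) : ‖x‖ ≤ ‖x - h • (c • (J x - x))‖ := by
  have h1 : x - h • (c • (J x - x)) = (1 + h * c) • x - (h * c) • J x := by module
  have h2 : ‖J x‖ ≤ ‖x‖ := by simpa using J.le_of_opNorm_le hJ x
  have hhc : 0 ≤ h * c := mul_nonneg hh hc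
  rw [h1]
  have h3 := norm_sub_norm_le ((1 + h * c) • x) ((h * c) • J x)
  rw [norm_smul, norm_smul, Real.norm_of_nonneg (by linarith), Real.norm_of_nonneg hhc] at h3
  nlinarith [mul_le_mul_of_nonneg_left h2 hhc]

/-- The semigroup generated by the bounded operator `c (J - 1)`. -/
noncomputable def jumpExp (J : X →L[ℝ] X) (c t : ℝ) : X →L[ℝ] X :=
  NormedSpace.exp (t • (c • (J - 1)))

theorem jumpExp_zero (J : X →L[ℝ] X) (c : ℝ) : jumpExp J c 0 = 1 := by
  simp [jumpExp, NormedSpace.exp_zero]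

theorem commute_jumpExp {J K : X →L[ℝ] X} (h : Commute J K) (c t : ℝ) :
    Commute K (jumpExp J c t) := by
  have h0 : Commute K (t • (c • (J - 1))) :=
    ((h.symm.sub_right (Commute.one_right K)).smul_right c).smul_right t
  let : NormedAlgebra ℚ (X →L[ℝ] X) := NormedAlgebra.restrictScalars ℚ ℝ _
  exact h0.exp_right

theorem jumpExp_comm_apply {J K : X →L[ℝ] X} (h : Commute J K) (c t : ℝ) (x : X) :
    K (jumpExp J c t x) = jumpExp J c t (K x) :=
  congrArg (fun T : X →L[ℝ] X => T x) (commute_jumpExp h c t).eq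

variable [CompleteSpace X]

theorem hasDerivAt_jumpExp (J : X →L[ℝ] X) (c t : ℝ) (x : X) :
    HasDerivAt (fun s => jumpExp J c s x) (c • (J (jumpExp J c t x) - jumpExp J c t x)) t := by
  have h := hasDerivAt_exp_smul_const' (c • (J - 1)) t
  have h2 := ((ContinuousLinearMap.apply ℝ X x).hasFDerivAt.comp_hasDerivAt t h)
  simpa [jumpExp, Function.comp_def] using h2

theorem norm_jumpExp_apply_le {J : X →L[ℝ] X} (hJ : ‖J‖ ≤ 1) {c : ℝ} (hc : 0 ≤ c) {t : ℝ}
    (ht : 0 ≤ t) (x : X) : ‖jumpExp J c t x‖ ≤ ‖x‖ := by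
  have hcont : Continuous fun s => jumpExp J c s x :=
    continuous_iff_continuousAt.2 fun s => (hasDerivAt_jumpExp J c s x).continuousAt
  have := norm_le_of_dissipative (δ := 0) (u := fun s => jumpExp J c s x)
    (v := fun s => c • (J (jumpExp J c s x) - jumpExp J c s x))
    (by fun_prop) (fun s _ => (hasDerivAt_jumpExp J c s x).hasDerivWithinAt)
    (fun s _ h hh => by simpa using norm_le_norm_sub_smul_of_contraction hJ hc _ hh.le) ht
  simpa [jumpExp_zero] using this

/-- Two commuting semigroups of this kind differ by at most `t` times the difference of their
generators. -/
theorem norm_jumpExp_sub_le {J K : X →L[ℝ] X} (hJ : ‖J‖ ≤ 1) (hK : ‖K‖ ≤ 1) (hJK : Commute J K)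
    {c e : ℝ} (hc : 0 ≤ c) (he : 0 ≤ e) {t : ℝ} (ht : 0 ≤ t) (x : X) :
    ‖jumpExp J c t x - jumpExp K e t x‖ ≤ ‖c • (J x - x) - e • (K x - x)‖ * t := by
  have hcont : ∀ (J : X →L[ℝ] X) (c : ℝ), Continuous fun s => jumpExp J c s x := fun J c =>
    continuous_iff_continuousAt.2 fun s => (hasDerivAt_jumpExp J c s x).continuousAt
  have h1 := hcont J c
  have h2 := hcont K e
  have := norm_le_of_dissipative (δ := ‖c • (J x - x) - e • (K x - x)‖)
    (u := fun s => jumpExp J c s x - jumpExp K e s x)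
    (v := fun s => c • (J (jumpExp J c s x) - jumpExp J c s x)
      - e • (K (jumpExp K e s x) - jumpExp K e s x))
    (by fun_prop)
    (fun s _ => ((hasDerivAt_jumpExp J c s x).sub (hasDerivAt_jumpExp K e s x)).hasDerivWithinAt)
    ?_ ht
  · simpa [jumpExp_zero] using this
  intro s hs h hh
  set a := jumpExp J c s x
  set b := jumpExp K e s x with hb
  have h3 := norm_le_norm_sub_smul_of_contraction hJ hc (a - b) hh.le
  -- The generator of the first semigroup is dissipative on a - b. What it leaves over is the
  -- difference of the two generators at b, which by commutation is the second semigroup applied to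
  -- that difference at x.
  have h4 : a - b - h • (c • (J (a - b) - (a - b)))
      = (a - b - h • (c • (J a - a) - e • (K b - b)))
        + h • (c • (J b - b) - e • (K b - b)) := by
    rw [map_sub]; module
  have h5 : c • (J b - b) - e • (K b - b)
      = jumpExp K e s (c • (J x - x) - e • (K x - x)) := by
    rw [hb, jumpExp_comm_apply hJK.symm, jumpExp_comm_apply (Commute.refl K)]
    simp only [map_sub, map_smul]
  rw [h4] at h3
  refine h3.trans ((norm_add_le _ _).trans ?_)
  rw [norm_smul, Real.norm_of_nonneg hh.le, h5]
  gcongr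
  exact norm_jumpExp_apply_le hK he hs _

end HilleYosida

/-! ### The Hille–Yosida theorem for operators given by graphs -/

section Generation

variable {X : Type*} [NormedAddCommGroup X] [NormedSpace ℝ X]

/-- Dissipativity of the difference p - q makes 1 - hA injective; this yields linearity of the
resolvent below. -/
theorem eq_of_dissipative {A : Submodule ℝ (X × X)}
    (hdis : ∀ p ∈ A, ∀ h : ℝ, 0 < h → ‖p.1‖ ≤ ‖p.1 - h • p.2‖) {h : ℝ} (hh : 0 < h)
    {p q : X × X} (hp : p ∈ A) (hq : q ∈ A) (h_eq : p.1 - h • p.2 = q.1 - h • q.2) :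
    p.1 = q.1 := by
  have h1 := hdis _ (A.sub_mem hp hq) h hh
  have h2 : (p - q).1 - h • (p - q).2 = 0 := by
    simp only [Prod.fst_sub, Prod.snd_sub, smul_sub]
    rw [sub_sub_sub_comm, h_eq, sub_self]
  rw [h2, norm_zero] at h1
  exact sub_eq_zero.1 (norm_le_zero_iff.1 h1)

/-- The resolvent of a dissipative operator, given by its graph, that satisfies the range
condition. -/
theorem exists_resolvent {A : Submodule ℝ (X × X)}
    (hdis : ∀ p ∈ A, ∀ h : ℝ, 0 < h → ‖p.1‖ ≤ ‖p.1 - h • p.2‖) {h : ℝ} (hh : 0 < h)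
    (hrange : ∀ y, ∃ p ∈ A, p.1 - h • p.2 = y) :
    ∃ J : X →L[ℝ] X, ‖J‖ ≤ 1 ∧ (∀ y, (J y, h⁻¹ • (J y - y)) ∈ A) ∧
      ∀ p ∈ A, J (p.1 - h • p.2) = p.1 := by
  choose F hFA hF using hrange
  have huniq : ∀ p ∈ A, (F (p.1 - h • p.2)).1 = p.1 := fun p hp =>
    eq_of_dissipative hdis hh (hFA _) hp (hF _)
  let L : X →ₗ[ℝ] X :=
    { toFun := fun y => (F y).1
      map_add' := fun y y' => by
        have := huniq _ (A.add_mem (hFA y) (hFA y'))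
        have h2 : (F y + F y').1 - h • (F y + F y').2 = y + y' := by
          conv_rhs => rw [← hF y, ← hF y']
          simp only [Prod.fst_add, Prod.snd_add]; module
        rwa [h2] at this
      map_smul' := fun c y => by
        have := huniq _ (A.smul_mem c (hFA y))
        have h2 : (c • F y).1 - h • (c • F y).2 = c • y := by
          conv_rhs => rw [← hF y]
          simp only [Prod.smul_fst, Prod.smul_snd]; module
        rwa [h2] at this }
  have hL : ∀ y, ‖L y‖ ≤ 1 * ‖y‖ := fun y => by
    have := hdis _ (hFA y) h hh
    rwa [hF, ← one_mul ‖y‖] at this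
  refine ⟨L.mkContinuous 1 hL, L.mkContinuous_norm_le zero_le_one hL, fun y => ?_, huniq⟩
  have h3 : h⁻¹ • ((F y).1 - y) = (F y).2 := by
    have : (F y).1 - y = h • (F y).2 := by
      rw [sub_eq_iff_eq_add, ← sub_eq_iff_eq_add', hF]
    rw [this, smul_smul, inv_mul_cancel₀ hh.ne', one_smul]
  change ((F y).1, h⁻¹ • ((F y).1 - y)) ∈ A
  rw [h3]
  exact hFA y

/-- A three-epsilon argument. It extends convergence of the Yosida semigroups from the domain, where
the generators converge, to the whole space. -/
theorem cauchySeq_of_dense {Z : Type*} [NormedAddCommGroup Z] {F : ℕ → Z → Z} (hF : ∀ k y y', ‖F k y - F k y'‖ ≤ ‖y - y'‖)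
    {D : Set Z} (hD : Dense D) (h : ∀ y ∈ D, CauchySeq fun k => F k y) (y : Z) :
    CauchySeq fun k => F k y := by
  rw [Metric.cauchySeq_iff']
  intro ε hε
  obtain ⟨x, hxD, hx⟩ := Metric.dense_iff.1 hD y (ε / 3) (by positivity)
  obtain ⟨M, hM⟩ := Metric.cauchySeq_iff'.1 (h _ hx) (ε / 3) (by positivity)
  refine ⟨M, fun n hn => ?_⟩
  have h1 := hM n hn
  have h2 := hF n y x
  have h3 := hF M x y
  rw [Metric.mem_ball, dist_eq_norm] at hxD
  rw [dist_eq_norm] at h1 ⊢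
  rw [norm_sub_rev y x] at h2
  have h4 : F n y - F M y = (F n y - F n x) + (F n x - F M x) + (F M x - F M y) := by abel
  rw [h4]
  refine (norm_add₃_le).trans_lt ?_
  linarith

theorem tendsto_of_dense {Z : Type*} [NormedAddCommGroup Z] {F : ℕ → Z → Z} (hF : ∀ k y y', ‖F k y - F k y'‖ ≤ ‖y - y'‖)
    {D : Set Z} (hD : Dense D) (h : ∀ y ∈ D, Tendsto (fun k => F k y) atTop (𝓝 y)) (y : Z) :
    Tendsto (fun k => F k y) atTop (𝓝 y) := by
  rw [Metric.tendsto_atTop]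
  intro ε hε
  obtain ⟨x, hxD, hx⟩ := Metric.dense_iff.1 hD y (ε / 3) (by positivity)
  obtain ⟨M, hM⟩ := Metric.tendsto_atTop.1 (h _ hx) (ε / 3) (by positivity)
  refine ⟨M, fun n hn => ?_⟩
  have h1 := hM n hn
  have h2 := hF n y x
  rw [Metric.mem_ball, dist_eq_norm] at hxD
  rw [dist_eq_norm] at h1 ⊢
  rw [norm_sub_rev y x] at h2
  have h4 : F n y - y = (F n y - F n x) + (F n x - x) + (x - y) := by abel
  rw [h4]
  refine (norm_add₃_le).trans_lt ?_
  linarith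

/-- **Hille--Yosida theorem** (existence part) for a closed, densely defined, dissipative operator
given by its graph, whose resolvent is everywhere defined near infinity. -/
theorem exists_isClassicalSolution [CompleteSpace X] {A : Submodule ℝ (X × X)}
    (hclosed : IsClosed (A : Set (X × X)))
    (hdis : ∀ p ∈ A, ∀ h : ℝ, 0 < h → ‖p.1‖ ≤ ‖p.1 - h • p.2‖) {h₀ : ℝ} (hh₀ : 0 < h₀)
    (hrange : ∀ h, 0 < h → h < h₀ → ∀ y, ∃ p ∈ A, p.1 - h • p.2 = y)
    (hdense : Dense (Prod.fst '' (A : Set (X × X)))) {p : X × X} (hp : p ∈ A) :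
    ∃ u : ℝ → X, IsClassicalSolution (A : Set (X × X)) p.1 u := by
  -- Any null sequence inside (0, h₀) would do; the shift by 2 keeps it strictly below h₀ at k = 0.
  set a : ℕ → ℝ := fun k => h₀ / ((k : ℝ) + 2) with ha_def
  have ha : ∀ k, 0 < a k := fun k => by positivity
  have ha' : ∀ k, a k < h₀ := fun k => by
    rw [ha_def]; dsimp only
    rw [div_lt_iff₀ (by positivity)]
    nlinarith [(Nat.cast_nonneg k : (0 : ℝ) ≤ k)]
  have ha0 : Tendsto a atTop (𝓝 0) :=
    tendsto_const_nhds.div_atTop (tendsto_atTop_add_const_right _ _ tendsto_natCast_atTop_atTop)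
  choose J hJ hJA hJinv using fun k => exists_resolvent hdis (ha k) (hrange _ (ha k) (ha' k))
  have hJle : ∀ k y, ‖J k y‖ ≤ ‖y‖ := fun k y => by simpa using (J k).le_of_opNorm_le (hJ k) y
  -- The Yosida approximation equals J_k A on the domain, hence is bounded there uniformly in k.
  have hYos : ∀ k, ∀ q ∈ A, (a k)⁻¹ • (J k q.1 - q.1) = J k q.2 := by
    intro k q hq
    have h1 := hJinv k q hq
    rw [map_sub, map_smul] at h1
    have h2 : J k q.1 - q.1 = a k • J k q.2 := by
      nth_rewrite 2 [← h1]; abel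
    rw [h2, smul_smul, inv_mul_cancel₀ (ha k).ne', one_smul]
  -- J_l maps the element of the graph over J_k y to another element of the graph, whose image under
  -- 1 - a_k A is J_l y; applying J_k to this identity gives the claim.
  have hcomm : ∀ k l, Commute (J k) (J l) := by
    intro k l
    ext y
    have h1 := hJA k y
    have h2 := hJA l (J k y)
    rw [hYos l _ h1, map_smul, map_sub] at h2
    have h3 := hJinv k _ h2
    dsimp only at h3
    rw [smul_smul, mul_inv_cancel₀ (ha k).ne', one_smul, sub_sub_cancel] at h3
    exact h3
  have hJlim : ∀ y, Tendsto (fun k => J k y) atTop (𝓝 y) := by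
    refine tendsto_of_dense (fun k y y' => by rw [← map_sub]; exact hJle k _) hdense ?_
    rintro _ ⟨q, hq, rfl⟩
    rw [tendsto_iff_norm_sub_tendsto_zero]
    have h1 : ∀ k, ‖J k q.1 - q.1‖ ≤ a k * ‖q.2‖ := fun k => by
      have := hYos k q hq
      rw [inv_smul_eq_iff₀ (ha k).ne'] at this
      rw [this, norm_smul, Real.norm_of_nonneg (ha k).le]
      exact mul_le_mul_of_nonneg_left (hJle k _) (ha k).le
    refine squeeze_zero (fun _ => norm_nonneg _) h1 ?_
    simpa using ha0.mul_const ‖q.2‖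
  have hc : ∀ k, 0 ≤ (a k)⁻¹ := fun k => (inv_pos.2 (ha k)).le
  set S : ℕ → ℝ → X → X := fun k t y => jumpExp (J k) (a k)⁻¹ t y with hS
  have hSle : ∀ k t, 0 ≤ t → ∀ y, ‖S k t y‖ ≤ ‖y‖ := fun k t ht y =>
    norm_jumpExp_apply_le (hJ k) (hc k) ht y
  have hSsub : ∀ k t, 0 ≤ t → ∀ y y', ‖S k t y - S k t y'‖ ≤ ‖y - y'‖ := fun k t ht y y' => by
    have : S k t y - S k t y' = S k t (y - y') := by simp [hS, map_sub]
    rw [this]; exact hSle k t ht _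
  have hSderiv : ∀ k t y, HasDerivAt (fun s => S k s y) (S k t ((a k)⁻¹ • (J k y - y))) t := by
    intro k t y
    have := hasDerivAt_jumpExp (J k) (a k)⁻¹ t y
    rw [jumpExp_comm_apply (Commute.refl _), ← map_sub, ← map_smul] at this
    exact this
  have hCauchy : ∀ t, 0 ≤ t → ∀ y, CauchySeq fun k => S k t y := by
    intro t ht
    refine cauchySeq_of_dense (fun k y y' => hSsub k t ht y y') hdense ?_
    rintro _ ⟨q, hq, rfl⟩
    have hq2 := (hJlim q.2).cauchySeq
    rw [Metric.cauchySeq_iff] at hq2 ⊢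
    intro ε hε
    obtain ⟨M, hM⟩ := hq2 (ε / (t + 1)) (by positivity)
    refine ⟨M, fun m hm n hn => ?_⟩
    have h1 := norm_jumpExp_sub_le (hJ m) (hJ n) (hcomm m n) (hc m) (hc n) ht q.1
    rw [hYos m q hq, hYos n q hq] at h1
    have h2 := hM m hm n hn
    rw [dist_eq_norm] at h2 ⊢
    rw [lt_div_iff₀ (by positivity)] at h2
    refine h1.trans_lt (lt_of_le_of_lt ?_ h2)
    gcongr
    linarith
  choose! T hT using fun t (ht : 0 ≤ t) y => cauchySeq_tendsto_of_complete (hCauchy t ht y)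
  have hTlip : ∀ q ∈ A, ∀ s, 0 ≤ s → ∀ t, 0 ≤ t → ‖T t q.1 - T s q.1‖ ≤ ‖q.2‖ * ‖t - s‖ := by
    intro q hq s hs t ht
    refine le_of_tendsto ((hT t ht q.1).sub (hT s hs q.1)).norm (Eventually.of_forall fun k => ?_)
    refine Convex.norm_image_sub_le_of_norm_hasDerivWithin_le (s := Ici (0 : ℝ))
      (fun r _ => (hSderiv k r q.1).hasDerivWithinAt) ?_ (convex_Ici _) hs ht
    intro r hr
    rw [hYos k q hq]
    exact (hSle k r hr _).trans (hJle k _)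
  have hTsub : ∀ t, 0 ≤ t → ∀ y y', ‖T t y - T t y'‖ ≤ ‖y - y'‖ := fun t ht y y' =>
    le_of_tendsto ((hT t ht y).sub (hT t ht y')).norm
      (Eventually.of_forall fun k => hSsub k t ht y y')
  have hTcont : ∀ y, ContinuousOn (fun t => T t y) (Ici 0) := by
    intro y
    rw [Metric.continuousOn_iff]
    intro s hs ε hε
    obtain ⟨_, hxD, q, hq, rfl⟩ := Metric.dense_iff.1 hdense y (ε / 4) (by positivity)
    rw [Metric.mem_ball, dist_eq_norm] at hxD
    refine ⟨ε / (4 * (‖q.2‖ + 1)), by positivity, fun t ht hts => ?_⟩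
    rw [dist_eq_norm] at hts ⊢
    rw [lt_div_iff₀ (by positivity)] at hts
    have h1 := hTsub t ht y q.1
    have h2 := hTsub s hs q.1 y
    have h3 := hTlip q hq s hs t ht
    rw [norm_sub_rev y] at h1
    have h4 : T t y - T s y = (T t y - T t q.1) + (T t q.1 - T s q.1) + (T s q.1 - T s y) := by
      abel
    rw [h4]
    refine norm_add₃_le.trans_lt ?_
    nlinarith [norm_nonneg (t - s), norm_nonneg q.2]
  have hvlim : ∀ t, 0 ≤ t →
      Tendsto (fun k => S k t ((a k)⁻¹ • (J k p.1 - p.1))) atTop (𝓝 (T t p.2)) := by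
    intro t ht
    have h1 : Tendsto (fun k => S k t ((a k)⁻¹ • (J k p.1 - p.1)) - S k t p.2) atTop (𝓝 0) := by
      refine squeeze_zero_norm (fun k => hSsub k t ht _ _) ?_
      simp_rw [hYos _ p hp]
      simpa using ((hJlim p.2).sub_const p.2).norm
    simpa using h1.add (hT t ht p.2)
  -- The limit semigroup T has arbitrary values at negative times, so the integrand is cut off at 0
  -- to be continuous on the whole line.
  have hulim : ∀ t, 0 ≤ t → T t p.1 = p.1 + ∫ s in (0 : ℝ)..t, T (max s 0) p.2 := by
    intro t ht
    have h1 : ∀ k, S k t p.1 = p.1 + ∫ s in (0 : ℝ)..t, S k s ((a k)⁻¹ • (J k p.1 - p.1)) := by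
      intro k
      have hcts : Continuous fun s => S k s ((a k)⁻¹ • (J k p.1 - p.1)) :=
        continuous_iff_continuousAt.2 fun s => (hSderiv k s _).continuousAt
      rw [intervalIntegral.integral_eq_sub_of_hasDerivAt (fun s _ => hSderiv k s p.1)
        (hcts.intervalIntegrable _ _)]
      simp [hS, jumpExp_zero]
    refine tendsto_nhds_unique (hT t ht p.1) ?_
    simp_rw [h1]
    refine Tendsto.const_add _ ?_
    refine intervalIntegral.tendsto_integral_filter_of_dominated_convergence (fun _ => ‖p.2‖)
      ?_ ?_ (by simp) ?_
    · refine Eventually.of_forall fun k => Continuous.aestronglyMeasurable ?_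
      exact continuous_iff_continuousAt.2 fun s => (hSderiv k s _).continuousAt
    · refine Eventually.of_forall fun k => Eventually.of_forall fun s hs => ?_
      rw [uIoc_of_le ht] at hs
      rw [hYos k p hp]
      exact (hSle k s hs.1.le _).trans (hJle k _)
    · refine Eventually.of_forall fun s hs => ?_
      rw [uIoc_of_le ht] at hs
      rw [max_eq_left hs.1.le]
      exact hvlim s hs.1.le
  have hwcont : Continuous fun s : ℝ => T (max s 0) p.2 :=
    (hTcont p.2).comp_continuous (by fun_prop) fun s => mem_Ici.2 (le_max_right _ _)
  refine ⟨fun t => T t p.1, by simpa using hulim 0 le_rfl, fun t => T t p.2, hTcont p.2,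
    fun t ht => ⟨?_, ?_⟩⟩
  · have h1 : HasDerivAt (fun t => p.1 + ∫ s in (0 : ℝ)..t, T (max s 0) p.2)
        (T (max t 0) p.2) t :=
      (intervalIntegral.integral_hasDerivAt_right (hwcont.intervalIntegrable _ _)
        (hwcont.stronglyMeasurableAtFilter _ _) hwcont.continuousAt).const_add _
    rw [max_eq_left ht] at h1
    exact h1.hasDerivWithinAt.congr (fun s hs => hulim s hs) (hulim t ht)
  -- Membership of the limit in the graph comes from closedness: J_k composed with the k-th Yosida
  -- semigroup yields elements of the graph, and both components converge.
  · have h1 : ∀ k, (J k (S k t p.1), S k t ((a k)⁻¹ • (J k p.1 - p.1))) ∈ A := by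
      intro k
      have := hJA k (S k t p.1)
      have h2 : (a k)⁻¹ • (J k (S k t p.1) - S k t p.1) = S k t ((a k)⁻¹ • (J k p.1 - p.1)) := by
        simp only [hS]
        rw [jumpExp_comm_apply (Commute.refl _), ← map_sub, ← map_smul]
      rwa [h2] at this
    have h2 : Tendsto (fun k => J k (S k t p.1)) atTop (𝓝 (T t p.1)) := by
      have h3 : Tendsto (fun k => J k (S k t p.1) - J k (T t p.1)) atTop (𝓝 0) := by
        refine squeeze_zero_norm (fun k => ?_)
          (by simpa using ((hT t ht p.1).sub_const (T t p.1)).norm)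
        rw [← map_sub]
        exact hJle k _
      simpa using h3.add (hJlim (T t p.1))
    exact hclosed.mem_of_tendsto (h2.prodMk_nhds (hvlim t ht)) (Eventually.of_forall h1)

/-- An operator in a closed subspace `Y` of a Banach space that is closed, dissipative, densely
defined and satisfies the range condition gives a well-posed Cauchy problem on `Y`. -/
theorem wellPosed_of_dissipative [CompleteSpace X] {Y : Submodule ℝ X} {A : Submodule ℝ (X × X)}
    (hY : IsClosed (Y : Set X)) (hclosed : IsClosed (A : Set (X × X)))
    (hmem : ∀ p ∈ A, p.1 ∈ Y ∧ p.2 ∈ Y)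
    (hdis : ∀ p ∈ A, ∀ h : ℝ, 0 < h → ‖p.1‖ ≤ ‖p.1 - h • p.2‖) {h₀ : ℝ} (hh₀ : 0 < h₀)
    (hrange : ∀ h, 0 < h → h < h₀ → ∀ y ∈ Y, ∃ p ∈ A, p.1 - h • p.2 = y)
    (hsingle : ∀ y, ((0 : X), y) ∈ A → y = 0)
    (hdense : (Y : Set X) ⊆ closure (Prod.fst '' (A : Set (X × X)))) :
    WellPosed (Y : Set X) (A : Set (X × X)) := by
  have hbound : ∀ (v u : ℝ → X), ContinuousOn v (Ici 0) →
      (∀ t ∈ Ici (0 : ℝ), HasDerivWithinAt u (v t) (Ici 0) t) →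
      (∀ t ∈ Ici (0 : ℝ), (u t, v t) ∈ A) → ∀ t ∈ Ici (0 : ℝ), ‖u t‖ ≤ ‖u 0‖ := by
    intro v u hv hu huv t ht
    simpa using norm_le_of_dissipative (δ := 0) hv hu
      (fun s hs h hh => by simpa using hdis _ (huv s hs) h hh) ht
  refine ⟨hmem, ?_, hdense, ?_, ?_, ?_⟩
  · intro x y y' h1 h2
    have := A.sub_mem h1 h2
    rw [Prod.mk_sub_mk, sub_self] at this
    exact sub_eq_zero.1 (hsingle _ this)
  · intro p hp
    have : CompleteSpace Y := hY.completeSpace_coe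
    -- The domain is dense in Y only, so the existence theorem is applied to A viewed as a graph in
    -- the Banach space Y.
    let ι : (Y × Y) →L[ℝ] (X × X) := Y.subtypeL.prodMap Y.subtypeL
    have hdense' : Dense (Prod.fst '' ((A.comap (ι : (Y × Y) →ₗ[ℝ] (X × X)) :
        Submodule ℝ (Y × Y)) : Set (Y × Y))) := by
      rw [Metric.dense_iff]
      intro y r hr
      obtain ⟨x, ⟨q, hq, rfl⟩, hx⟩ := Metric.mem_closure_iff.1 (hdense y.2) r hr
      refine ⟨⟨q.1, (hmem q hq).1⟩, ?_, ⟨(⟨q.1, (hmem q hq).1⟩, ⟨q.2, (hmem q hq).2⟩), hq, rfl⟩⟩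
      rw [Metric.mem_ball, dist_comm]
      exact hx
    obtain ⟨u, hu0, v, hv, huv⟩ := exists_isClassicalSolution
      (A := A.comap (ι : (Y × Y) →ₗ[ℝ] (X × X))) (hclosed.preimage ι.continuous)
      (fun q hq h hh => hdis _ hq h hh) hh₀ (fun h hh hh' y => by
        obtain ⟨q, hq, hqy⟩ := hrange h hh hh' y y.2
        exact ⟨(⟨q.1, (hmem q hq).1⟩, ⟨q.2, (hmem q hq).2⟩), hq, Subtype.ext hqy⟩)
      hdense' (p := (⟨p.1, (hmem p hp).1⟩, ⟨p.2, (hmem p hp).2⟩)) hp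
    refine ⟨fun t => u t, congrArg Subtype.val hu0, fun t => v t, continuous_subtype_val.comp_continuousOn hv,
      fun t ht => ⟨?_, (huv t ht).2⟩⟩
    exact Y.subtypeL.hasFDerivAt.comp_hasDerivWithinAt t (huv t ht).1
  · rintro x₀ u w ⟨hu0, v, hv, hu⟩ ⟨hw0, v', hv', hw⟩ t ht
    have := hbound (fun s => v s - v' s) (fun s => u s - w s) (hv.sub hv')
      (fun s hs => (hu s hs).1.sub (hw s hs).1)
      (fun s hs => A.sub_mem (hu s hs).2 (hw s hs).2) t ht
    simp only [hu0, hw0, sub_self, norm_zero, norm_le_zero_iff] at this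
    exact sub_eq_zero.1 this
  · intro T _
    refine ⟨1, ?_⟩
    rintro x₀ u ⟨hu0, v, hv, hu⟩ t ht
    rw [one_mul, ← hu0]
    exact hbound v u hv (fun s hs => (hu s hs).1) (fun s hs => (hu s hs).2) t ht.1

end Generation

/-! ### Essentially bounded functions and vanishing along a grading -/

section Linfty

variable {Ω : Type*} [MeasurableSpace Ω] {μ : Measure Ω}

theorem ae_abs_le_norm (u : Lp ℝ ∞ μ) : ∀ᵐ η ∂μ, |u η| ≤ ‖u‖ := by
  have h := ae_le_eLpNormEssSup (f := u) (μ := μ)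
  filter_upwards [h] with η hη
  rw [Lp.norm_def, eLpNorm_exponent_top, ← Real.norm_eq_abs, ← toReal_enorm]
  refine ENNReal.toReal_mono ?_ hη
  rw [← eLpNorm_exponent_top]
  exact Lp.eLpNorm_ne_top u

theorem norm_le_of_ae_abs_le {u : Lp ℝ ∞ μ} {K : ℝ} (hK : 0 ≤ K) (h : ∀ᵐ η ∂μ, |u η| ≤ K) :
    ‖u‖ ≤ K := by
  rw [Lp.norm_def, eLpNorm_exponent_top]
  exact ENNReal.toReal_le_of_le_ofReal hK (eLpNormEssSup_le_of_ae_bound h)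

theorem exists_linfty_of_ae_abs_le {f : Ω → ℝ} (hf : AEStronglyMeasurable f μ) {K : ℝ}
    (h : ∀ᵐ η ∂μ, |f η| ≤ K) : ∃ u : Lp ℝ ∞ μ, u =ᵐ[μ] f :=
  ⟨(memLp_top_of_bound hf K h).toLp f, MemLp.coeFn_toLp _⟩

/-- Convergence in L^∞ is uniform off a null set, so pointwise envelopes survive limits. The fixed
point of the damped resolvent map inherits its decay in this way. -/
theorem isClosed_setOf_ae_abs_le (b : Ω → ℝ) : IsClosed {u : Lp ℝ ∞ μ | ∀ᵐ η ∂μ, |u η| ≤ b η} := by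
  refine isClosed_of_closure_subset fun u hu => ?_
  have h : ∀ k : ℕ, ∀ᵐ η ∂μ, |u η| ≤ b η + 1 / ((k : ℝ) + 1) := by
    intro k
    obtain ⟨w, hw, hwu⟩ := Metric.mem_closure_iff.1 hu (1 / ((k : ℝ) + 1)) (by positivity)
    rw [dist_eq_norm] at hwu
    filter_upwards [hw, ae_abs_le_norm (u - w), Lp.coeFn_sub u w] with η h1 h2 h3
    rw [h3, Pi.sub_apply] at h2
    have := abs_sub_abs_le_abs_sub (u η) (w η)
    linarith
  filter_upwards [ae_all_iff.2 h] with η hη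
  refine ge_of_tendsto' (x := atTop (α := ℕ)) ?_ hη
  simpa using (tendsto_const_nhds (x := b η)).add
    (tendsto_one_div_add_atTop_nhds_zero_nat (𝕜 := ℝ))

/-- The space of `u ∈ L^∞` that vanish at infinity with respect to the grading `N`. -/
def vanishing (μ : Measure Ω) (N : Ω → ℕ) : Submodule ℝ (Lp ℝ ∞ μ) where
  carrier := {u | ∀ ε : ℝ, 0 < ε → ∃ M : ℕ, ∀ᵐ η ∂μ, M ≤ N η → |u η| ≤ ε}
  zero_mem' := fun ε hε => ⟨0, by
    filter_upwards [Lp.coeFn_zero ℝ ∞ μ] with η hη _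
    rw [hη]; simpa using hε.le⟩
  add_mem' := by
    intro u w hu hw ε hε
    obtain ⟨M, hM⟩ := hu (ε / 2) (by positivity)
    obtain ⟨M', hM'⟩ := hw (ε / 2) (by positivity)
    refine ⟨max M M', ?_⟩
    filter_upwards [hM, hM', Lp.coeFn_add u w] with η h1 h2 h3 hη
    rw [h3, Pi.add_apply]
    have h4 := h1 ((le_max_left _ _).trans hη)
    have h5 := h2 ((le_max_right _ _).trans hη)
    exact (abs_add_le _ _).trans (by linarith)
  smul_mem' := by
    intro c u hu ε hε
    obtain ⟨M, hM⟩ := hu (ε / (|c| + 1)) (by positivity)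
    refine ⟨M, ?_⟩
    filter_upwards [hM, Lp.coeFn_smul c u] with η h1 h3 hη
    rw [h3, Pi.smul_apply, smul_eq_mul, abs_mul]
    have h4 := h1 hη
    rw [le_div_iff₀ (by positivity)] at h4
    nlinarith [abs_nonneg (u η)]

variable {N : Ω → ℕ}

theorem isClosed_vanishing : IsClosed (vanishing μ N : Set (Lp ℝ ∞ μ)) := by
  refine isClosed_of_closure_subset fun u hu ε hε => ?_
  obtain ⟨w, hw, hwu⟩ := Metric.mem_closure_iff.1 hu (ε / 2) (by positivity)
  rw [dist_eq_norm] at hwu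
  obtain ⟨M, hM⟩ := hw (ε / 2) (by positivity)
  refine ⟨M, ?_⟩
  filter_upwards [hM, ae_abs_le_norm (u - w), Lp.coeFn_sub u w] with η h1 h2 h3 hη
  rw [h3, Pi.sub_apply] at h2
  have := abs_sub_abs_le_abs_sub (u η) (w η)
  have := h1 hη
  linarith

/-- A bound by a null sequence of the grading gives membership in `vanishing`. -/
theorem mem_vanishing_of_ae_abs_le {u : Lp ℝ ∞ μ} {a : ℕ → ℝ} (ha : Tendsto a atTop (𝓝 0))
    (h : ∀ᵐ η ∂μ, |u η| ≤ a (N η)) : u ∈ vanishing μ N := by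
  intro ε hε
  obtain ⟨M, hM⟩ := eventually_atTop.1 (ha.eventually_le_const hε)
  refine ⟨M, ?_⟩
  filter_upwards [h] with η h1 hη
  exact h1.trans (hM _ hη)

/-- Cutting u off above a grade M costs at most ε, because u is small there. -/
theorem exists_truncation (hN : Measurable N) {u : Lp ℝ ∞ μ} (hu : u ∈ vanishing μ N) {ε : ℝ}
    (hε : 0 < ε) : ∃ (M : ℕ) (w : Lp ℝ ∞ μ), ‖w - u‖ ≤ ε ∧
      (∀ᵐ η ∂μ, |w η| ≤ if N η ≤ M then ‖u‖ else 0) := by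
  obtain ⟨M, hM⟩ := hu ε hε
  have hmeas : MeasurableSet {η | N η ≤ M} := hN measurableSet_Iic
  obtain ⟨w, hw⟩ := exists_linfty_of_ae_abs_le (K := ‖u‖)
    ((Lp.aestronglyMeasurable u).indicator hmeas) (by
      filter_upwards [ae_abs_le_norm u] with η hη
      by_cases h : N η ≤ M
      · rwa [indicator_of_mem (by exact h)]
      · rw [indicator_of_notMem (by exact h), abs_zero]
        exact norm_nonneg _)
  refine ⟨M, w, norm_le_of_ae_abs_le hε.le ?_, ?_⟩
  · filter_upwards [hw, hM, Lp.coeFn_sub w u] with η h1 h2 h3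
    rw [h3, Pi.sub_apply, h1]
    by_cases h : N η ≤ M
    · rw [indicator_of_mem (by exact h)]
      simpa using hε.le
    · rw [indicator_of_notMem (by exact h), zero_sub, abs_neg]
      exact h2 (not_le.1 h).le
  · filter_upwards [hw, ae_abs_le_norm u] with η h1 h2
    rw [h1]
    split_ifs with h
    · rwa [indicator_of_mem (by exact h)]
    · rw [indicator_of_notMem (by exact h), abs_zero]

end Linfty

/-! ### The graded operator: closedness and dissipativity -/

section Graded

variable {Ω : Type*} [MeasurableSpace Ω] {μ : Measure Ω} {N : Ω → ℕ}
  {S : Lp ℝ ∞ μ →ₗ[ℝ] Lp ℝ ∞ μ}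

/-- The graph of the part in `vanishing` of the operator `u ↦ -N u + (1 + N) S u` with maximal
domain in `L^∞`. -/
def gradedGraph (μ : Measure Ω) (N : Ω → ℕ) (S : Lp ℝ ∞ μ →ₗ[ℝ] Lp ℝ ∞ μ) :
    Submodule ℝ (Lp ℝ ∞ μ × Lp ℝ ∞ μ) where
  carrier := {p | (∀ᵐ η ∂μ, p.2 η = -(N η : ℝ) * p.1 η + (1 + (N η : ℝ)) * S p.1 η) ∧
    p.1 ∈ vanishing μ N ∧ p.2 ∈ vanishing μ N}
  zero_mem' := by
    refine ⟨?_, Submodule.zero_mem _, Submodule.zero_mem _⟩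
    simp only [Prod.fst_zero, Prod.snd_zero, map_zero]
    filter_upwards [Lp.coeFn_zero ℝ ∞ μ] with η hη
    have h0 : ((0 : Lp ℝ ∞ μ) : Ω → ℝ) η = 0 := hη
    rw [h0]
    ring
  add_mem' := by
    intro p q hp hq
    refine ⟨?_, Submodule.add_mem _ hp.2.1 hq.2.1, Submodule.add_mem _ hp.2.2 hq.2.2⟩
    simp only [Prod.fst_add, Prod.snd_add, map_add]
    filter_upwards [hp.1, hq.1, Lp.coeFn_add p.1 q.1, Lp.coeFn_add p.2 q.2,
      Lp.coeFn_add (S p.1) (S q.1)] with η h1 h2 h3 h4 h5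
    rw [h3, h4, h5, Pi.add_apply, Pi.add_apply, Pi.add_apply, h1, h2]
    ring
  smul_mem' := by
    intro c p hp
    refine ⟨?_, Submodule.smul_mem _ _ hp.2.1, Submodule.smul_mem _ _ hp.2.2⟩
    simp only [Prod.smul_fst, Prod.smul_snd, map_smul]
    filter_upwards [hp.1, Lp.coeFn_smul c p.1, Lp.coeFn_smul c p.2,
      Lp.coeFn_smul c (S p.1)] with η h1 h3 h4 h5
    rw [h3, h4, h5, Pi.smul_apply, Pi.smul_apply, Pi.smul_apply, h1]
    simp only [smul_eq_mul]
    ring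

/-- The domination property of the jump part: `(1 + N) S` lowers the grading by at most one, and
has norm at most `N` in grade `N`. -/
def Dominated (μ : Measure Ω) (N : Ω → ℕ) (S : Lp ℝ ∞ μ →ₗ[ℝ] Lp ℝ ∞ μ) : Prop :=
  ∀ (u : Lp ℝ ∞ μ) (a : ℕ → ℝ), Antitone a → (∀ n, 0 ≤ a n) →
    (∀ᵐ η ∂μ, |u η| ≤ a (N η)) →
    ∀ᵐ η ∂μ, (1 + (N η : ℝ)) * |S u η| ≤ (N η : ℝ) * a (N η - 1)

theorem Dominated.ae_le_norm (hS : Dominated μ N S) (u : Lp ℝ ∞ μ) :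
    ∀ᵐ η ∂μ, (1 + (N η : ℝ)) * |S u η| ≤ (N η : ℝ) * ‖u‖ :=
  hS u (fun _ => ‖u‖) antitone_const (fun _ => norm_nonneg _) (ae_abs_le_norm u)

/-- The operator is unbounded only through N, which is finite at each point: an error of 1/(k + 1)
in norm becomes (1 + 2N)/(k + 1) pointwise, and this still tends to 0. -/
theorem isClosed_gradedGraph (hS : Dominated μ N S) :
    IsClosed (gradedGraph μ N S : Set (Lp ℝ ∞ μ × Lp ℝ ∞ μ)) := by
  refine isClosed_of_closure_subset fun p hp => ⟨?_, ?_, ?_⟩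
  · have h : ∀ k : ℕ, ∀ᵐ η ∂μ, |p.2 η + (N η : ℝ) * p.1 η - (1 + (N η : ℝ)) * S p.1 η|
        ≤ (1 + 2 * (N η : ℝ)) * (1 / ((k : ℝ) + 1)) := by
      intro k
      obtain ⟨q, hq, hqp⟩ := Metric.mem_closure_iff.1 hp (1 / ((k : ℝ) + 1)) (by positivity)
      rw [Prod.dist_eq, max_lt_iff, dist_eq_norm, dist_eq_norm] at hqp
      filter_upwards [hq.1, ae_abs_le_norm (p.1 - q.1), ae_abs_le_norm (p.2 - q.2),
        hS.ae_le_norm (p.1 - q.1), Lp.coeFn_sub p.1 q.1, Lp.coeFn_sub p.2 q.2,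
        Lp.coeFn_sub (S p.1) (S q.1)] with η h1 h2 h3 h4 h5 h6 h7
      rw [map_sub, h7] at h4
      rw [h5] at h2
      rw [h6] at h3
      simp only [Pi.sub_apply] at h2 h3 h4
      have hn : (0 : ℝ) ≤ N η := Nat.cast_nonneg _
      have h8 : p.2 η + (N η : ℝ) * p.1 η - (1 + (N η : ℝ)) * S p.1 η
          = (p.2 η - q.2 η) + (N η : ℝ) * (p.1 η - q.1 η)
            + (-((1 + (N η : ℝ)) * (S p.1 η - S q.1 η))) := by
        rw [h1]; ring
      rw [h8]
      refine (abs_add_three _ _ _).trans ?_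
      rw [abs_neg, abs_mul, abs_mul, abs_of_nonneg hn,
        abs_of_nonneg (show 0 ≤ 1 + (N η : ℝ) by linarith)]
      nlinarith
    filter_upwards [ae_all_iff.2 h] with η hη
    have h0 : |p.2 η + (N η : ℝ) * p.1 η - (1 + (N η : ℝ)) * S p.1 η| ≤ 0 := by
      refine ge_of_tendsto' (x := atTop (α := ℕ)) ?_ hη
      simpa using (tendsto_one_div_add_atTop_nhds_zero_nat (𝕜 := ℝ)).const_mul (1 + 2 * (N η : ℝ))
    have := abs_nonpos_iff.1 h0
    linarith
  · exact isClosed_vanishing.closure_subset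
      (map_mem_closure continuous_fst hp fun q hq => hq.2.1)
  · exact isClosed_vanishing.closure_subset
      (map_mem_closure continuous_snd hp fun q hq => hq.2.2)

/-- Maximum principle. Let s and w be the two norms and suppose w < s. Beyond some grade M, |u| ≤
s/2. In grade n ≤ M, domination gives (1 + hn)|u| ≤ w + hns, and (w + hns)/(1 + hn) is an average of
w and s that increases with n, hence stays below its value at M, which is less than s. So the norm
would be less than s. -/
theorem gradedGraph_dissipative (hS : Dominated μ N S) {p : Lp ℝ ∞ μ × Lp ℝ ∞ μ}
    (hp : p ∈ gradedGraph μ N S) {h : ℝ} (hh : 0 < h) : ‖p.1‖ ≤ ‖p.1 - h • p.2‖ := by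
  by_contra! hlt
  set s := ‖p.1‖
  set w := ‖p.1 - h • p.2‖
  have hw0 : 0 ≤ w := norm_nonneg _
  have hs : 0 < s := hw0.trans_lt hlt
  obtain ⟨M, hM⟩ := hp.2.1 (s / 2) (by positivity)
  have hden : 0 < 1 + h * (M : ℝ) := by positivity
  have h1 : s ≤ max (s / 2) ((w + h * M * s) / (1 + h * M)) := by
    refine norm_le_of_ae_abs_le (le_max_of_le_left (by positivity)) ?_
    filter_upwards [hM, hp.1, ae_abs_le_norm (p.1 - h • p.2), Lp.coeFn_sub p.1 (h • p.2),
      Lp.coeFn_smul h p.2, hS.ae_le_norm p.1] with η h1 h2 h3 h4 h5 h6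
    rcases le_total M (N η) with hη | hη
    · exact le_max_of_le_left (h1 hη)
    · refine le_max_of_le_right ?_
      rw [h4, Pi.sub_apply, h5, Pi.smul_apply, smul_eq_mul, h2] at h3
      have hn : (0 : ℝ) ≤ N η := Nat.cast_nonneg _
      have hnM : (N η : ℝ) ≤ M := by exact_mod_cast hη
      have h7 : (1 + h * N η) * p.1 η = (p.1 η - h * (-(N η : ℝ) * p.1 η + (1 + (N η : ℝ)) * S p.1 η))
          + h * ((1 + (N η : ℝ)) * S p.1 η) := by ring
      have h8 : (1 + h * N η) * |p.1 η| ≤ w + h * (N η * s) := by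
        rw [← abs_of_nonneg (show 0 ≤ 1 + h * (N η : ℝ) by positivity), ← abs_mul, h7]
        refine (abs_add_le _ _).trans (add_le_add h3 ?_)
        rw [abs_mul, abs_mul, abs_of_pos hh, abs_of_nonneg (show 0 ≤ 1 + (N η : ℝ) by positivity)]
        gcongr
      have h9 : |p.1 η| ≤ (w + h * (N η * s)) / (1 + h * N η) := by
        rw [le_div_iff₀ (by positivity)]; linarith
      refine h9.trans ?_
      rw [div_le_div_iff₀ (by positivity) hden]
      nlinarith [mul_nonneg (mul_nonneg hh.le (sub_nonneg.2 hnM)) (sub_nonneg.2 hlt.le)]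
  rcases le_max_iff.1 h1 with h2 | h2
  · linarith
  · rw [le_div_iff₀ hden] at h2
    nlinarith

end Graded

/-! ### The range condition and well-posedness for the graded operator -/

section GradedRange

variable {Ω : Type*} [MeasurableSpace Ω] {μ : Measure Ω} {N : Ω → ℕ}
  {S : Lp ℝ ∞ μ →ₗ[ℝ] Lp ℝ ∞ μ}

/-- The weight `1 / ((n + 1) (n + 2))`. -/
noncomputable def decay (n : ℕ) : ℝ := (((n : ℝ) + 1) * ((n : ℝ) + 2))⁻¹

theorem decay_pos (n : ℕ) : 0 < decay n := by unfold decay; positivity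

theorem antitone_decay : Antitone decay := by
  intro m n hmn
  have : (m : ℝ) ≤ n := by exact_mod_cast hmn
  unfold decay
  gcongr

theorem tendsto_inv_add_one : Tendsto (fun n : ℕ => ((n : ℝ) + 1)⁻¹) atTop (𝓝 0) := by
  simpa using tendsto_one_div_add_atTop_nhds_zero_nat (𝕜 := ℝ)

theorem decay_le (n : ℕ) : decay n ≤ ((n : ℝ) + 1)⁻¹ := by
  unfold decay
  gcongr
  nlinarith [(Nat.cast_nonneg n : (0 : ℝ) ≤ n)]

theorem mul_decay_le (n : ℕ) : (n : ℝ) * decay n ≤ ((n : ℝ) + 1)⁻¹ := by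
  unfold decay
  rw [← div_eq_mul_inv, inv_eq_one_div, div_le_div_iff₀ (by positivity) (by positivity)]
  nlinarith [(Nat.cast_nonneg n : (0 : ℝ) ≤ n)]

/-- Equality holds for n ≥ 1, and for n = 0 the truncated index is harmless because of the factor n.
A birth thus multiplies the envelope by n + 2 where death offers only n; the surplus 2 is absorbed
by taking h < 1/4. -/
theorem mul_decay_pred (n : ℕ) : (n : ℝ) * decay (n - 1) ≤ ((n : ℝ) + 2) * decay n := by
  cases n with
  | zero => simp [decay]
  | succ n =>
    simp only [decay, Nat.add_sub_cancel]
    push_cast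
    apply le_of_eq
    field_simp
    ring

theorem mul_decay_pred_le (n : ℕ) : (n : ℝ) * decay (n - 1) ≤ ((n : ℝ) + 1)⁻¹ := by
  refine (mul_decay_pred n).trans (le_of_eq ?_)
  unfold decay
  field_simp

/-- Functions that decay fast enough belong to the domain. -/
theorem exists_mem_gradedGraph (hN : Measurable N) (hS : Dominated μ N S) {u : Lp ℝ ∞ μ} {K : ℝ}
    (hK : 0 ≤ K) (hu : ∀ᵐ η ∂μ, |u η| ≤ K * decay (N η)) : ∃ v, (u, v) ∈ gradedGraph μ N S := by
  have hSu := hS u (fun n => K * decay n) (antitone_decay.const_mul hK)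
    (fun n => mul_nonneg hK (decay_pos n).le) hu
  have hNr : Measurable fun η => (N η : ℝ) := measurable_from_nat.comp hN
  have hb : ∀ᵐ η ∂μ, |-(N η : ℝ) * u η + (1 + (N η : ℝ)) * S u η| ≤ 2 * K * ((N η : ℝ) + 1)⁻¹ := by
    filter_upwards [hu, hSu] with η h1 h2
    have hn : (0 : ℝ) ≤ N η := Nat.cast_nonneg _
    refine (abs_add_le _ _).trans ?_
    rw [abs_mul, abs_mul, abs_neg, abs_of_nonneg hn,
      abs_of_nonneg (show 0 ≤ 1 + (N η : ℝ) by linarith)]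
    have h3 : (N η : ℝ) * |u η| ≤ K * ((N η : ℝ) + 1)⁻¹ := by
      calc (N η : ℝ) * |u η| ≤ (N η : ℝ) * (K * decay (N η)) := by gcongr
        _ = K * ((N η : ℝ) * decay (N η)) := by ring
        _ ≤ _ := by gcongr; exact mul_decay_le _
    have h4 : (N η : ℝ) * (K * decay (N η - 1)) ≤ K * ((N η : ℝ) + 1)⁻¹ := by
      calc (N η : ℝ) * (K * decay (N η - 1)) = K * ((N η : ℝ) * decay (N η - 1)) := by ring
        _ ≤ _ := by gcongr; exact mul_decay_pred_le _
    linarith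
  obtain ⟨v, hv⟩ := exists_linfty_of_ae_abs_le (K := 2 * K)
    (f := fun η => -(N η : ℝ) * u η + (1 + (N η : ℝ)) * S u η)
    ((hNr.neg.aestronglyMeasurable.mul (Lp.aestronglyMeasurable u)).add
      ((measurable_const.add hNr).aestronglyMeasurable.mul (Lp.aestronglyMeasurable (S u)))) (by
      filter_upwards [hb] with η h1
      refine h1.trans ?_
      have : ((N η : ℝ) + 1)⁻¹ ≤ 1 := inv_le_one_of_one_le₀ (by simp)
      nlinarith)
  refine ⟨v, hv, ?_, ?_⟩
  · refine mem_vanishing_of_ae_abs_le (a := fun n => K * ((n : ℝ) + 1)⁻¹) ?_ ?_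
    · simpa using tendsto_inv_add_one.const_mul K
    · filter_upwards [hu] with η h1
      exact h1.trans (mul_le_mul_of_nonneg_left (decay_le _) hK)
  · refine mem_vanishing_of_ae_abs_le (a := fun n => 2 * K * ((n : ℝ) + 1)⁻¹) ?_ ?_
    · simpa using tendsto_inv_add_one.const_mul (2 * K)
    · filter_upwards [hb, hv] with η h1 h2
      rwa [h2]

/-- A bounded function supported in finitely many grades lies below a multiple of any positive
decreasing envelope. -/
theorem exists_truncation_decay (hN : Measurable N) {u : Lp ℝ ∞ μ} (hu : u ∈ vanishing μ N)
    {ε : ℝ} (hε : 0 < ε) : ∃ (K : ℝ) (w : Lp ℝ ∞ μ), 0 ≤ K ∧ ‖w - u‖ ≤ ε ∧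
      ∀ᵐ η ∂μ, |w η| ≤ K * decay (N η) := by
  obtain ⟨M, w, hw, hb⟩ := exists_truncation hN hu hε
  refine ⟨‖u‖ * (decay M)⁻¹, w, mul_nonneg (norm_nonneg _) (inv_pos.2 (decay_pos _)).le, hw, ?_⟩
  filter_upwards [hb] with η h1
  refine h1.trans ?_
  split_ifs with h
  · rw [mul_assoc]
    refine le_mul_of_one_le_right (norm_nonneg _) ?_
    rw [inv_mul_eq_div, one_le_div (decay_pos _)]
    exact antitone_decay h
  · exact mul_nonneg (mul_nonneg (norm_nonneg _) (inv_pos.2 (decay_pos _)).le) (decay_pos _).le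

/-- The damped resolvent equation `(1 + h N) u = y + h r (1 + N) S u` with `r < 1`. -/
theorem exists_damped_resolvent (hN : Measurable N) (hS : Dominated μ N S) {h r : ℝ} (hh : 0 < h)
    (hh4 : h < 1 / 4) (hr : 0 ≤ r) (hr1 : r < 1) {y : Lp ℝ ∞ μ} {K : ℝ} (hK : 0 ≤ K)
    (hy : ∀ᵐ η ∂μ, |y η| ≤ K * decay (N η)) :
    ∃ u : Lp ℝ ∞ μ, (∀ᵐ η ∂μ, |u η| ≤ 2 * K * decay (N η)) ∧
      ∀ᵐ η ∂μ, (1 + h * N η) * u η = y η + h * r * ((1 + (N η : ℝ)) * S u η) := by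
  have hNr : Measurable fun η => (N η : ℝ) := measurable_from_nat.comp hN
  have hbd : ∀ u : Lp ℝ ∞ μ, ∀ᵐ η ∂μ,
      |(1 + h * N η)⁻¹ * (y η + h * r * ((1 + (N η : ℝ)) * S u η))| ≤ ‖y‖ + ‖u‖ := by
    intro u
    filter_upwards [ae_abs_le_norm y, hS.ae_le_norm u] with η h1 h2
    have hn : (0 : ℝ) ≤ N η := Nat.cast_nonneg _
    have hhn : 0 ≤ h * N η := mul_nonneg hh.le hn
    rw [abs_mul, abs_inv, abs_of_pos (show 0 < 1 + h * (N η : ℝ) by positivity),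
      inv_mul_le_iff₀ (by positivity)]
    refine (abs_add_le _ _).trans ?_
    rw [abs_mul, abs_mul (1 + (N η : ℝ)), abs_of_nonneg (mul_nonneg hh.le hr),
      abs_of_nonneg (show 0 ≤ 1 + (N η : ℝ) by linarith)]
    have h3 : h * r * ((1 + (N η : ℝ)) * |S u η|) ≤ h * 1 * ((N η : ℝ) * ‖u‖) := by gcongr
    nlinarith [norm_nonneg y, norm_nonneg u, mul_nonneg hhn (norm_nonneg y)]
  have hex : ∀ u : Lp ℝ ∞ μ, ∃ w : Lp ℝ ∞ μ, w =ᵐ[μ]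
      fun η => (1 + h * N η)⁻¹ * (y η + h * r * ((1 + (N η : ℝ)) * S u η)) := fun u =>
    exists_linfty_of_ae_abs_le
      (((measurable_const.add (hNr.const_mul h)).inv.aestronglyMeasurable).mul
        ((Lp.aestronglyMeasurable y).add
          (((measurable_const.add hNr).aestronglyMeasurable.mul
            (Lp.aestronglyMeasurable (S u))).const_mul (h * r)))) (hbd u)
  choose F hF using hex
  -- The Lipschitz constant in grade n is r hn/(1 + hn) ≤ r. It would tend to 1 without the damping
  -- r.
  have hlip : ContractingWith r.toNNReal F := by
    refine ⟨by rwa [Real.toNNReal_lt_one], LipschitzWith.of_dist_le_mul fun u w => ?_⟩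
    rw [dist_eq_norm, dist_eq_norm, Real.coe_toNNReal r hr]
    refine norm_le_of_ae_abs_le (by positivity) ?_
    filter_upwards [hF u, hF w, Lp.coeFn_sub (F u) (F w), hS.ae_le_norm (u - w),
      Lp.coeFn_sub (S u) (S w)] with η h1 h2 h3 h4 h5
    have hn : (0 : ℝ) ≤ N η := Nat.cast_nonneg _
    have hhn : 0 ≤ h * N η := mul_nonneg hh.le hn
    rw [map_sub, h5, Pi.sub_apply] at h4
    rw [h3, Pi.sub_apply, h1, h2, ← mul_sub, add_sub_add_left_eq_sub, ← mul_sub, ← mul_sub, abs_mul,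
      abs_inv, abs_of_pos (show 0 < 1 + h * (N η : ℝ) by positivity), inv_mul_le_iff₀ (by positivity),
      abs_mul, abs_mul (1 + (N η : ℝ)), abs_of_nonneg (mul_nonneg hh.le hr),
      abs_of_nonneg (show 0 ≤ 1 + (N η : ℝ) by linarith)]
    have h6 : h * r * ((1 + (N η : ℝ)) * |S u η - S w η|) ≤ h * r * ((N η : ℝ) * ‖u - w‖) := by
      gcongr
    nlinarith [mul_nonneg hr (norm_nonneg (u - w))]
  -- Invariance of the envelope amounts to 1 + 2h(n + 2) ≤ 2(1 + hn), that is h ≤ 1/4. The envelope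
  -- does not depend on r.
  have hinv : ∀ u : Lp ℝ ∞ μ, (∀ᵐ η ∂μ, |u η| ≤ 2 * K * decay (N η)) →
      ∀ᵐ η ∂μ, |F u η| ≤ 2 * K * decay (N η) := by
    intro u hu
    filter_upwards [hF u, hy, hS u (fun n => 2 * K * decay n)
      (antitone_decay.const_mul (by positivity))
      (fun n => mul_nonneg (by positivity) (decay_pos n).le) hu] with η h1 h2 h3
    have hn : (0 : ℝ) ≤ N η := Nat.cast_nonneg _
    have hd := decay_pos (N η)
    rw [h1, abs_mul, abs_inv, abs_of_pos (show 0 < 1 + h * (N η : ℝ) by positivity),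
      inv_mul_le_iff₀ (by positivity)]
    refine (abs_add_le _ _).trans ?_
    rw [abs_mul, abs_mul (1 + (N η : ℝ)), abs_of_nonneg (mul_nonneg hh.le hr),
      abs_of_nonneg (show 0 ≤ 1 + (N η : ℝ) by linarith)]
    have h4 : h * r * ((1 + (N η : ℝ)) * |S u η|)
        ≤ h * 1 * (2 * K * (((N η : ℝ) + 2) * decay (N η))) := by
      have h5 : (N η : ℝ) * (2 * K * decay (N η - 1)) ≤ 2 * K * (((N η : ℝ) + 2) * decay (N η)) := by
        calc _ = 2 * K * ((N η : ℝ) * decay (N η - 1)) := by ring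
          _ ≤ _ := mul_le_mul_of_nonneg_left (mul_decay_pred _) (by positivity)
      have h6 := h3.trans h5
      gcongr
    have hKd : 0 ≤ K * decay (N η) := mul_nonneg hK hd.le
    nlinarith
  set u := ContractingWith.fixedPoint F hlip with hu_def
  have hfix : F u = u := hlip.fixedPoint_isFixedPt
  refine ⟨u, ?_, ?_⟩
  · refine (isClosed_setOf_ae_abs_le fun η => 2 * K * decay (N η)).mem_of_tendsto
      (hlip.tendsto_iterate_fixedPoint 0) (Eventually.of_forall fun n => ?_)
    induction n with
    | zero =>
      change ∀ᵐ η ∂μ, |(0 : Lp ℝ ∞ μ) η| ≤ 2 * K * decay (N η)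
      filter_upwards [Lp.coeFn_zero ℝ ∞ μ] with η hη
      have h0 : ((0 : Lp ℝ ∞ μ) : Ω → ℝ) η = 0 := hη
      rw [h0, abs_zero]
      exact mul_nonneg (by positivity) (decay_pos _).le
    | succ n ih =>
      rw [Function.iterate_succ_apply']
      exact hinv _ ih
  · have := hF u
    rw [hfix] at this
    filter_upwards [this] with η h1
    rw [h1, mul_inv_cancel_left₀]
    have hn : (0 : ℝ) ≤ N η := Nat.cast_nonneg _
    positivity

/-- For truncated y and damping 1 - δ the solution lies in the domain and misses the true equation
by h δ (1 + N) S u, which is at most 2Kδ since K is independent of δ. Thus the range of 1 - hA is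
dense; it is closed because A is closed and 1 - hA does not decrease norms. -/
theorem gradedGraph_range (hN : Measurable N) (hS : Dominated μ N S) {h : ℝ} (hh : 0 < h)
    (hh4 : h < 1 / 4) {y : Lp ℝ ∞ μ} (hy : y ∈ vanishing μ N) :
    ∃ p ∈ gradedGraph μ N S, p.1 - h • p.2 = y := by
  have happrox : ∀ k : ℕ, ∃ p ∈ gradedGraph μ N S, ‖p.1 - h • p.2 - y‖ ≤ 1 / ((k : ℝ) + 1) := by
    intro k
    set ε : ℝ := 1 / ((k : ℝ) + 1)
    have hε : 0 < ε := by positivity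
    obtain ⟨K, w, hK, hwy, hw⟩ := exists_truncation_decay hN hy (half_pos hε)
    -- Chosen so that 2Kδ ≤ ε/2; the extra 1 in the denominator covers K = 0.
    set δ : ℝ := min 1 (ε / 2 / (2 * K + 1))
    have hδ : 0 < δ := by positivity
    have hδ1 : δ ≤ 1 := min_le_left _ _
    have hδ2 : 2 * K * δ ≤ ε / 2 := by
      have h1 : δ ≤ ε / 2 / (2 * K + 1) := min_le_right _ _
      rw [le_div_iff₀ (by positivity)] at h1
      nlinarith
    obtain ⟨u, hu, hres⟩ := exists_damped_resolvent hN hS hh hh4 (r := 1 - δ) (by linarith)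
      (by linarith) hK hw
    obtain ⟨v, hv⟩ := exists_mem_gradedGraph hN hS (by positivity) hu
    refine ⟨(u, v), hv, ?_⟩
    have h1 : ‖u - h • v - w‖ ≤ ε / 2 := by
      refine norm_le_of_ae_abs_le (by positivity) ?_
      filter_upwards [hres, hv.1, Lp.coeFn_sub (u - h • v) w, Lp.coeFn_sub u (h • v),
        Lp.coeFn_smul h v, hS u (fun n => 2 * K * decay n)
        (antitone_decay.const_mul (by positivity))
        (fun n => mul_nonneg (by positivity) (decay_pos n).le) hu] with η h1 h2 h3 h4 h5 h6
      rw [h3, Pi.sub_apply, h4, Pi.sub_apply, h5, Pi.smul_apply, smul_eq_mul, h2]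
      have hn : (0 : ℝ) ≤ N η := Nat.cast_nonneg _
      have h7 : u η - h * (-(N η : ℝ) * u η + (1 + (N η : ℝ)) * S u η) - w η
          = -(h * δ * ((1 + (N η : ℝ)) * S u η)) := by
        linear_combination h1
      have h8 : (1 + (N η : ℝ)) * |S u η| ≤ 2 * K := by
        refine h6.trans ?_
        have h9 : (N η : ℝ) * decay (N η - 1) ≤ 1 :=
          (mul_decay_pred_le _).trans (inv_le_one_of_one_le₀ (by linarith))
        nlinarith
      rw [h7, abs_neg, abs_mul, abs_mul (1 + (N η : ℝ)), abs_of_nonneg (by positivity),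
        abs_of_nonneg (show 0 ≤ 1 + (N η : ℝ) by linarith)]
      calc h * δ * ((1 + (N η : ℝ)) * |S u η|) ≤ 1 * δ * (2 * K) := by gcongr; linarith
        _ ≤ ε / 2 := by linarith
    have h2 : u - h • v - y = (u - h • v - w) + (w - y) := by abel
    change ‖u - h • v - y‖ ≤ ε
    rw [h2]
    exact (norm_add_le _ _).trans (by linarith)
  choose p hp hpy using happrox
  have hlim : Tendsto (fun k => (p k).1 - h • (p k).2) atTop (𝓝 y) := by
    rw [tendsto_iff_norm_sub_tendsto_zero]
    exact squeeze_zero (fun _ => norm_nonneg _) hpy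
      (tendsto_one_div_add_atTop_nhds_zero_nat (𝕜 := ℝ))
  have hcauchy : CauchySeq fun k => (p k).1 := by
    rw [Metric.cauchySeq_iff]
    intro ε hε
    obtain ⟨M, hM⟩ := Metric.cauchySeq_iff.1 hlim.cauchySeq ε hε
    refine ⟨M, fun m hm n hn => lt_of_le_of_lt ?_ (hM m hm n hn)⟩
    rw [dist_eq_norm, dist_eq_norm]
    refine (gradedGraph_dissipative hS (Submodule.sub_mem _ (hp m) (hp n)) hh).trans_eq ?_
    congr 1
    simp only [Prod.fst_sub, Prod.snd_sub]
    module
  obtain ⟨u, hu⟩ := cauchySeq_tendsto_of_complete hcauchy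
  have hv : Tendsto (fun k => (p k).2) atTop (𝓝 (h⁻¹ • (u - y))) := by
    refine ((hu.sub hlim).const_smul h⁻¹).congr fun k => ?_
    rw [sub_sub_cancel, smul_smul, inv_mul_cancel₀ hh.ne', one_smul]
  refine ⟨(u, h⁻¹ • (u - y)), (isClosed_gradedGraph hS).mem_of_tendsto (hu.prodMk_nhds hv)
    (Eventually.of_forall hp), ?_⟩
  dsimp only
  rw [smul_smul, mul_inv_cancel₀ hh.ne', one_smul, sub_sub_cancel]

theorem wellPosed_gradedGraph (hN : Measurable N) (hS : Dominated μ N S) :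
    WellPosed (vanishing μ N : Set (Lp ℝ ∞ μ))
      (gradedGraph μ N S : Set (Lp ℝ ∞ μ × Lp ℝ ∞ μ)) := by
  refine wellPosed_of_dissipative isClosed_vanishing (isClosed_gradedGraph hS)
    (fun p hp => hp.2) (fun p hp h hh => gradedGraph_dissipative hS hp hh) (h₀ := 1 / 4)
    (by norm_num) (fun h hh hh4 y hy => gradedGraph_range hN hS hh hh4 hy) ?_ ?_
  · rintro y ⟨hy, -⟩
    rw [← norm_le_zero_iff]
    refine norm_le_of_ae_abs_le le_rfl ?_
    simp only [map_zero] at hy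
    filter_upwards [hy, Lp.coeFn_zero ℝ ∞ μ] with η h1 h2
    have h0 : ((0 : Lp ℝ ∞ μ) : Ω → ℝ) η = 0 := h2
    rw [h1, h0]
    simp
  · intro u hu
    rw [Metric.mem_closure_iff]
    intro ε hε
    obtain ⟨K, w, hK, hwu, hw⟩ := exists_truncation_decay hN hu (half_pos hε)
    obtain ⟨v, hv⟩ := exists_mem_gradedGraph hN hS hK hw
    refine ⟨w, ⟨(w, v), hv, rfl⟩, ?_⟩
    rw [dist_comm, dist_eq_norm]
    linarith

end GradedRange

/-! ### Finite sequences and the Mecke and Minlos formulas -/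

section FinSeq

/-- Finite sequences in `E`, graded by their length. -/
abbrev FinSeq (E : Type*) : Type _ := Σ n : ℕ, (Fin n → E)

variable {E : Type*} {γ : Type*} {δ : Type*}

/-- The sequences of length `n`. -/
abbrev FinSeq.mk (n : ℕ) (x : Fin n → E) : FinSeq E := ⟨n, x⟩

theorem FinSeq.mk_injective (n : ℕ) : Function.Injective (FinSeq.mk n : (Fin n → E) → FinSeq E) :=
  fun _ _ h => eq_of_heq (Sigma.mk.inj h).2

theorem measurable_mk [MeasurableSpace E] (n : ℕ) :
    Measurable (FinSeq.mk n : (Fin n → E) → FinSeq E) :=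
  fun _ hs => (MeasurableSpace.measurableSet_iInf.1 hs) n

theorem measurableSet_finSeq [MeasurableSpace E] {s : Set (FinSeq E)}
    (h : ∀ n, MeasurableSet (FinSeq.mk n ⁻¹' s)) : MeasurableSet s :=
  MeasurableSpace.measurableSet_iInf.2 h

theorem measurable_finSeq [MeasurableSpace E] [MeasurableSpace δ] {f : FinSeq E → δ}
    (h : ∀ n, Measurable fun x : Fin n → E => f ⟨n, x⟩) : Measurable f :=
  fun _ ht => measurableSet_finSeq fun n => h n ht

theorem measurableEmbedding_mk [MeasurableSpace E] (n : ℕ) :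
    MeasurableEmbedding (FinSeq.mk n : (Fin n → E) → FinSeq E) where
  injective := FinSeq.mk_injective n
  measurable := measurable_mk n
  measurableSet_image' := by
    intro s hs
    refine measurableSet_finSeq fun m => ?_
    rcases eq_or_ne m n with rfl | hmn
    · rwa [preimage_image_eq _ (FinSeq.mk_injective _)]
    · convert MeasurableSet.empty
      ext x
      simp only [mem_preimage, mem_image, Sigma.mk.injEq, mem_empty_iff_false, iff_false,
        not_exists, not_and]
      intro y _ h
      exact absurd h.symm hmn

/-- The σ-algebra of sequences is defined level by level, that of a product is not. Each of the
countably many levels embeds measurably, so a preimage is a countable union of measurable images. -/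
theorem measurable_finSeq_prod [MeasurableSpace E] [MeasurableSpace γ] [MeasurableSpace δ]
    {f : FinSeq E × γ → δ}
    (h : ∀ n, Measurable fun p : (Fin n → E) × γ => f (⟨n, p.1⟩, p.2)) : Measurable f := by
  intro t ht
  have h1 : f ⁻¹' t = ⋃ n, Prod.map (FinSeq.mk n : (Fin n → E) → FinSeq E) (id : γ → γ) ''
      ((fun p : (Fin n → E) × γ => f (⟨n, p.1⟩, p.2)) ⁻¹' t) := by
    ext ⟨⟨n, x⟩, y⟩
    simp only [mem_preimage, mem_iUnion, mem_image, Prod.exists]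
    constructor
    · intro hx
      exact ⟨n, x, y, hx, rfl⟩
    · rintro ⟨m, x', y', hx, heq⟩
      rw [← heq]
      exact hx
  rw [h1]
  exact MeasurableSet.iUnion fun n =>
    ((measurableEmbedding_mk n).prodMap .id).measurableSet_image.2 (h n ht)

theorem measurable_prod_finSeq [MeasurableSpace E] [MeasurableSpace γ] [MeasurableSpace δ]
    {f : γ × FinSeq E → δ}
    (h : ∀ n, Measurable fun p : γ × (Fin n → E) => f (p.1, ⟨n, p.2⟩)) : Measurable f := by
  have : Measurable fun q : FinSeq E × γ => f (q.2, q.1) :=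
    measurable_finSeq_prod fun n => (h n).comp measurable_swap
  exact this.comp measurable_swap

namespace FinSeq

/-- Concatenation. -/
def append (s t : FinSeq E) : FinSeq E := ⟨s.1 + t.1, Fin.append s.2 t.2⟩

/-- Prepending a point. -/
def cons (x : E) (s : FinSeq E) : FinSeq E := ⟨s.1 + 1, Fin.cons x s.2⟩

/-- Removing the `i`-th entry. -/
def remove : ∀ {n : ℕ}, Fin n → (Fin n → E) → FinSeq E
  | 0, i, _ => i.elim0
  | n + 1, i, w => ⟨n, i.removeNth w⟩

/-- The subsequence with index set `S`. -/
def sub {n : ℕ} (S : Finset (Fin n)) (w : Fin n → E) : FinSeq E :=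
  ⟨S.card, fun i => w (S.orderEmbOfFin rfl i)⟩

theorem measurable_cons [MeasurableSpace E] :
    Measurable fun p : E × FinSeq E => cons p.1 p.2 := by
  refine measurable_prod_finSeq fun n => (measurable_mk (n + 1)).comp ?_
  refine measurable_pi_iff.2 fun i => ?_
  refine Fin.cases ?_ (fun j => ?_) i
  · simpa using measurable_fst
  · simp only [Fin.cons_succ]
    exact (measurable_pi_apply j).comp measurable_snd

theorem measurable_fin_append [MeasurableSpace E] (n m : ℕ) :
    Measurable fun p : (Fin n → E) × (Fin m → E) => Fin.append p.1 p.2 := by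
  refine measurable_pi_iff.2 fun i => ?_
  refine Fin.addCases (fun j => ?_) (fun j => ?_) i
  · simp only [Fin.append_left]
    exact (measurable_pi_apply j).comp measurable_fst
  · simp only [Fin.append_right]
    exact (measurable_pi_apply j).comp measurable_snd

theorem measurable_append [MeasurableSpace E] :
    Measurable fun p : FinSeq E × FinSeq E => append p.1 p.2 :=
  measurable_finSeq_prod fun n => measurable_prod_finSeq fun m =>
    (measurable_mk (n + m)).comp (measurable_fin_append n m)

theorem measurable_remove [MeasurableSpace E] {n : ℕ} (i : Fin n) :
    Measurable fun w : Fin n → E => remove i w := by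
  cases n with
  | zero => exact i.elim0
  | succ n =>
    exact (measurable_mk n).comp (measurable_pi_iff.2 fun j => measurable_pi_apply _)

theorem measurable_sub [MeasurableSpace E] {n : ℕ} (S : Finset (Fin n)) :
    Measurable fun w : Fin n → E => sub S w :=
  (measurable_mk S.card).comp (measurable_pi_iff.2 fun _ => measurable_pi_apply _)

end FinSeq

variable [MeasureSpace E] [SigmaFinite (volume : Measure E)]

/-- The measure `∑ₙ (1/n!) dxⁿ` on finite sequences. -/
noncomputable def seqMeasure (E : Type*) [MeasureSpace E] : Measure (FinSeq E) :=
  Measure.sum fun n : ℕ => ((n.factorial : ℝ≥0∞)⁻¹) •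
    (volume : Measure (Fin n → E)).map (FinSeq.mk n)

theorem inv_factorial_ne_zero (n : ℕ) : ((n.factorial : ℝ≥0∞)⁻¹) ≠ 0 :=
  ENNReal.inv_ne_zero.2 (ENNReal.natCast_ne_top _)

theorem inv_factorial_ne_top (n : ℕ) : ((n.factorial : ℝ≥0∞)⁻¹) ≠ ∞ :=
  ENNReal.inv_ne_top.2 (by exact_mod_cast n.factorial_ne_zero)

instance sfinite_seqMeasure : SFinite (seqMeasure E) := by
  unfold seqMeasure
  infer_instance

omit [SigmaFinite (volume : Measure E)] in
theorem ae_seqMeasure_iff {p : FinSeq E → Prop} :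
    (∀ᵐ s ∂(seqMeasure E), p s) ↔ ∀ n, ∀ᵐ x : Fin n → E, p ⟨n, x⟩ := by
  unfold seqMeasure
  rw [Measure.ae_sum_iff]
  refine forall_congr' fun n => ?_
  rw [Measure.ae_ennreal_smul_measure_iff (inv_factorial_ne_zero n),
    (measurableEmbedding_mk n).ae_map_iff]

omit [SigmaFinite (volume : Measure E)] in
/-- If a measure decomposes over the levels of `seqMeasure`, with finitely many pieces
in each level, then its integrals are integrals over `seqMeasure` of finite sums. -/
theorem integral_seqMeasure_of_decomposition [MeasurableSpace γ] {ν : Measure γ} {I : ℕ → Type*}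
    [∀ n, Fintype (I n)] {e : ∀ n, I n → (Fin n → E) → γ} (he : ∀ n i, Measurable (e n i))
    (hν : ν = Measure.sum fun n : ℕ => ((n.factorial : ℝ≥0∞)⁻¹) •
      ∑ i, (volume : Measure (Fin n → E)).map (e n i))
    {H : γ → ℝ} (hH : Integrable H ν) {F : FinSeq E → ℝ}
    (hF : ∀ n, ∀ᵐ w : Fin n → E, F ⟨n, w⟩ = ∑ i, H (e n i w)) :
    Integrable F (seqMeasure E) ∧ ∫ s, F s ∂(seqMeasure E) = ∫ p, H p ∂ν := by
  subst hν
  have hHn : ∀ n i, Integrable H ((volume : Measure (Fin n → E)).map (e n i)) := by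
    intro n i
    have h1 := (integrable_sum_measure_iff.1 hH).1 n
    rw [integrable_smul_measure (inv_factorial_ne_zero n) (inv_factorial_ne_top n),
      integrable_finsetSum_measure] at h1
    exact h1 i (Finset.mem_univ i)
  have hHe : ∀ n i, Integrable (fun w => H (e n i w)) (volume : Measure (Fin n → E)) := fun n i =>
    (hHn n i).comp_measurable (he n i)
  have hint : ∀ n i, ∫ w, H (e n i w) = ∫ p, H p ∂((volume : Measure (Fin n → E)).map (e n i)) :=
    fun n i => (integral_map (he n i).aemeasurable (hHn n i).aestronglyMeasurable).symm
  have hint' : ∀ n i, ∫ w, ‖H (e n i w)‖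
      = ∫ p, ‖H p‖ ∂((volume : Measure (Fin n → E)).map (e n i)) :=
    fun n i => (integral_map (he n i).aemeasurable (hHn n i).aestronglyMeasurable.norm).symm
  have hFn : ∀ n, Integrable (fun w : Fin n → E => F ⟨n, w⟩) := fun n =>
    (integrable_finsetSum _ fun i _ => hHe n i).congr (by
      filter_upwards [hF n] with w hw
      rw [hw])
  have hFm : ∀ n, Integrable F ((volume : Measure (Fin n → E)).map (FinSeq.mk n)) := fun n =>
    ((measurableEmbedding_mk n).integrable_map_iff).2 (hFn n)
  have hFint : Integrable F (seqMeasure E) := by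
    refine integrable_sum_measure (fun n => (hFm n).smul_measure (inv_factorial_ne_top n)) ?_
    refine Summable.of_nonneg_of_le (fun n => integral_nonneg fun _ => norm_nonneg _) (fun n => ?_)
      (integrable_sum_measure_iff.1 hH).2
    rw [integral_smul_measure, integral_smul_measure, (measurableEmbedding_mk n).integral_map,
      integral_finsetSum_measure fun i _ => (hHn n i).norm]
    refine smul_le_smul_of_nonneg_left ?_ ENNReal.toReal_nonneg
    simp_rw [← hint' n]
    rw [← integral_finsetSum _ fun i _ => (hHe n i).norm]
    refine integral_mono_ae (hFn n).norm (integrable_finsetSum _ fun i _ => (hHe n i).norm) ?_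
    filter_upwards [hF n] with w hw
    rw [hw]
    exact norm_sum_le _ _
  refine ⟨hFint, ?_⟩
  rw [integral_sum_measure hH]
  unfold seqMeasure at hFint ⊢
  rw [integral_sum_measure hFint]
  refine tsum_congr fun n => ?_
  rw [integral_smul_measure, integral_smul_measure, (measurableEmbedding_mk n).integral_map,
    integral_finsetSum_measure fun i _ => hHn n i, integral_congr_ae (hF n),
    integral_finsetSum _ fun i _ => hHe n i]
  simp_rw [hint n]

theorem map_apply_remove {n : ℕ} (i : Fin (n + 1)) :
    (volume : Measure (Fin (n + 1) → E)).map (fun w => (w i, FinSeq.remove i w))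
      = (volume : Measure E).prod ((volume : Measure (Fin n → E)).map (FinSeq.mk n)) := by
  have h1 := (volume_preserving_piFinSuccAbove (fun _ : Fin (n + 1) => E) i).map_eq
  have h2 : (fun w : Fin (n + 1) → E => (w i, FinSeq.remove i w))
      = Prod.map id (FinSeq.mk n) ∘ MeasurableEquiv.piFinSuccAbove (fun _ => E) i := rfl
  rw [h2, ← Measure.map_map (measurable_id.prodMap (measurable_mk n))
    (MeasurableEquiv.measurable _), h1, Measure.volume_eq_prod,
    ← Measure.map_prod_map _ _ measurable_id (measurable_mk n), Measure.map_id]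

/-- The **Mecke formula**, as a decomposition of measures. -/
theorem volume_prod_seqMeasure :
    (volume : Measure E).prod (seqMeasure E) = Measure.sum fun n : ℕ => ((n.factorial : ℝ≥0∞)⁻¹) •
      ∑ i : Fin n, (volume : Measure (Fin n → E)).map fun w => (w i, FinSeq.remove i w) := by
  ext t ht
  have hsplit : ∀ μ : ℕ → Measure (E × FinSeq E),
      Measure.sum μ t = μ 0 t + ∑' n, μ (n + 1) t := fun μ => by
    rw [Measure.sum_apply _ ht]
    exact tsum_eq_zero_add' ENNReal.summable
  have hleft : ((volume : Measure E).prod (seqMeasure E)) t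
      = ∑' n : ℕ, ((n.factorial : ℝ≥0∞)⁻¹ • ((volume : Measure E).prod
        ((volume : Measure (Fin n → E)).map (FinSeq.mk n)))) t := by
    unfold seqMeasure
    rw [Measure.prod_sum_right, Measure.sum_apply _ ht]
    simp_rw [Measure.prod_smul_right]
  rw [hsplit, hleft]
  -- Level 0 has no point to remove. At level n + 1 the n + 1 possible removals all give the same
  -- product measure, which turns 1/(n + 1)! into 1/n!.
  have h0 : (((Nat.factorial 0 : ℕ) : ℝ≥0∞)⁻¹ • ∑ i : Fin 0,
      (volume : Measure (Fin 0 → E)).map fun w => (w i, FinSeq.remove i w)) t = 0 := by simp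
  rw [h0, zero_add]
  refine tsum_congr fun n => ?_
  simp_rw [map_apply_remove]
  rw [Finset.sum_const, Finset.card_univ, Fintype.card_fin,
    Measure.smul_apply, Measure.smul_apply, Measure.smul_apply, smul_eq_mul, smul_eq_mul,
    nsmul_eq_mul, ← mul_assoc, Nat.factorial_succ, Nat.cast_mul, ENNReal.mul_inv (by simp) (by simp),
    mul_comm ((n + 1 : ℕ) : ℝ≥0∞)⁻¹, mul_assoc _ _ ((n + 1 : ℕ) : ℝ≥0∞),
    ENNReal.inv_mul_cancel (by simp) (by simp), mul_one]

/-- Splitting the coordinates into S and its complement preserves volume. -/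
theorem map_sub_sub_compl {n : ℕ} (S : Finset (Fin n)) :
    (volume : Measure (Fin n → E)).map (fun w => (FinSeq.sub S w, FinSeq.sub Sᶜ w))
      = ((volume : Measure (Fin S.card → E)).map (FinSeq.mk S.card)).prod
        ((volume : Measure (Fin (n - S.card) → E)).map (FinSeq.mk (n - S.card))) := by
  have hc : Sᶜ.card = n - S.card := by rw [Finset.card_compl, Fintype.card_fin]
  rw [← hc]
  let σ := finSumEquivOfFinset (s := S) rfl (rfl : Sᶜ.card = Sᶜ.card)
  have h1 := (volume_measurePreserving_piCongrLeft (fun _ : Fin n => E) σ).symm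
  have h2 := volume_measurePreserving_sumPiEquivProdPi
    (fun _ : Fin S.card ⊕ Fin Sᶜ.card => E)
  have h3 : (fun w : Fin n → E => (FinSeq.sub S w, FinSeq.sub Sᶜ w))
      = Prod.map (FinSeq.mk S.card) (FinSeq.mk Sᶜ.card) ∘
        (MeasurableEquiv.sumPiEquivProdPi (fun _ : Fin S.card ⊕ Fin Sᶜ.card => E)) ∘
        (MeasurableEquiv.piCongrLeft (fun _ : Fin n => E) σ).symm := rfl
  rw [h3, ← Measure.map_map ((measurable_mk _).prodMap (measurable_mk _))
    ((MeasurableEquiv.measurable _).comp (MeasurableEquiv.measurable _)),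
    ← Measure.map_map (MeasurableEquiv.measurable _) (MeasurableEquiv.measurable _), h1.map_eq,
    h2.map_eq, Measure.volume_eq_prod,
    ← Measure.map_prod_map _ _ (measurable_mk _) (measurable_mk _)]

/-- The **Minlos formula**, as a decomposition of measures. -/
theorem seqMeasure_prod_seqMeasure :
    (seqMeasure E).prod (seqMeasure E) = Measure.sum fun n : ℕ => ((n.factorial : ℝ≥0∞)⁻¹) •
      ∑ S : Finset (Fin n), (volume : Measure (Fin n → E)).map
        fun w => (FinSeq.sub S w, FinSeq.sub Sᶜ w) := by
  ext t ht
  set g : ℕ → ℕ → ℝ≥0∞ := fun j l =>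
    (((volume : Measure (Fin j → E)).map (FinSeq.mk j)).prod
      ((volume : Measure (Fin l → E)).map (FinSeq.mk l))) t with hg
  have h1 : ((seqMeasure E).prod (seqMeasure E)) t
      = ∑' p : ℕ × ℕ, ((p.1.factorial : ℝ≥0∞)⁻¹ * (p.2.factorial : ℝ≥0∞)⁻¹) * g p.1 p.2 := by
    rw [seqMeasure, Measure.prod_sum, Measure.sum_apply _ ht]
    refine tsum_congr fun p => ?_
    rw [Measure.prod_smul_right, Measure.prod_smul_left, Measure.smul_apply, Measure.smul_apply,
      smul_eq_mul, smul_eq_mul]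
    ring
  rw [h1, Measure.sum_apply _ ht, ← (Finset.HasAntidiagonal.sigmaAntidiagonalEquivProd (A := ℕ)).tsum_eq,
    ENNReal.tsum_sigma']
  refine tsum_congr fun n => ?_
  rw [tsum_fintype, Measure.smul_apply, Measure.finsetSum_apply, smul_eq_mul]
  simp_rw [map_sub_sub_compl]
  -- The summand depends on S only through its cardinality j, so the count of subsets gives (n
  -- choose j)/n! = 1/(j! (n - j)!), the weight of the product measure.
  have h2 := Finset.sum_powerset_apply_card (fun m => g m (n - m)) (x := (Finset.univ : Finset (Fin n)))
  rw [Finset.powerset_univ, Finset.card_univ, Fintype.card_fin] at h2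
  rw [h2, ← Finset.Nat.sum_antidiagonal_eq_sum_range_succ (fun i j => n.choose i • g i j) n,
    Finset.mul_sum]
  refine (Finset.sum_coe_sort (Finset.HasAntidiagonal.antidiagonal n) fun p : ℕ × ℕ =>
    ((p.1.factorial : ℝ≥0∞)⁻¹ * (p.2.factorial : ℝ≥0∞)⁻¹) * g p.1 p.2).trans ?_
  refine Finset.sum_congr rfl fun p hp => ?_
  obtain ⟨j, l⟩ := p
  have hjl : j + l = n := Finset.HasAntidiagonal.mem_antidiagonal.1 hp
  dsimp only
  rw [nsmul_eq_mul, ← mul_assoc]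
  congr 1
  have h3 : n.choose j * j.factorial * l.factorial = n.factorial := by
    rw [← hjl, Nat.choose_symm_add]; exact Nat.add_choose_mul_factorial_mul_factorial j l
  have hn : (n.factorial : ℝ≥0∞) ≠ 0 := by exact_mod_cast n.factorial_ne_zero
  have hj : (j.factorial : ℝ≥0∞) ≠ 0 := by exact_mod_cast j.factorial_ne_zero
  have hl : (l.factorial : ℝ≥0∞) ≠ 0 := by exact_mod_cast l.factorial_ne_zero
  have h4 : (n.factorial : ℝ≥0∞) = n.choose j * (j.factorial * l.factorial) := by
    rw [← h3]; push_cast; ring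
  rw [← ENNReal.mul_inv (Or.inl hj) (Or.inl (by simp)), mul_comm _ (n.choose j : ℝ≥0∞),
    ← div_eq_mul_inv, ENNReal.eq_div_iff hn (by simp), h4, mul_assoc,
    ENNReal.mul_inv_cancel (mul_ne_zero hj hl) (ENNReal.mul_ne_top (by simp) (by simp)), mul_one]

end FinSeq

/-! ### Exponential formula and null sets for sequences -/

section SeqMeasure

variable {E : Type*} [MeasureSpace E] [SigmaFinite (volume : Measure E)]

/-- The integral of a product function over finite sequences is an exponential. -/
theorem integral_seqMeasure_prod {f : E → ℝ} (hf : Integrable f) :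
    Integrable (fun s : FinSeq E => ∏ j, f (s.2 j)) (seqMeasure E) ∧
      ∫ s, ∏ j, f (s.2 j) ∂(seqMeasure E) = Real.exp (∫ x, f x) := by
  have hn : ∀ (g : E → ℝ) n, ∫ s, ∏ j, g (s.2 j) ∂(((n.factorial : ℝ≥0∞)⁻¹) •
      (volume : Measure (Fin n → E)).map (FinSeq.mk n)) = (∫ x, g x) ^ n / n.factorial := by
    intro g n
    rw [integral_smul_measure, (measurableEmbedding_mk n).integral_map,
      integral_fintype_prod_volume_eq_pow, Fintype.card_fin, ENNReal.toReal_inv,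
      ENNReal.toReal_natCast, smul_eq_mul, inv_mul_eq_div]
  have hint : Integrable (fun s : FinSeq E => ∏ j, f (s.2 j)) (seqMeasure E) := by
    refine integrable_sum_measure (fun n => Integrable.smul_measure ?_ (inv_factorial_ne_top n)) ?_
    · rw [(measurableEmbedding_mk n).integrable_map_iff]
      exact Integrable.fintype_prod (f := fun _ => f) fun _ => hf
    · simp_rw [norm_prod, hn fun x => ‖f x‖]
      exact Real.summable_pow_div_factorial _
  refine ⟨hint, ?_⟩
  unfold seqMeasure at hint ⊢
  rw [integral_sum_measure hint, Real.exp_eq_exp_ℝ, NormedSpace.exp_eq_tsum_div]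
  exact tsum_congr fun n => hn f n

theorem measurePreserving_fin_append (n m : ℕ) :
    MeasurePreserving (fun p : (Fin n → E) × (Fin m → E) => Fin.append p.1 p.2) := by
  have h1 := volume_measurePreserving_piCongrLeft (fun _ : Fin (n + m) => E) finSumFinEquiv
  have h2 := volume_measurePreserving_sumPiEquivProdPi_symm (fun _ : Fin n ⊕ Fin m => E)
  convert! h1.comp h2 using 1
  ext p i
  obtain ⟨j, rfl⟩ := finSumFinEquiv.surjective i
  rw [Function.comp_apply, MeasurableEquiv.coe_piCongrLeft, Equiv.piCongrLeft_apply_apply]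
  cases j with
  | inl j => simp [MeasurableEquiv.sumPiEquivProdPi, Equiv.sumPiEquivProdPi]
  | inr j => simp [MeasurableEquiv.sumPiEquivProdPi, Equiv.sumPiEquivProdPi]

/-- Appending preserves Lebesgue measure level by level, so Fubini applies. Together with
`ae_remove` this makes the dual birth operator well defined on classes of functions modulo null
sets. -/
theorem ae_append {p : FinSeq E → Prop} (h : ∀ᵐ s ∂(seqMeasure E), p s) :
    ∀ᵐ w ∂(seqMeasure E), ∀ᵐ y ∂(seqMeasure E), p (FinSeq.append w y) := by
  rw [ae_seqMeasure_iff] at h ⊢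
  intro n
  have : ∀ m, ∀ᵐ x : Fin n → E, ∀ᵐ y : Fin m → E, p (FinSeq.append ⟨n, x⟩ ⟨m, y⟩) := fun m =>
    Measure.ae_ae_of_ae_prod ((measurePreserving_fin_append n m).quasiMeasurePreserving.ae (h (n + m)))
  filter_upwards [ae_all_iff.2 this] with x hx
  rwa [ae_seqMeasure_iff]

theorem ae_remove {p : FinSeq E → Prop} (h : ∀ᵐ s ∂(seqMeasure E), p s) (n : ℕ) :
    ∀ᵐ w : Fin n → E, ∀ i, p (FinSeq.remove i w) := by
  cases n with
  | zero => exact Eventually.of_forall fun w i => i.elim0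
  | succ n =>
    rw [ae_all_iff]
    intro i
    have h1 := (measurableEmbedding_mk n).ae_map_iff.2 (ae_seqMeasure_iff.1 h n)
    have h2 := (Measure.quasiMeasurePreserving_snd (μ := (volume : Measure E))
      (ν := (volume : Measure (Fin n → E)).map (FinSeq.mk n))).ae h1
    rw [← map_apply_remove i] at h2
    exact ae_of_ae_map ((measurable_pi_apply i).prodMk (FinSeq.measurable_remove i)).aemeasurable h2

theorem ae_forall_mem {q : E → Prop} (h : ∀ᵐ x, q x) :
    ∀ᵐ s ∂(seqMeasure E), ∀ j, q (s.2 j) := by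
  rw [ae_seqMeasure_iff]
  intro n
  refine ae_all_iff.2 fun j : Fin n => ?_
  exact (Measure.quasiMeasurePreserving_eval (μ := fun _ : Fin n => (volume : Measure E)) j).ae h

end SeqMeasure

/-! ### Configurations as images of sequences -/

section Configurations

variable {d : ℕ}

theorem measurableSet_injective (d n : ℕ) :
    MeasurableSet {x : Fin n → Pt d | Function.Injective x} := by
  have : {x : Fin n → Pt d | Function.Injective x}
      = ⋂ i, ⋂ j, {x | x i = x j → i = j} := by
    ext x; simp [Function.Injective]
  rw [this]
  refine MeasurableSet.iInter fun i => MeasurableSet.iInter fun j => ?_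
  by_cases hij : i = j
  · simp [hij]
  · simp only [hij, imp_false]
    exact (measurableSet_eq_fun (measurable_pi_apply i) (measurable_pi_apply j)).compl

/-- A coincidence of two entries defines a linear subspace, which is proper because d ≥ 1 and hence
has measure zero. -/
theorem ae_injective [NeZero d] (n : ℕ) : ∀ᵐ x : Fin n → Pt d, Function.Injective x := by
  have h : ∀ i j : Fin n, i ≠ j → ∀ᵐ x : Fin n → Pt d, x i ≠ x j := by
    intro i j hij
    let f : (Fin n → Pt d) →ₗ[ℝ] Pt d := (LinearMap.proj i : (Fin n → Pt d) →ₗ[ℝ] Pt d) - LinearMap.proj j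
    have hf : LinearMap.ker f ≠ ⊤ := by
      intro htop
      have h1 : Pi.single i (EuclideanSpace.single (0 : Fin d) (1 : ℝ)) ∈ LinearMap.ker f := by
        rw [htop]; trivial
      rw [LinearMap.mem_ker] at h1
      simp [f, hij.symm] at h1
    have h2 := Measure.addHaar_submodule (volume : Measure (Fin n → Pt d)) _ hf
    rw [ae_iff]
    convert h2 using 2
    ext x
    simp [f, sub_eq_zero]
  have h' : ∀ᵐ x : Fin n → Pt d, ∀ i j : Fin n, i ≠ j → x i ≠ x j := by
    rw [ae_all_iff]; intro i
    rw [ae_all_iff]; intro j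
    by_cases hij : i = j
    · exact Eventually.of_forall fun x hne => absurd hij hne
    · filter_upwards [h i j hij] with x hx _ using hx
  filter_upwards [h'] with x hx i j hxy
  by_contra hne
  exact hx i j hne hxy

theorem measurable_of_tup {β : Type*} [MeasurableSpace β] {f : Conf d → β}
    (h : ∀ n, Measurable fun x : Tup d n => f x.conf) : Measurable f :=
  fun _ ht => MeasurableSpace.measurableSet_iInf.2 fun n => h n ht

/-- The underlying finite set of a configuration. -/
def Conf.pts (η : Conf d) : Finset (Pt d) := η

/-- The configuration with a given underlying finite set. -/
def Conf.ofPts (s : Finset (Pt d)) : Conf d := s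

theorem Conf.mem_pts_ofPts {s : Finset (Pt d)} {x : Pt d} : x ∈ (ofPts s).pts ↔ x ∈ s := Iff.rfl

theorem Conf.ext_pts {η ξ : Conf d} (h : ∀ x, x ∈ η.pts ↔ x ∈ ξ.pts) : η = ξ :=
  Finset.ext (α := Pt d) h

/-- The empty configuration. -/
def Conf.empty (d : ℕ) : Conf d := (∅ : Finset (Pt d))

open Classical in
/-- The configuration of the entries of a sequence without repetitions (and the empty configuration
for the other sequences). -/
noncomputable def FinSeq.toConf (s : FinSeq (Pt d)) : Conf d :=
  if h : Function.Injective s.2 then Tup.conf ⟨s.2, h⟩ else Conf.empty d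

theorem FinSeq.toConf_of_injective {s : FinSeq (Pt d)} (h : Function.Injective s.2) :
    s.toConf = Tup.conf ⟨s.2, h⟩ := dif_pos h

theorem FinSeq.toConf_of_not_injective {s : FinSeq (Pt d)} (h : ¬ Function.Injective s.2) :
    s.toConf = Conf.empty d := dif_neg h

theorem FinSeq.mem_toConf {s : FinSeq (Pt d)} (h : Function.Injective s.2) {x : Pt d} :
    x ∈ s.toConf.pts ↔ ∃ i, s.2 i = x := by
  rw [toConf_of_injective h]
  simp [Tup.conf, Conf.pts]

theorem measurable_toConf : Measurable (FinSeq.toConf (d := d)) := by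
  refine measurable_finSeq fun n => ?_
  classical
  have := Measurable.dite (s := {x : Fin n → Pt d | Function.Injective x})
    (f := fun x => Tup.conf ⟨x.1, x.2⟩) (g := fun _ => Conf.empty d)
    (measurable_conf d n) measurable_const (measurableSet_injective d n)
  simp only [mem_ofPred_eq] at this
  exact this

/-- Measurability of a function of configurations can be checked on sequences without
repetitions. -/
theorem measurable_of_toConf {β : Type*} [MeasurableSpace β] {f : Conf d → β}
    {g : FinSeq (Pt d) → β} (hg : Measurable g)
    (h : ∀ s : FinSeq (Pt d), Function.Injective s.2 → f s.toConf = g s) : Measurable f := by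
  refine measurable_of_tup fun n => ?_
  have h1 : (fun x : Tup d n => f x.conf) = fun x : Tup d n => g ⟨n, x.1⟩ := by
    ext x
    rw [← h ⟨n, x.1⟩ x.2, FinSeq.toConf_of_injective]
  rw [h1]
  exact hg.comp ((measurable_mk n).comp measurable_subtype_coe)

/-- Sequences with repetitions form a null set, so the restriction to distinct points can be
dropped. From here on all integrals over configurations are computed over sequences. -/
theorem lebesguePoisson_eq_map [NeZero d] :
    lebesguePoisson d = (seqMeasure (Pt d)).map FinSeq.toConf := by
  unfold lebesguePoisson seqMeasure
  rw [Measure.map_sum measurable_toConf.aemeasurable]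
  congr 1
  ext1 n
  rw [Measure.map_smul]
  congr 1
  have h1 : (volume : Measure (Fin n → Pt d))
      = (Measure.comap (Subtype.val : Tup d n → Fin n → Pt d) volume).map Subtype.val := by
    exact ((map_comap_subtype_coe (measurableSet_injective d n) _).trans
      (Measure.restrict_eq_self_of_ae_mem (ae_injective n))).symm
  conv_rhs => rw [h1]
  rw [Measure.map_map measurable_toConf (measurable_mk n),
    Measure.map_map (measurable_toConf.comp (measurable_mk n)) measurable_subtype_coe]
  congr 1
  ext1 x
  exact (FinSeq.toConf_of_injective (s := ⟨n, x.1⟩) x.2).symm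

theorem ae_seq_injective [NeZero d] :
    ∀ᵐ s ∂(seqMeasure (Pt d)), Function.Injective s.2 :=
  ae_seqMeasure_iff.2 ae_injective

theorem FinSeq.toConf_congr {s t : FinSeq (Pt d)} (hs : Function.Injective s.2)
    (ht : Function.Injective t.2) (h : range s.2 = range t.2) : s.toConf = t.toConf := by
  refine Conf.ext_pts fun x => ?_
  rw [mem_toConf hs, mem_toConf ht, ← mem_range, ← mem_range, h]

theorem FinSeq.card_toConf {s : FinSeq (Pt d)} (h : Function.Injective s.2) :
    s.toConf.card = s.1 := by
  rw [toConf_of_injective h, Conf.card, Tup.conf]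
  simp

theorem FinSeq.lpExp_toConf {s : FinSeq (Pt d)} (h : Function.Injective s.2) (f : Pt d → ℝ) :
    lpExp f s.toConf = ∏ j, f (s.2 j) := by
  rw [toConf_of_injective h, lpExp, Tup.conf]
  simp

theorem measurable_fst_finSeq {E : Type*} [MeasurableSpace E] :
    Measurable (fun s : FinSeq E => s.1) :=
  measurable_finSeq fun _ => measurable_const

theorem measurable_prod_finSeq_apply {E : Type*} [MeasurableSpace E] {f : E → ℝ}
    (hf : Measurable f) : Measurable fun s : FinSeq E => ∏ j, f (s.2 j) :=
  measurable_finSeq fun n => Finset.measurable_prod (f := fun (j : Fin n) (x : Fin n → E) => f (x j))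
    Finset.univ fun j _ => hf.comp (measurable_pi_apply j)

theorem measurable_card : Measurable (Conf.card (d := d)) :=
  measurable_of_toConf measurable_fst_finSeq fun _ hs => FinSeq.card_toConf hs

theorem measurable_lpExp {f : Pt d → ℝ} (hf : Measurable f) : Measurable (lpExp f) :=
  measurable_of_toConf (measurable_prod_finSeq_apply hf) fun _ hs => FinSeq.lpExp_toConf hs f

end Configurations

/-! ### Subsets, removal and union in terms of sequences -/

section Combinatorics

variable {d : ℕ}

namespace FinSeq

theorem injective_append_iff {E : Type*} {s t : FinSeq E} :
    Function.Injective (append s t).2 ↔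
      Function.Injective s.2 ∧ Function.Injective t.2 ∧ ∀ i j, s.2 i ≠ t.2 j :=
  Fin.append_injective_iff

theorem mem_range_append {E : Type*} {s t : FinSeq E} {x : E} :
    x ∈ range (append s t).2 ↔ x ∈ range s.2 ∨ x ∈ range t.2 := by
  constructor
  · rintro ⟨i, rfl⟩
    refine Fin.addCases (fun j => ?_) (fun j => ?_) i
    · left; exact ⟨j, (Fin.append_left s.2 t.2 j).symm⟩
    · right; exact ⟨j, (Fin.append_right s.2 t.2 j).symm⟩
  · rintro (⟨j, rfl⟩ | ⟨j, rfl⟩)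
    · exact ⟨Fin.castAdd _ j, Fin.append_left s.2 t.2 j⟩
    · exact ⟨Fin.natAdd _ j, Fin.append_right s.2 t.2 j⟩

theorem injective_sub {E : Type*} {n : ℕ} {w : Fin n → E} (hw : Function.Injective w)
    (S : Finset (Fin n)) : Function.Injective (sub S w).2 :=
  hw.comp (S.orderEmbOfFin rfl).injective

theorem range_sub {E : Type*} {n : ℕ} (w : Fin n → E) (S : Finset (Fin n)) :
    range (sub S w).2 = w '' S := by
  change range (w ∘ S.orderEmbOfFin rfl) = w '' S
  rw [range_comp, Finset.range_orderEmbOfFin]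

theorem injective_remove {E : Type*} {n : ℕ} {w : Fin n → E} (hw : Function.Injective w)
    (i : Fin n) : Function.Injective (remove i w).2 := by
  cases n with
  | zero => exact i.elim0
  | succ n => exact hw.comp Fin.succAbove_right_injective

theorem range_remove {E : Type*} {n : ℕ} {w : Fin n → E} (hw : Function.Injective w)
    (i : Fin n) : range (remove i w).2 = range w \ {w i} := by
  cases n with
  | zero => exact i.elim0
  | succ n =>
    change range (w ∘ i.succAbove) = _
    rw [range_comp, Fin.range_succAbove, ← image_univ, ← image_singleton, ← image_sdiff hw,
      compl_eq_univ_sdiff]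

theorem fst_remove {E : Type*} {n : ℕ} (w : Fin n → E) (i : Fin n) : (remove i w).1 = n - 1 := by
  cases n with
  | zero => exact i.elim0
  | succ n => rfl

theorem injective_cons_iff {E : Type*} {x : E} {s : FinSeq E} :
    Function.Injective (cons x s).2 ↔ x ∉ range s.2 ∧ Function.Injective s.2 :=
  Fin.cons_injective_iff

theorem range_cons {E : Type*} (x : E) (s : FinSeq E) :
    range (cons x s).2 = insert x (range s.2) :=
  Fin.range_cons x s.2

theorem mem_toConf_iff_mem_range {s : FinSeq (Pt d)} (h : Function.Injective s.2) {x : Pt d} :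
    x ∈ s.toConf.pts ↔ x ∈ range s.2 := mem_toConf h

theorem toConf_sub {n : ℕ} {w : Fin n → Pt d} (hw : Function.Injective w) (S : Finset (Fin n)) :
    (sub S w).toConf = Conf.ofPts (S.map ⟨w, hw⟩) := by
  refine Conf.ext_pts fun x => ?_
  rw [mem_toConf_iff_mem_range (injective_sub hw S), range_sub]
  simp [Conf.mem_pts_ofPts]

theorem toConf_mk {n : ℕ} {w : Fin n → Pt d} (hw : Function.Injective w) :
    (mk n w).toConf = Conf.ofPts (Finset.univ.map ⟨w, hw⟩) :=
  toConf_of_injective (s := mk n w) hw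

theorem toConf_append_sub {n : ℕ} {w : Fin n → Pt d} (hw : Function.Injective w)
    (S : Finset (Fin n)) : (append (sub S w) (sub Sᶜ w)).toConf = (mk n w).toConf := by
  refine toConf_congr ?_ hw ?_
  · rw [injective_append_iff]
    refine ⟨injective_sub hw S, injective_sub hw Sᶜ, fun i j h => ?_⟩
    have h1 := hw h
    have h2 : S.orderEmbOfFin rfl i ∈ S := Finset.orderEmbOfFin_mem _ _ _
    have h3 : Sᶜ.orderEmbOfFin rfl j ∈ Sᶜ := Finset.orderEmbOfFin_mem _ _ _
    rw [← h1] at h3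
    exact (Finset.mem_compl.1 h3) h2
  · ext x
    rw [mem_range_append, range_sub, range_sub, Finset.coe_compl, ← mem_union, ← image_union,
      union_compl_self, image_univ]

theorem toConf_cons_remove {n : ℕ} {w : Fin n → Pt d} (hw : Function.Injective w) (i : Fin n) :
    (cons (w i) (remove i w)).toConf = (mk n w).toConf := by
  have hr := range_remove hw i
  refine toConf_congr ?_ hw ?_
  · rw [injective_cons_iff]
    refine ⟨?_, injective_remove hw i⟩
    rw [hr]
    simp
  · rw [range_cons, hr, insert_sdiff_singleton, insert_eq_of_mem (mem_range_self i)]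

open Classical in
theorem toConf_cons {s : FinSeq (Pt d)} (hs : Function.Injective s.2) {x : Pt d}
    (hx : x ∉ range s.2) :
    (cons x s).toConf = Conf.ofPts (insert x s.toConf.pts) := by
  refine Conf.ext_pts fun y => ?_
  rw [mem_toConf_iff_mem_range (injective_cons_iff.2 ⟨hx, hs⟩), range_cons, mem_insert_iff]
  rw [Conf.mem_pts_ofPts, Finset.mem_insert]
  exact or_congr_right (mem_toConf_iff_mem_range hs).symm

open Classical in
theorem toConf_remove {n : ℕ} {w : Fin n → Pt d} (hw : Function.Injective w) (i : Fin n) :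
    (remove i w).toConf = Conf.ofPts ((mk n w).toConf.pts.erase (w i)) := by
  refine Conf.ext_pts fun y => ?_
  rw [mem_toConf_iff_mem_range (injective_remove hw i), range_remove hw]
  rw [Conf.mem_pts_ofPts, Finset.mem_erase, Set.mem_sdiff, mem_singleton_iff, and_comm]
  exact and_congr_right fun _ => (mem_toConf_iff_mem_range (s := mk n w) hw).symm

theorem sum_toConf {n : ℕ} {w : Fin n → Pt d} (hw : Function.Injective w) (f : Pt d → ℝ) :
    ∑ x ∈ (mk n w).toConf.pts, f x = ∑ i, f (w i) := by
  rw [toConf_mk hw]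
  exact Finset.sum_map _ _ _

open Classical in
theorem sum_powerset_toConf {n : ℕ} {w : Fin n → Pt d} (hw : Function.Injective w)
    (f : Conf d → Conf d → ℝ) :
    ∑ ξ ∈ (mk n w).toConf.pts.powerset,
        f (Conf.ofPts ξ) (Conf.ofPts ((mk n w).toConf.pts \ ξ))
      = ∑ S : Finset (Fin n), f (sub S w).toConf (sub Sᶜ w).toConf := by
  have hpts : (mk n w).toConf.pts = Finset.univ.map ⟨w, hw⟩ := by rw [toConf_mk hw]; rfl
  rw [hpts]
  symm
  refine Finset.sum_bij (fun S _ => S.map ⟨w, hw⟩) ?_ ?_ ?_ ?_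
  · intro S _
    rw [Finset.mem_powerset]
    exact Finset.map_subset_map.2 (Finset.subset_univ S)
  · intro S _ T _ h
    exact Finset.map_injective _ h
  · intro ξ hξ
    rw [Finset.mem_powerset, Finset.subset_map_iff] at hξ
    obtain ⟨S, -, rfl⟩ := hξ
    exact ⟨S, Finset.mem_univ _, rfl⟩
  · intro S _
    rw [toConf_sub hw, toConf_sub hw, Finset.compl_eq_univ_sdiff, Finset.map_sdiff]

end FinSeq

open Classical in
/-- The union of a configuration with the entries of a sequence (the empty configuration if there
are repetitions). -/
noncomputable def glue (ξ : Conf d) (y : FinSeq (Pt d)) : Conf d :=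
  if Function.Injective y.2 ∧ ∀ j, y.2 j ∉ ξ.pts then
    Conf.ofPts (ξ.pts ∪ Finset.univ.image y.2) else Conf.empty d

/-- The default value of `glue` is that of `toConf`, so no exceptional set of y has to be discarded.
-/
theorem glue_toConf {s : FinSeq (Pt d)} (hs : Function.Injective s.2) (y : FinSeq (Pt d)) :
    glue s.toConf y = (FinSeq.append s y).toConf := by
  classical
  by_cases h : Function.Injective (FinSeq.append s y).2
  · have h' := FinSeq.injective_append_iff.1 h
    have hcond : Function.Injective y.2 ∧ ∀ j, y.2 j ∉ s.toConf.pts := by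
      refine ⟨h'.2.1, fun j hj => ?_⟩
      obtain ⟨i, hi⟩ := (FinSeq.mem_toConf hs).1 hj
      exact h'.2.2 i j hi
    rw [glue, if_pos hcond]
    refine Conf.ext_pts fun x => ?_
    rw [FinSeq.mem_toConf_iff_mem_range h, FinSeq.mem_range_append, ← FinSeq.mem_toConf_iff_mem_range hs]
    rw [Conf.mem_pts_ofPts, Finset.mem_union]
    simp
  · have hcond : ¬ (Function.Injective y.2 ∧ ∀ j, y.2 j ∉ s.toConf.pts) := by
      rintro ⟨h1, h2⟩
      refine h (FinSeq.injective_append_iff.2 ⟨hs, h1, fun i j hij => h2 j ?_⟩)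
      exact (FinSeq.mem_toConf hs).2 ⟨i, hij⟩
    rw [glue, if_neg hcond]
    exact (FinSeq.toConf_of_not_injective h).symm

end Combinatorics

/-! ### The birth operator and its dual on sequences -/

section Duality

theorem lintegral_seqMeasure {E : Type*} [MeasureSpace E] (F : FinSeq E → ℝ≥0∞) :
    ∫⁻ s, F s ∂(seqMeasure E) = ∑' n : ℕ, ((n.factorial : ℝ≥0∞)⁻¹) * ∫⁻ w : Fin n → E, F ⟨n, w⟩ := by
  unfold seqMeasure
  rw [lintegral_sum_measure]
  congr 1
  ext n
  rw [lintegral_smul_measure, (measurableEmbedding_mk n).lintegral_map]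
  rfl

/-- The version for nonnegative functions presupposes no integrability; it serves to establish
integrability in Mecke's formula. -/
theorem lintegral_seqMeasure_of_decomposition {E γ : Type*} [MeasureSpace E] [MeasurableSpace γ]
    {ν : Measure γ} {I : ℕ → Type*}
    [∀ n, Fintype (I n)] {e : ∀ n, I n → (Fin n → E) → γ} (he : ∀ n i, Measurable (e n i))
    (hν : ν = Measure.sum fun n : ℕ => ((n.factorial : ℝ≥0∞)⁻¹) •
      ∑ i, (volume : Measure (Fin n → E)).map (e n i))
    {H : γ → ℝ≥0∞} (hH : Measurable H) {F : FinSeq E → ℝ≥0∞}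
    (hF : ∀ n, ∀ᵐ w : Fin n → E, F ⟨n, w⟩ = ∑ i, H (e n i w)) :
    ∫⁻ p, H p ∂ν = ∫⁻ s, F s ∂(seqMeasure E) := by
  subst hν
  rw [lintegral_seqMeasure, lintegral_sum_measure]
  congr 1
  ext n
  rw [lintegral_smul_measure, lintegral_finsetSum_measure, lintegral_congr_ae (hF n),
    lintegral_finsetSum (f := fun i w => H (e n i w)) _ fun i _ => hH.comp (he n i)]
  simp only [smul_eq_mul]
  congr 1
  exact Finset.sum_congr rfl fun i _ => lintegral_map hH (he n i)

variable {d : ℕ}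

/-- The Mayer-type product `∏ⱼ (-φ(x - yⱼ))`. -/
noncomputable def mayer (φ : Pt d → ℝ) (x : Pt d) (y : FinSeq (Pt d)) : ℝ :=
  ∏ j, -φ (x - y.2 j)

theorem measurable_mayer {φ : Pt d → ℝ} (hφ : Measurable φ) :
    Measurable fun p : Pt d × FinSeq (Pt d) => mayer φ p.1 p.2 :=
  measurable_prod_finSeq fun n =>
    Finset.measurable_prod (f := fun (j : Fin n) (p : Pt d × (Fin n → Pt d)) => -φ (p.1 - p.2 j))
      Finset.univ fun j _ =>
        (hφ.comp (measurable_fst.sub ((measurable_pi_apply j).comp measurable_snd))).neg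

/-- The integral `∫ G(w ∪ x) ∏ⱼ (-φ(x - yⱼ)) dx`. -/
noncomputable def birthKernel (φ : Pt d → ℝ) (G : Conf d → ℝ)
    (p : FinSeq (Pt d) × FinSeq (Pt d)) : ℝ :=
  ∫ x, G (FinSeq.cons x p.1).toConf * mayer φ x p.2

/-- The integral `∫ k(w ∪ y) ∏ⱼ (-φ(x - yⱼ)) dλ(y)`. -/
noncomputable def dualKernel (φ : Pt d → ℝ) (k : Conf d → ℝ) (p : Pt d × FinSeq (Pt d)) : ℝ :=
  ∫ y, k (FinSeq.append p.2 y).toConf * mayer φ p.1 y ∂(seqMeasure (Pt d))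

open Classical in
/-- The birth part of the operator `L̂_V`, without the factor `z`. -/
noncomputable def birth (φ : Pt d → ℝ) (G : Conf d → ℝ) (η : Conf d) : ℝ :=
  ∑ ξ ∈ η.pts.powerset, ∫ x : Pt d, G (Conf.ofPts (insert x ξ)) *
    lpExp (fun y => -φ (x - y)) (Conf.ofPts (η.pts \ ξ))

open Classical in
/-- The dual of the birth part of the operator `L̂_V`, without the factor `z`. -/
noncomputable def birthDual (φ : Pt d → ℝ) (k : Conf d → ℝ) (η : Conf d) : ℝ :=
  ∑ x ∈ η.pts, ∫ y, k (glue (Conf.ofPts (η.pts.erase x)) y) * mayer φ x y ∂(seqMeasure (Pt d))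

theorem vlasovExpr_eq (φ : Pt d → ℝ) (z : ℝ) (G : Conf d → ℝ) (η : Conf d) :
    vlasovExpr φ z G η = -(η.card : ℝ) * G η + z * birth φ G η := rfl

/-- Prepending x represents the insertion of x unless x already occurs; the finitely many
exceptional x are negligible in the integral. -/
theorem birth_toConf [NeZero d] (φ : Pt d → ℝ) (G : Conf d → ℝ) {n : ℕ} {w : Fin n → Pt d}
    (hw : Function.Injective w) :
    birth φ G (FinSeq.mk n w).toConf
      = ∑ S : Finset (Fin n), birthKernel φ G (FinSeq.sub S w, FinSeq.sub Sᶜ w) := by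
  classical
  have h := FinSeq.sum_powerset_toConf hw fun ξ ζ =>
    ∫ x : Pt d, G (Conf.ofPts (insert x ξ.pts)) * lpExp (fun y => -φ (x - y)) ζ
  refine Eq.trans ?_ (h.trans ?_)
  · unfold birth
    congr!
  refine Finset.sum_congr rfl fun S _ => ?_
  refine integral_congr_ae ?_
  have hfin : (range (FinSeq.sub S w).2).Finite := finite_range _
  filter_upwards [hfin.countable.ae_notMem volume] with x hx
  rw [FinSeq.toConf_cons (FinSeq.injective_sub hw S) hx,
    FinSeq.lpExp_toConf (FinSeq.injective_sub hw Sᶜ)]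
  rfl

theorem birthDual_toConf (φ : Pt d → ℝ) (k : Conf d → ℝ) {n : ℕ} {w : Fin n → Pt d}
    (hw : Function.Injective w) :
    birthDual φ k (FinSeq.mk n w).toConf = ∑ i, dualKernel φ k (w i, FinSeq.remove i w) := by
  classical
  unfold birthDual
  rw [FinSeq.sum_toConf hw]
  refine Finset.sum_congr rfl fun i _ => ?_
  unfold dualKernel
  congr 1
  ext y
  rw [← FinSeq.toConf_remove hw, glue_toConf (FinSeq.injective_remove hw i)]

theorem measurable_birthKernel {φ : Pt d → ℝ} (hφ : Measurable φ) {G : Conf d → ℝ}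
    (hG : Measurable G) : Measurable (birthKernel φ G) := by
  have h : Measurable fun q : (FinSeq (Pt d) × FinSeq (Pt d)) × Pt d =>
      G (FinSeq.cons q.2 q.1.1).toConf * mayer φ q.2 q.1.2 := by
    refine Measurable.mul ?_ ?_
    · exact hG.comp (measurable_toConf.comp (FinSeq.measurable_cons.comp
        (measurable_snd.prodMk (measurable_fst.comp measurable_fst))))
    · exact (measurable_mayer hφ).comp (measurable_snd.prodMk (measurable_snd.comp measurable_fst))
  exact h.stronglyMeasurable.integral_prod_right'.measurable

theorem measurable_dualKernel {φ : Pt d → ℝ} (hφ : Measurable φ) {k : Conf d → ℝ}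
    (hk : Measurable k) : Measurable (dualKernel φ k) := by
  have h : Measurable fun q : (Pt d × FinSeq (Pt d)) × FinSeq (Pt d) =>
      k (FinSeq.append q.1.2 q.2).toConf * mayer φ q.1.1 q.2 := by
    refine Measurable.mul ?_ ?_
    · exact hk.comp (measurable_toConf.comp (FinSeq.measurable_append.comp
        ((measurable_snd.comp measurable_fst).prodMk measurable_snd)))
    · exact (measurable_mayer hφ).comp ((measurable_fst.comp measurable_fst).prodMk measurable_snd)
  exact h.stronglyMeasurable.integral_prod_right'.measurable

theorem measurable_birth [NeZero d] {φ : Pt d → ℝ} (hφ : Measurable φ) {G : Conf d → ℝ}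
    (hG : Measurable G) : Measurable (birth φ G) :=
  measurable_of_toConf
    (g := fun s => ∑ S : Finset (Fin s.1), birthKernel φ G (FinSeq.sub S s.2, FinSeq.sub Sᶜ s.2))
    (measurable_finSeq fun n => Finset.measurable_sum
      (f := fun (S : Finset (Fin n)) (x : Fin n → Pt d) =>
        birthKernel φ G (FinSeq.sub S x, FinSeq.sub Sᶜ x)) Finset.univ fun S _ =>
      (measurable_birthKernel hφ hG).comp
        ((FinSeq.measurable_sub S).prodMk (FinSeq.measurable_sub Sᶜ)))
    fun _ hs => birth_toConf φ G hs

theorem measurable_birthDual {φ : Pt d → ℝ} (hφ : Measurable φ) {k : Conf d → ℝ}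
    (hk : Measurable k) : Measurable (birthDual φ k) :=
  measurable_of_toConf
    (g := fun s => ∑ i, dualKernel φ k (s.2 i, FinSeq.remove i s.2))
    (measurable_finSeq fun n => Finset.measurable_sum
      (f := fun (i : Fin n) (x : Fin n → Pt d) => dualKernel φ k (x i, FinSeq.remove i x)) Finset.univ
      fun i _ => (measurable_dualKernel hφ hk).comp
        ((measurable_pi_apply i).prodMk (FinSeq.measurable_remove i)))
    fun _ hs => birthDual_toConf φ k hs

theorem integrable_lebesguePoisson_iff [NeZero d] {f : Conf d → ℝ} (hf : Measurable f) :
    Integrable f (lebesguePoisson d) ↔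
      Integrable (fun s : FinSeq (Pt d) => f s.toConf) (seqMeasure (Pt d)) := by
  rw [lebesguePoisson_eq_map]
  exact integrable_map_measure hf.aestronglyMeasurable measurable_toConf.aemeasurable

theorem integral_lebesguePoisson [NeZero d] {f : Conf d → ℝ} (hf : Measurable f) :
    ∫ η, f η ∂(lebesguePoisson d) = ∫ s : FinSeq (Pt d), f s.toConf ∂(seqMeasure (Pt d)) := by
  rw [lebesguePoisson_eq_map]
  exact integral_map measurable_toConf.aemeasurable hf.aestronglyMeasurable

theorem ae_lebesguePoisson_iff [NeZero d] {p : Conf d → Prop} (hp : MeasurableSet {η | p η}) :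
    (∀ᵐ η ∂(lebesguePoisson d), p η) ↔ ∀ᵐ s ∂(seqMeasure (Pt d)), p s.toConf := by
  rw [lebesguePoisson_eq_map]
  exact ae_map_iff measurable_toConf.aemeasurable hp

theorem ae_toConf_of_ae [NeZero d] {p : Conf d → Prop} (h : ∀ᵐ η ∂(lebesguePoisson d), p η) :
    ∀ᵐ s ∂(seqMeasure (Pt d)), p s.toConf := by
  rw [lebesguePoisson_eq_map] at h
  exact ae_of_ae_map measurable_toConf.aemeasurable h

/-- A sequence with repetitions is sent to the empty configuration, so only an inequality holds in
general. For C ≥ 1 this suffices for bounds valid on all sequences. -/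
theorem card_toConf_le (s : FinSeq (Pt d)) : s.toConf.card ≤ s.1 := by
  by_cases h : Function.Injective s.2
  · exact (FinSeq.card_toConf h).le
  · rw [FinSeq.toConf_of_not_injective h]
    exact Nat.zero_le _

/-- Mecke's formula yields integrability of `(x, w) ↦ G(w ∪ x) C^{|w|}`. -/
theorem integrable_cons [NeZero d] {G : Conf d → ℝ} (hG : Measurable G) {C : ℝ} (hC : 0 < C)
    (h : Integrable (fun η => (η.card : ℝ) * (G η * C ^ η.card)) (lebesguePoisson d)) :
    Integrable (fun p : Pt d × FinSeq (Pt d) => G (FinSeq.cons p.1 p.2).toConf * C ^ p.2.1)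
      ((volume : Measure (Pt d)).prod (seqMeasure (Pt d))) := by
  have hm : Measurable fun p : Pt d × FinSeq (Pt d) =>
      G (FinSeq.cons p.1 p.2).toConf * C ^ p.2.1 := by
    refine Measurable.mul (hG.comp (measurable_toConf.comp FinSeq.measurable_cons)) ?_
    exact (measurable_of_countable fun n : ℕ => C ^ n).comp
      (measurable_fst_finSeq.comp measurable_snd)
  refine ⟨hm.aestronglyMeasurable, ?_⟩
  have hGm : Measurable fun η : Conf d => (η.card : ℝ) * (G η * C ^ η.card) := by
    refine Measurable.mul ((measurable_of_countable fun n : ℕ => (n : ℝ)).comp measurable_card)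
      (hG.mul ((measurable_of_countable fun n : ℕ => C ^ n).comp measurable_card))
  have h1 := ((integrable_lebesguePoisson_iff hGm).1 h).const_mul C⁻¹
  have h2 := h1.hasFiniteIntegral
  unfold HasFiniteIntegral at h2 ⊢
  refine lt_of_le_of_lt (le_of_eq ?_) h2
  refine lintegral_seqMeasure_of_decomposition
    (e := fun n i w => (w i, FinSeq.remove i w))
    (fun n i => (measurable_pi_apply i).prodMk (FinSeq.measurable_remove i))
    volume_prod_seqMeasure hm.enorm fun n => ?_
  filter_upwards [ae_injective n] with w hw
  -- Reinserting the removed point gives back w, so all n terms agree; their number is the factor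
  -- |η| in the hypothesis.
  have hsum : ∀ i ∈ (Finset.univ : Finset (Fin n)),
      ‖G (FinSeq.cons (w i) (FinSeq.remove i w)).toConf * C ^ (FinSeq.remove i w).1‖ₑ
        = ‖G (FinSeq.mk n w).toConf * C ^ (n - 1)‖ₑ := fun i _ => by
    rw [FinSeq.toConf_cons_remove hw, FinSeq.fst_remove]
  rw [Finset.sum_congr rfl hsum, Finset.sum_const, Finset.card_univ, Fintype.card_fin]
  have hcard : (FinSeq.mk n w).toConf.card = n := FinSeq.card_toConf (s := FinSeq.mk n w) hw
  change ‖C⁻¹ * (((FinSeq.mk n w).toConf.card : ℝ) *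
    (G (FinSeq.mk n w).toConf * C ^ (FinSeq.mk n w).toConf.card))‖ₑ = _
  rw [hcard]
  cases n with
  | zero => simp
  | succ n =>
    have : C⁻¹ * (((n + 1 : ℕ) : ℝ) * (G (FinSeq.mk (n + 1) w).toConf * C ^ (n + 1)))
        = ((n + 1 : ℕ) : ℝ) * (G (FinSeq.mk (n + 1) w).toConf * C ^ n) := by
      field_simp
      ring
    rw [this, enorm_mul, nsmul_eq_mul, Nat.add_sub_cancel]
    congr 1
    rw [Real.enorm_natCast]

end Duality

/-! ### The duality formula -/

section DualityFormula

variable {d : ℕ}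

theorem abs_mayer {φ : Pt d → ℝ} (hφ : ∀ x, 0 ≤ φ x) (x : Pt d) (y : FinSeq (Pt d)) :
    |mayer φ x y| = ∏ j, φ (x - y.2 j) := by
  unfold mayer
  rw [Finset.abs_prod]
  exact Finset.prod_congr rfl fun j _ => by rw [abs_neg, abs_of_nonneg (hφ _)]

/-- The power of C is distributed over the factors and the exponential formula applies; translation
and reflection invariance remove x. This is the source of the constant e^{Cβ}. -/
theorem integrable_mayer_bound {φ : Pt d → ℝ} (hφi : Integrable φ) (C : ℝ) (x : Pt d) :
    Integrable (fun y : FinSeq (Pt d) => C ^ y.1 * ∏ j, φ (x - y.2 j)) (seqMeasure (Pt d)) ∧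
      ∫ y : FinSeq (Pt d), C ^ y.1 * ∏ j, φ (x - y.2 j) ∂(seqMeasure (Pt d))
        = Real.exp (C * ∫ y, φ y) := by
  have h := integral_seqMeasure_prod ((hφi.comp_sub_left x).const_mul C)
  rw [integral_const_mul, integral_sub_left_eq_self φ volume x] at h
  have he : (fun y : FinSeq (Pt d) => C ^ y.1 * ∏ j, φ (x - y.2 j))
      = fun y : FinSeq (Pt d) => ∏ j, (C * φ (x - y.2 j)) := by
    ext y
    rw [Finset.prod_mul_distrib, Finset.prod_const, Finset.card_univ, Fintype.card_fin]
  rw [he]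
  exact h

theorem abs_le_append {k : Conf d → ℝ} {C M : ℝ} (hC : 1 ≤ C) (hM : 0 ≤ M)
    (hk : ∀ η, |k η| ≤ M * C ^ η.card) (w y : FinSeq (Pt d)) :
    |k (FinSeq.append w y).toConf| ≤ M * (C ^ w.1 * C ^ y.1) := by
  refine (hk _).trans ?_
  rw [← pow_add]
  exact mul_le_mul_of_nonneg_left (pow_le_pow_right₀ hC (card_toConf_le _)) hM

/-- The bound on k splits as C^{|w|} C^{|y|}. The integral over y then contributes the constant
e^{Cβ}, and what remains is integrable in (x, w) by Mecke's formula. -/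
theorem integrable_duality [NeZero d] {φ : Pt d → ℝ} (hφm : Measurable φ) (hφ : ∀ x, 0 ≤ φ x)
    (hφi : Integrable φ) {C M : ℝ} (hC : 1 ≤ C) (hM : 0 ≤ M) {G k : Conf d → ℝ}
    (hG : Measurable G) (hk : Measurable k) (hkb : ∀ η, |k η| ≤ M * C ^ η.card)
    (h : Integrable (fun η => (η.card : ℝ) * (G η * C ^ η.card)) (lebesguePoisson d)) :
    Integrable (fun q : (Pt d × FinSeq (Pt d)) × FinSeq (Pt d) =>
      G (FinSeq.cons q.1.1 q.1.2).toConf * mayer φ q.1.1 q.2 *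
        k (FinSeq.append q.1.2 q.2).toConf)
      (((volume : Measure (Pt d)).prod (seqMeasure (Pt d))).prod (seqMeasure (Pt d))) := by
  have hcons : Measurable fun p : Pt d × FinSeq (Pt d) => G (FinSeq.cons p.1 p.2).toConf :=
    hG.comp (measurable_toConf.comp FinSeq.measurable_cons)
  have hpow : Measurable fun w : FinSeq (Pt d) => C ^ w.1 :=
    (measurable_of_countable fun n : ℕ => C ^ n).comp measurable_fst_finSeq
  have hmay : Measurable fun q : (Pt d × FinSeq (Pt d)) × FinSeq (Pt d) => mayer φ q.1.1 q.2 :=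
    (measurable_mayer hφm).comp ((measurable_fst.comp measurable_fst).prodMk measurable_snd)
  have hm : Measurable fun q : (Pt d × FinSeq (Pt d)) × FinSeq (Pt d) =>
      G (FinSeq.cons q.1.1 q.1.2).toConf * mayer φ q.1.1 q.2 *
        k (FinSeq.append q.1.2 q.2).toConf :=
    ((hcons.comp measurable_fst).mul hmay).mul
      (hk.comp (measurable_toConf.comp (FinSeq.measurable_append.comp
        ((measurable_snd.comp measurable_fst).prodMk measurable_snd))))
  set ψ : Pt d × FinSeq (Pt d) → ℝ := fun p => G (FinSeq.cons p.1 p.2).toConf * C ^ p.2.1 with hψ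
  have hψi := integrable_cons hG (by linarith) h
  have hψm : Measurable ψ := hcons.mul (hpow.comp measurable_snd)
  have hdom : Integrable (fun q : (Pt d × FinSeq (Pt d)) × FinSeq (Pt d) =>
      M * |ψ q.1| * (C ^ q.2.1 * |mayer φ q.1.1 q.2|))
      (((volume : Measure (Pt d)).prod (seqMeasure (Pt d))).prod (seqMeasure (Pt d))) := by
    have hdm : Measurable fun q : (Pt d × FinSeq (Pt d)) × FinSeq (Pt d) =>
        M * |ψ q.1| * (C ^ q.2.1 * |mayer φ q.1.1 q.2|) :=
      (((hψm.comp measurable_fst).abs).const_mul M).mul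
        ((hpow.comp measurable_snd).mul hmay.abs)
    rw [integrable_prod_iff hdm.aestronglyMeasurable]
    constructor
    · refine Eventually.of_forall fun p => ?_
      change Integrable (fun y : FinSeq (Pt d) => M * |ψ p| * (C ^ y.1 * |mayer φ p.1 y|)) _
      refine Integrable.const_mul ?_ _
      simp_rw [abs_mayer hφ]
      exact (integrable_mayer_bound hφi C p.1).1
    · have he : (fun p : Pt d × FinSeq (Pt d) => ∫ y : FinSeq (Pt d),
          ‖M * |ψ p| * (C ^ y.1 * |mayer φ p.1 y|)‖ ∂(seqMeasure (Pt d)))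
          = fun p => M * |ψ p| * Real.exp (C * ∫ y, φ y) := by
        ext p
        rw [← (integrable_mayer_bound hφi C p.1).2, ← integral_const_mul]
        congr 1
        ext y
        rw [← abs_mayer hφ, Real.norm_of_nonneg]
        positivity
      rw [he]
      exact (hψi.abs.const_mul M).mul_const _
  refine hdom.mono' hm.aestronglyMeasurable (Eventually.of_forall fun q => ?_)
  rw [Real.norm_eq_abs, abs_mul, abs_mul]
  have h1 := abs_le_append hC hM hkb q.1.2 q.2
  have h2 : |ψ q.1| = |G (FinSeq.cons q.1.1 q.1.2).toConf| * C ^ q.1.2.1 := by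
    rw [hψ, abs_mul, abs_of_nonneg (a := C ^ _) (by positivity)]
  calc |G (FinSeq.cons q.1.1 q.1.2).toConf| * |mayer φ q.1.1 q.2|
        * |k (FinSeq.append q.1.2 q.2).toConf|
      ≤ |G (FinSeq.cons q.1.1 q.1.2).toConf| * |mayer φ q.1.1 q.2|
        * (M * (C ^ q.1.2.1 * C ^ q.2.1)) := by gcongr
    _ = M * |ψ q.1| * (C ^ q.2.1 * |mayer φ q.1.1 q.2|) := by rw [h2]; ring

/-- Both integrals equal that of G(w ∪ x) ∏ⱼ(-φ(x - yⱼ)) k(w ∪ y): Minlos recombines w and y into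
the argument of k, Mecke recombines w and x into the argument of G, and Fubini exchanges the order.
-/
theorem integral_birth_mul [NeZero d] {φ : Pt d → ℝ} (hφm : Measurable φ) (hφ : ∀ x, 0 ≤ φ x)
    (hφi : Integrable φ) {C M : ℝ} (hC : 1 ≤ C) (hM : 0 ≤ M) {G k : Conf d → ℝ}
    (hG : Measurable G) (hk : Measurable k) (hkb : ∀ η, |k η| ≤ M * C ^ η.card)
    (h : Integrable (fun η => (η.card : ℝ) * (G η * C ^ η.card)) (lebesguePoisson d)) :
    Integrable (fun η => birth φ G η * k η) (lebesguePoisson d) ∧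
    Integrable (fun η => G η * birthDual φ k η) (lebesguePoisson d) ∧
    ∫ η, birth φ G η * k η ∂(lebesguePoisson d)
      = ∫ η, G η * birthDual φ k η ∂(lebesguePoisson d) := by
  have hΦ := integrable_duality hφm hφ hφi hC hM hG hk hkb h
  have hmL : Measurable fun η => birth φ G η * k η := (measurable_birth hφm hG).mul hk
  have hmR : Measurable fun η => G η * birthDual φ k η := hG.mul (measurable_birthDual hφm hk)
  rw [integrable_lebesguePoisson_iff hmL, integrable_lebesguePoisson_iff hmR,
    integral_lebesguePoisson hmL, integral_lebesguePoisson hmR]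
  have hassoc := (measurePreserving_prodAssoc (volume : Measure (Pt d)) (seqMeasure (Pt d))
    (seqMeasure (Pt d))).symm
  have hΨ := (hassoc.integrable_comp_emb (MeasurableEquiv.measurableEmbedding _)).2 hΦ
  have hΨint := hassoc.integral_comp (MeasurableEquiv.measurableEmbedding _)
    (fun q : (Pt d × FinSeq (Pt d)) × FinSeq (Pt d) =>
      G (FinSeq.cons q.1.1 q.1.2).toConf * mayer φ q.1.1 q.2 *
        k (FinSeq.append q.1.2 q.2).toConf)
  have hR := integral_seqMeasure_of_decomposition
    (e := fun n i w => (w i, FinSeq.remove i w))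
    (fun n i => (measurable_pi_apply i).prodMk (FinSeq.measurable_remove i))
    volume_prod_seqMeasure hΦ.integral_prod_left
    (F := fun s : FinSeq (Pt d) => G s.toConf * birthDual φ k s.toConf) (fun n => by
      filter_upwards [ae_injective n] with w hw
      change G (FinSeq.mk n w).toConf * birthDual φ k (FinSeq.mk n w).toConf = _
      rw [birthDual_toConf φ k hw, Finset.mul_sum]
      refine Finset.sum_congr rfl fun i _ => ?_
      rw [dualKernel, ← integral_const_mul]
      congr 1
      ext y
      simp only
      rw [FinSeq.toConf_cons_remove hw]
      ring)
  have hL := integral_seqMeasure_of_decomposition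
    (e := fun n S w => (FinSeq.sub S w, FinSeq.sub Sᶜ w))
    (fun n S => (FinSeq.measurable_sub S).prodMk (FinSeq.measurable_sub Sᶜ))
    seqMeasure_prod_seqMeasure hΨ.integral_prod_right
    (F := fun s : FinSeq (Pt d) => birth φ G s.toConf * k s.toConf) (fun n => by
      filter_upwards [ae_injective n] with w hw
      change birth φ G (FinSeq.mk n w).toConf * k (FinSeq.mk n w).toConf = _
      rw [birth_toConf φ G hw, Finset.sum_mul]
      refine Finset.sum_congr rfl fun S _ => ?_
      rw [birthKernel, ← integral_mul_const, ← FinSeq.toConf_append_sub hw S]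
      rfl)
  refine ⟨hL.1, hR.1, hL.2.trans (Eq.trans ?_ hR.2.symm)⟩
  rw [← integral_prod _ hΦ, ← hΨint]
  exact (integral_prod_symm _ hΨ).symm

end DualityFormula

/-! ### Bounds for the dual birth operator -/

section DualBound

variable {d : ℕ}

theorem measurable_const_pow_card (C : ℝ) : Measurable fun η : Conf d => C ^ η.card :=
  (measurable_of_countable fun n : ℕ => C ^ n).comp measurable_card

theorem measurable_comp_card (a : ℕ → ℝ) : Measurable fun η : Conf d => a η.card :=
  (measurable_of_countable a).comp measurable_card

theorem birthDual_congr [NeZero d] {φ : Pt d → ℝ} (hφm : Measurable φ) {k k' : Conf d → ℝ}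
    (hk : Measurable k) (hk' : Measurable k') (h : k =ᵐ[lebesguePoisson d] k') :
    birthDual φ k =ᵐ[lebesguePoisson d] birthDual φ k' := by
  refine (ae_lebesguePoisson_iff (measurableSet_eq_fun (measurable_birthDual hφm hk)
    (measurable_birthDual hφm hk'))).2 (ae_seqMeasure_iff.2 fun n => ?_)
  filter_upwards [ae_remove (ae_append (ae_toConf_of_ae h)) n, ae_injective n] with w h1 hw
  change birthDual φ k (FinSeq.mk n w).toConf = birthDual φ k' (FinSeq.mk n w).toConf
  rw [birthDual_toConf φ k hw, birthDual_toConf φ k' hw]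
  refine Finset.sum_congr rfl fun i _ => integral_congr_ae ?_
  filter_upwards [h1 i] with y hy
  rw [hy]

/-- Each of the n terms evaluates k on configurations with n - 1 + |y| points. Since `a` decreases
it is at most its value at n - 1, and the weights C^{|y|} integrate to e^{Cβ}. -/
theorem abs_birthDual_le [NeZero d] {φ : Pt d → ℝ} (hφm : Measurable φ) (hφ : ∀ x, 0 ≤ φ x)
    (hφi : Integrable φ) {C : ℝ} (hC : 0 ≤ C) {k : Conf d → ℝ}
    (hk : Measurable k) {a : ℕ → ℝ} (ha : Antitone a)
    (h : ∀ᵐ η ∂(lebesguePoisson d), |k η| ≤ a η.card * C ^ η.card) :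
    ∀ᵐ η ∂(lebesguePoisson d), |birthDual φ k η|
      ≤ η.card * (a (η.card - 1) * C ^ (η.card - 1) * Real.exp (C * ∫ y, φ y)) := by
  refine (ae_lebesguePoisson_iff (measurableSet_le (measurable_birthDual hφm hk).abs
    (measurable_comp_card fun n => n * (a (n - 1) * C ^ (n - 1) * Real.exp (C * ∫ y, φ y))))).2
    (ae_seqMeasure_iff.2 fun n => ?_)
  filter_upwards [ae_remove (ae_append ((ae_toConf_of_ae h).and ae_seq_injective)) n,
    ae_injective n] with w h1 hw
  change |birthDual φ k (FinSeq.mk n w).toConf| ≤ ((FinSeq.mk n w).toConf.card : ℝ) *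
    (a ((FinSeq.mk n w).toConf.card - 1) * C ^ ((FinSeq.mk n w).toConf.card - 1) * _)
  rw [birthDual_toConf φ k hw, FinSeq.card_toConf (s := FinSeq.mk n w) hw]
  change _ ≤ (n : ℝ) * (a (n - 1) * C ^ (n - 1) * _)
  have hterm : ∀ i : Fin n, |dualKernel φ k (w i, FinSeq.remove i w)|
      ≤ a (n - 1) * C ^ (n - 1) * Real.exp (C * ∫ y, φ y) := by
    intro i
    have hb := integrable_mayer_bound hφi C (w i)
    rw [← hb.2, ← integral_const_mul, dualKernel, ← Real.norm_eq_abs]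
    refine norm_integral_le_of_norm_le (hb.1.const_mul _) ?_
    filter_upwards [h1 i] with y hy
    obtain ⟨hy1, hy2⟩ := hy
    rw [FinSeq.card_toConf hy2] at hy1
    rw [norm_mul, Real.norm_eq_abs, Real.norm_eq_abs, abs_mayer hφ, ← mul_assoc]
    refine mul_le_mul_of_nonneg_right (hy1.trans ?_) (Finset.prod_nonneg fun j _ => hφ _)
    change a ((FinSeq.remove i w).1 + y.1) * C ^ ((FinSeq.remove i w).1 + y.1) ≤ _
    rw [FinSeq.fst_remove, pow_add, ← mul_assoc]
    gcongr
    exact ha (Nat.le_add_right _ _)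
  calc |∑ i, dualKernel φ k (w i, FinSeq.remove i w)|
      ≤ ∑ i, |dualKernel φ k (w i, FinSeq.remove i w)| := Finset.abs_sum_le_sum_abs _ _
    _ ≤ ∑ _i : Fin n, a (n - 1) * C ^ (n - 1) * Real.exp (C * ∫ y, φ y) :=
        Finset.sum_le_sum fun i _ => hterm i
    _ = _ := by rw [Finset.sum_const, Finset.card_univ, Fintype.card_fin, nsmul_eq_mul]

theorem integrable_dualKernel {φ : Pt d → ℝ} (hφm : Measurable φ) (hφ : ∀ x, 0 ≤ φ x)
    (hφi : Integrable φ) {C M : ℝ} (hC : 1 ≤ C) (hM : 0 ≤ M) {k : Conf d → ℝ}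
    (hk : Measurable k) (hkb : ∀ η, |k η| ≤ M * C ^ η.card) (x : Pt d) (w : FinSeq (Pt d)) :
    Integrable (fun y => k (FinSeq.append w y).toConf * mayer φ x y) (seqMeasure (Pt d)) := by
  refine ((integrable_mayer_bound hφi C x).1.const_mul (M * C ^ w.1)).mono' ?_
    (Eventually.of_forall fun y => ?_)
  · exact ((hk.comp (measurable_toConf.comp (FinSeq.measurable_append.comp
      (measurable_const.prodMk measurable_id)))).mul ((measurable_mayer hφm).comp
        (measurable_const.prodMk measurable_id))).aestronglyMeasurable
  · rw [norm_mul, Real.norm_eq_abs, Real.norm_eq_abs, abs_mayer hφ, ← mul_assoc]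
    refine mul_le_mul_of_nonneg_right ?_ (Finset.prod_nonneg fun j _ => hφ _)
    have := abs_le_append hC hM hkb w y
    rwa [← mul_assoc] at this

theorem birthDual_add_smul [NeZero d] {φ : Pt d → ℝ} (hφm : Measurable φ) (hφ : ∀ x, 0 ≤ φ x)
    (hφi : Integrable φ) {C M M' : ℝ} (hC : 1 ≤ C) (hM : 0 ≤ M) (hM' : 0 ≤ M')
    {k k' : Conf d → ℝ} (hk : Measurable k) (hkb : ∀ η, |k η| ≤ M * C ^ η.card)
    (hk' : Measurable k') (hkb' : ∀ η, |k' η| ≤ M' * C ^ η.card) (c : ℝ) :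
    birthDual φ (fun η => k η + c * k' η)
      =ᵐ[lebesguePoisson d] fun η => birthDual φ k η + c * birthDual φ k' η := by
  refine (ae_lebesguePoisson_iff (measurableSet_eq_fun
    (measurable_birthDual hφm (hk.add (hk'.const_mul c)))
    ((measurable_birthDual hφm hk).add ((measurable_birthDual hφm hk').const_mul c)))).2
    (ae_seqMeasure_iff.2 fun n => ?_)
  filter_upwards [ae_injective n] with w hw
  change birthDual φ (fun η => k η + c * k' η) (FinSeq.mk n w).toConf
    = birthDual φ k (FinSeq.mk n w).toConf + c * birthDual φ k' (FinSeq.mk n w).toConf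
  rw [birthDual_toConf φ k hw, birthDual_toConf φ k' hw, birthDual_toConf φ _ hw,
    Finset.mul_sum, ← Finset.sum_add_distrib]
  refine Finset.sum_congr rfl fun i _ => ?_
  unfold dualKernel
  rw [← integral_const_mul, ← integral_add (integrable_dualKernel hφm hφ hφi hC hM hk hkb _ _)
    ((integrable_dualKernel hφm hφ hφi hC hM' hk' hkb' _ _).const_mul c)]
  congr 1
  ext y
  ring

theorem KSpace.measurable_fn (C : ℝ) (u : KSpace d) : Measurable (u.fn C) :=
  (measurable_const_pow_card C).mul (Lp.stronglyMeasurable u).measurable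

/-- Every element of `𝓚_C` has a representative that obeys the norm bound everywhere. -/
theorem KSpace.exists_bounded_rep {C : ℝ} (hC : 0 ≤ C) (u : KSpace d) :
    ∃ k : Conf d → ℝ, Measurable k ∧ (∀ η, |k η| ≤ ‖u‖ * C ^ η.card) ∧
      u.fn C =ᵐ[lebesguePoisson d] k := by
  refine ⟨fun η => C ^ η.card * max (-‖u‖) (min (u η) ‖u‖), ?_, fun η => ?_, ?_⟩
  · exact (measurable_const_pow_card C).mul
      (measurable_const.max ((Lp.stronglyMeasurable u).measurable.min measurable_const))
  · rw [abs_mul, abs_of_nonneg (a := C ^ _) (by positivity), mul_comm]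
    refine mul_le_mul_of_nonneg_right ?_ (by positivity)
    have := norm_nonneg u
    rw [abs_le]
    exact ⟨le_max_left _ _, max_le (by linarith) (min_le_right _ _)⟩
  · filter_upwards [ae_abs_le_norm u] with η hη
    rw [abs_le] at hη
    rw [KSpace.fn, min_eq_left hη.2, max_eq_right hη.1]

/-- The one missing power of C is what z E ≤ C compensates; for n = 0 the prefactor n makes the
truncated exponent irrelevant. -/
theorem pow_pred_bound {C z E : ℝ} (hC : 0 < C) (h : z * E ≤ C) {b : ℝ} (hb : 0 ≤ b) (n : ℕ) :
    z * (C ^ n)⁻¹ * (n * (b * C ^ (n - 1) * E)) ≤ n * b := by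
  cases n with
  | zero => simp
  | succ n =>
    have : z * (C ^ (n + 1))⁻¹ * (((n + 1 : ℕ) : ℝ) * (b * C ^ (n + 1 - 1) * E))
        = ((n + 1 : ℕ) : ℝ) * b * ((z * E) / C) := by
      rw [Nat.add_sub_cancel, pow_succ]
      field_simp
    rw [this]
    refine mul_le_of_le_one_right (by positivity) ?_
    rwa [div_le_one hC]

theorem ae_abs_birthDual_fn_le [NeZero d] {φ : Pt d → ℝ} (hφm : Measurable φ) (hφ : ∀ x, 0 ≤ φ x)
    (hφi : Integrable φ) {C z : ℝ} (hC : 0 < C) (hz : 0 ≤ z)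
    (hzC : z * Real.exp (C * ∫ y, φ y) ≤ C) (u : KSpace d) {a : ℕ → ℝ} (ha : Antitone a)
    (ha0 : ∀ n, 0 ≤ a n) (h : ∀ᵐ η ∂(lebesguePoisson d), |u η| ≤ a η.card) :
    ∀ᵐ η ∂(lebesguePoisson d),
      |z * (C ^ η.card)⁻¹ * birthDual φ (u.fn C) η| ≤ η.card * a (η.card - 1) := by
  have h1 : ∀ᵐ η ∂(lebesguePoisson d), |u.fn C η| ≤ a η.card * C ^ η.card := by
    filter_upwards [h] with η hη
    rw [KSpace.fn, abs_mul, abs_of_nonneg (a := C ^ _) (by positivity), mul_comm]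
    gcongr
  filter_upwards [abs_birthDual_le hφm hφ hφi hC.le (u.measurable_fn C) ha h1] with η hη
  rw [abs_mul, abs_of_nonneg (a := z * _) (by positivity)]
  exact (mul_le_mul_of_nonneg_left hη (by positivity)).trans
    (pow_pred_bound hC hzC (ha0 _) _)

/-- The birth part of `L̂_V^*`, divided by `1 + |η|`, as a linear map. -/
theorem exists_dominated [NeZero d] {φ : Pt d → ℝ} (hφm : Measurable φ) (hφ : ∀ x, 0 ≤ φ x)
    (hφi : Integrable φ) {C z : ℝ} (hC : 1 ≤ C) (hz : 0 ≤ z)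
    (hzC : z * Real.exp (C * ∫ y, φ y) ≤ C) :
    ∃ S : KSpace d →ₗ[ℝ] KSpace d, Dominated (lebesguePoisson d) Conf.card S ∧
      ∀ u, ∀ᵐ η ∂(lebesguePoisson d),
        (1 + (η.card : ℝ)) * S u η = z * (C ^ η.card)⁻¹ * birthDual φ (u.fn C) η := by
  have hC0 : 0 < C := by linarith
  have hex : ∀ u : KSpace d, ∃ s : KSpace d, s =ᵐ[lebesguePoisson d]
      fun η => (1 + (η.card : ℝ))⁻¹ * (z * (C ^ η.card)⁻¹ * birthDual φ (u.fn C) η) := by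
    intro u
    refine exists_linfty_of_ae_abs_le (K := ‖u‖) ?_ ?_
    · exact ((measurable_comp_card fun n => (1 + (n : ℝ))⁻¹).mul
        ((measurable_comp_card fun n => z * (C ^ n)⁻¹).mul
          (measurable_birthDual hφm (u.measurable_fn C)))).aestronglyMeasurable
    · filter_upwards [ae_abs_birthDual_fn_le hφm hφ hφi hC0 hz hzC u (a := fun _ => ‖u‖)
        antitone_const (fun _ => norm_nonneg _) (ae_abs_le_norm u)] with η hη
      rw [abs_mul, abs_of_nonneg (a := (1 + (η.card : ℝ))⁻¹) (by positivity), inv_mul_le_iff₀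
        (by positivity)]
      nlinarith [norm_nonneg u]
  choose S hS using hex
  -- Additivity of the inner integrals needs integrability for every sequence, hence representatives
  -- bounded everywhere and not just almost everywhere.
  have hlin : ∀ u v c, birthDual φ (KSpace.fn C (u + c • v)) =ᵐ[lebesguePoisson d]
      fun η => birthDual φ (u.fn C) η + c * birthDual φ (v.fn C) η := by
    intro u v c
    obtain ⟨k, hkm, hkb, hk⟩ := u.exists_bounded_rep hC0.le
    obtain ⟨k', hkm', hkb', hk'⟩ := v.exists_bounded_rep hC0.le
    have h1 : KSpace.fn C (u + c • v) =ᵐ[lebesguePoisson d] fun η => k η + c * k' η := by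
      filter_upwards [Lp.coeFn_add u (c • v), Lp.coeFn_smul c v, hk, hk'] with η h1 h2 h3 h4
      rw [← h3, ← h4]
      simp only [KSpace.fn]
      rw [h1, Pi.add_apply, h2, Pi.smul_apply, smul_eq_mul]
      ring
    have h2 := birthDual_congr hφm (KSpace.measurable_fn C (u + c • v))
      (k' := fun η => k η + c * k' η) (hkm.add (hkm'.const_mul c)) h1
    filter_upwards [h2, birthDual_add_smul hφm hφ hφi hC (norm_nonneg u) (norm_nonneg v) hkm hkb
      hkm' hkb' c, birthDual_congr hφm (u.measurable_fn C) hkm hk,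
      birthDual_congr hφm (v.measurable_fn C) hkm' hk'] with η h3 h4 h5 h6
    rw [h3, h4, h5, h6]
  have hSlin : ∀ u v (c : ℝ), S (u + c • v) = S u + c • S v := by
    intro u v c
    refine Lp.ext ?_
    filter_upwards [hlin u v c, hS u, hS v, hS (u + c • v), Lp.coeFn_add (S u) (c • S v),
      Lp.coeFn_smul c (S v)] with η h1 h2 h3 h4 h5 h6
    rw [h4, h1, h5, Pi.add_apply, h6, Pi.smul_apply, h2, h3, smul_eq_mul]
    ring
  have hS0 : S 0 = 0 := by
    have h := hSlin 0 0 1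
    simp only [one_smul, add_zero] at h
    exact left_eq_add.1 h
  let L : KSpace d →ₗ[ℝ] KSpace d :=
    { toFun := S
      map_add' := fun u v => by simpa using hSlin u v 1
      map_smul' := fun c v => by simpa [hS0] using hSlin 0 v c }
  have hL : ∀ u, ∀ᵐ η ∂(lebesguePoisson d),
      (1 + (η.card : ℝ)) * L u η = z * (C ^ η.card)⁻¹ * birthDual φ (u.fn C) η := by
    intro u
    filter_upwards [hS u] with η hη
    change (1 + (η.card : ℝ)) * S u η = _
    rw [hη, mul_inv_cancel_left₀ (by positivity)]
  refine ⟨L, fun u a ha ha0 h => ?_, hL⟩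
  filter_upwards [hL u, ae_abs_birthDual_fn_le hφm hφ hφi hC0 hz hzC u ha ha0 h] with η h1 h2
  rw [← abs_of_nonneg (a := 1 + (η.card : ℝ)) (by positivity), ← abs_mul, h1]
  exact h2

end DualBound

/-! ### Identification of the dual operator -/

section DualGraph

variable {d : ℕ}

theorem measurable_weight (d : ℕ) (C : ℝ) :
    Measurable fun η : Conf d => ENNReal.ofReal (C ^ η.card) :=
  (measurable_const_pow_card C).ennreal_ofReal

theorem integrable_weighted_iff {C : ℝ} (hC : 0 < C) {f : Conf d → ℝ} :
    Integrable f (lebesguePoissonWeighted d C) ↔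
      Integrable (fun η => f η * C ^ η.card) (lebesguePoisson d) := by
  unfold lebesguePoissonWeighted
  rw [integrable_withDensity_iff (measurable_weight d C)
    (Eventually.of_forall fun _ => ENNReal.ofReal_lt_top)]
  refine integrable_congr (Eventually.of_forall fun η => ?_)
  simp only
  rw [ENNReal.toReal_ofReal (by positivity)]

theorem ae_weighted_iff {C : ℝ} (hC : 0 < C) {p : Conf d → Prop} :
    (∀ᵐ η ∂(lebesguePoissonWeighted d C), p η) ↔ ∀ᵐ η ∂(lebesguePoisson d), p η := by
  unfold lebesguePoissonWeighted
  rw [ae_withDensity_iff (measurable_weight d C)]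
  refine eventually_congr (Eventually.of_forall fun η => ?_)
  have : ENNReal.ofReal (C ^ η.card) ≠ 0 := by
    rw [Ne, ENNReal.ofReal_eq_zero, not_le]
    positivity
  simp [this]

theorem integrable_mul_fn {C : ℝ} (hC : 0 < C) {G : Conf d → ℝ}
    (hG : Integrable G (lebesguePoissonWeighted d C)) (u : KSpace d) :
    Integrable (fun η => G η * u.fn C η) (lebesguePoisson d) := by
  have h := (integrable_weighted_iff hC).1 hG
  have h1 := h.mul_bdd (c := ‖u‖) (Lp.aestronglyMeasurable u) (by
    simpa only [Real.norm_eq_abs] using ae_abs_le_norm u)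
  refine h1.congr (Eventually.of_forall fun η => ?_)
  simp only [KSpace.fn]
  ring

/-- The pairing with an element of `𝓚_C` as a continuous function on `𝓛_C`. -/
theorem continuous_pairing {C : ℝ} (hC : 0 < C) (u : KSpace d) :
    Continuous fun G : LSpace d C => ∫ η, G η * u.fn C η ∂(lebesguePoisson d) := by
  refine (LipschitzWith.of_dist_le_mul (K := ‖u‖₊) fun G H => ?_).continuous
  have hG := L1.integrable_coeFn G
  have hH := L1.integrable_coeFn H
  have hsub := (hG.sub hH)
  rw [Real.dist_eq, ← integral_sub (integrable_mul_fn hC hG u) (integrable_mul_fn hC hH u),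
    ← Real.norm_eq_abs, dist_eq_norm, L1.norm_eq_integral_norm]
  have h1 : ∫ η, ‖(G - H) η‖ ∂(lebesguePoissonWeighted d C)
      = ∫ η, |G η - H η| * C ^ η.card ∂(lebesguePoisson d) := by
    have h2 : ∫ η, ‖(G - H) η‖ ∂(lebesguePoissonWeighted d C)
        = ∫ η, |G η - H η| ∂(lebesguePoissonWeighted d C) := by
      refine integral_congr_ae ?_
      filter_upwards [Lp.coeFn_sub G H] with η hη
      rw [hη, Pi.sub_apply, Real.norm_eq_abs]
    rw [h2]
    unfold lebesguePoissonWeighted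
    rw [integral_withDensity_eq_integral_toReal_smul (measurable_weight d C)
      (Eventually.of_forall fun _ => ENNReal.ofReal_lt_top)]
    refine integral_congr_ae (Eventually.of_forall fun η => ?_)
    simp only
    rw [ENNReal.toReal_ofReal (by positivity), smul_eq_mul, mul_comm]
  rw [h1, coe_nnnorm, ← integral_const_mul]
  refine norm_integral_le_of_norm_le
    (((integrable_weighted_iff hC).1 hsub.abs).const_mul _) ?_
  filter_upwards [ae_abs_le_norm u] with η hη
  rw [← sub_mul, norm_mul, Real.norm_eq_abs, Real.norm_eq_abs, KSpace.fn, abs_mul,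
    abs_of_nonneg (a := C ^ η.card) (by positivity)]
  calc |G η - H η| * (C ^ η.card * |u η|) ≤ |G η - H η| * (C ^ η.card * ‖u‖) := by gcongr
    _ = _ := by ring

/-- The inequality n ≤ 2ⁿ: the passage from C to 2C in the weight pays for the factor |η|. -/
theorem integrable_card_mul {C : ℝ} (hC : 0 < C) {G : Conf d → ℝ} (hG : Measurable G)
    (h : Integrable G (lebesguePoissonWeighted d (2 * C))) :
    Integrable (fun η => (η.card : ℝ) * (G η * C ^ η.card)) (lebesguePoisson d) := by
  refine ((integrable_weighted_iff (by positivity)).1 h).mono ?_ (Eventually.of_forall fun η => ?_)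
  · exact ((measurable_comp_card fun n => (n : ℝ)).mul
      (hG.mul (measurable_const_pow_card C))).aestronglyMeasurable
  · rw [norm_mul, norm_mul, norm_mul, mul_pow, norm_mul, mul_left_comm]
    refine mul_le_mul_of_nonneg_left (mul_le_mul_of_nonneg_right ?_ (norm_nonneg _)) (norm_nonneg _)
    rw [Real.norm_natCast, Real.norm_of_nonneg (by positivity)]
    exact_mod_cast Nat.lt_two_pow_self.le

/-- The expression of `L̂_V^*` applied to the function represented by `u`. -/
noncomputable def dualExpr (φ : Pt d → ℝ) (z C : ℝ) (u : KSpace d) (η : Conf d) : ℝ :=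
  -(η.card : ℝ) * u.fn C η + z * birthDual φ (u.fn C) η

theorem measurable_dualExpr {φ : Pt d → ℝ} (hφm : Measurable φ) (z C : ℝ) (u : KSpace d) :
    Measurable (dualExpr φ z C u) :=
  ((measurable_comp_card fun n => -(n : ℝ)).mul (u.measurable_fn C)).add
    ((measurable_birthDual hφm (u.measurable_fn C)).const_mul z)

theorem integrable_vlasovExpr [NeZero d] {φ : Pt d → ℝ} (hφm : Measurable φ) (hφ : ∀ x, 0 ≤ φ x)
    (hφi : Integrable φ) {C : ℝ} (hC : 1 ≤ C) (z : ℝ) {G : Conf d → ℝ} (hG : Measurable G)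
    (h : Integrable (fun η => (η.card : ℝ) * (G η * C ^ η.card)) (lebesguePoisson d)) :
    Integrable (vlasovExpr φ z G) (lebesguePoissonWeighted d C) := by
  rw [integrable_weighted_iff (by positivity)]
  have hb := (integral_birth_mul hφm hφ hφi hC zero_le_one hG (measurable_const_pow_card C)
    (fun η => by rw [one_mul, abs_of_nonneg (by positivity)]) h).1
  refine (h.neg.add (hb.const_mul z)).congr (Eventually.of_forall fun η => ?_)
  simp only [Pi.add_apply, Pi.neg_apply, vlasovExpr_eq]
  ring

theorem integral_vlasovExpr_mul [NeZero d] {φ : Pt d → ℝ} (hφm : Measurable φ)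
    (hφ : ∀ x, 0 ≤ φ x) (hφi : Integrable φ) {C : ℝ} (hC : 1 ≤ C) (z : ℝ) {G : Conf d → ℝ}
    (hG : Measurable G)
    (h : Integrable (fun η => (η.card : ℝ) * (G η * C ^ η.card)) (lebesguePoisson d))
    (u : KSpace d) :
    Integrable (fun η => G η * dualExpr φ z C u η) (lebesguePoisson d) ∧
      ∫ η, vlasovExpr φ z G η * u.fn C η ∂(lebesguePoisson d)
        = ∫ η, G η * dualExpr φ z C u η ∂(lebesguePoisson d) := by
  obtain ⟨k, hkm, hkb, hk⟩ := u.exists_bounded_rep (C := C) (by positivity)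
  obtain ⟨h1, h2, h3⟩ := integral_birth_mul hφm hφ hφi hC (norm_nonneg u) hG hkm hkb h
  have hN : Integrable (fun η => -((η.card : ℝ) * (G η * C ^ η.card)) * u η)
      (lebesguePoisson d) :=
    h.neg.mul_bdd (c := ‖u‖) (Lp.aestronglyMeasurable u) (by
      simpa only [Real.norm_eq_abs] using ae_abs_le_norm u)
  have hbd := birthDual_congr hφm (u.measurable_fn C) hkm hk
  have hR : (fun η => -((η.card : ℝ) * (G η * C ^ η.card)) * u η + z * (G η * birthDual φ k η))
      =ᵐ[lebesguePoisson d] fun η => G η * dualExpr φ z C u η := by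
    filter_upwards [hbd] with η hη
    rw [dualExpr, hη, KSpace.fn]
    ring
  have hL : (fun η => -((η.card : ℝ) * (G η * C ^ η.card)) * u η + z * (birth φ G η * k η))
      =ᵐ[lebesguePoisson d] fun η => vlasovExpr φ z G η * u.fn C η := by
    filter_upwards [hk] with η hη
    rw [vlasovExpr_eq, ← hη, KSpace.fn]
    ring
  refine ⟨(hN.add (h2.const_mul z)).congr hR, ?_⟩
  rw [← integral_congr_ae hL, ← integral_congr_ae hR, integral_add hN (h1.const_mul z),
    integral_add hN (h2.const_mul z), integral_const_mul, integral_const_mul, h3]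

theorem exists_pos_integrable (E : Type*) [MeasureSpace E] [SigmaFinite (volume : Measure E)] :
    ∃ q : E → ℝ, Measurable q ∧ (∀ x, 0 < q x) ∧ Integrable q := by
  obtain ⟨g, hg, hgm, hgi⟩ := exists_pos_lintegral_lt_of_sigmaFinite (volume : Measure E)
    (ε := 1) one_ne_zero
  refine ⟨fun x => g x, hgm.coe_nnreal_real, fun x => hg x, hgm.coe_nnreal_real.aestronglyMeasurable, ?_⟩
  refine lt_of_eq_of_lt ?_ (hgi.trans ENNReal.one_lt_top)
  refine lintegral_congr fun x => ?_
  simp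

theorem integrable_lpExp [NeZero d] {q : Pt d → ℝ} (hqm : Measurable q) (hq : Integrable q)
    {C : ℝ} (hC : 0 < C) : Integrable (lpExp q) (lebesguePoissonWeighted d C) := by
  rw [integrable_weighted_iff hC, integrable_lebesguePoisson_iff
    (f := fun η => lpExp q η * C ^ η.card) ((measurable_lpExp hqm).mul (measurable_const_pow_card C))]
  refine (integral_seqMeasure_prod (hq.const_mul C)).1.congr ?_
  filter_upwards [ae_seq_injective] with s hs
  rw [FinSeq.lpExp_toConf hs, FinSeq.card_toConf hs, Finset.prod_mul_distrib, Finset.prod_const,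
    Finset.card_univ, Fintype.card_fin, mul_comm]

/-- An identity of pairings on the graph of L̂_V extends to the closure because pairings are
continuous on 𝓛_C. Conversely, there are enough test functions in 𝓛_{2C} to force equality almost
everywhere. -/
theorem mem_vlasovDualGraph_iff [NeZero d] {φ : Pt d → ℝ} (hφm : Measurable φ)
    (hφ : ∀ x, 0 ≤ φ x) (hφi : Integrable φ) {C : ℝ} (hC : 1 ≤ C) (z : ℝ) {u v : KSpace d} :
    (u, v) ∈ vlasovDualGraph φ z C ↔ v.fn C =ᵐ[lebesguePoisson d] dualExpr φ z C u := by
  have hC0 : 0 < C := by linarith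
  constructor
  · intro h
    set W : Conf d → ℝ := fun η => v.fn C η - dualExpr φ z C u η with hW
    have hWm : Measurable W := (v.measurable_fn C).sub (measurable_dualExpr hφm z C u)
    obtain ⟨q, hqm, hq0, hq⟩ := exists_pos_integrable (Pt d)
    -- The sign of the defect W (0 where W = 0) times the strictly positive e_λ(q), which is
    -- integrable for every weight. Testing with it gives ∫ |W| e_λ(q) dλ = 0.
    set G : Conf d → ℝ := fun η => W η / |W η| * lpExp q η with hG
    have hGm : Measurable G := (hWm.div hWm.abs).mul (measurable_lpExp hqm)
    have hGi : ∀ C' : ℝ, 0 < C' → Integrable G (lebesguePoissonWeighted d C') := fun C' hC' =>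
      (integrable_lpExp hqm hq hC').mono hGm.aestronglyMeasurable
        (Eventually.of_forall fun η => by
          rw [hG]
          simp only
          rw [norm_mul, norm_div, Real.norm_eq_abs, Real.norm_eq_abs, abs_abs]
          exact mul_le_of_le_one_left (norm_nonneg _) (div_self_le_one _))
    set g : LSpace d C := (hGi C hC0).toL1 G with hg
    have hgG : ∀ᵐ η ∂(lebesguePoisson d), g η = G η :=
      (ae_weighted_iff hC0).1 (Integrable.coeFn_toL1 (hGi C hC0))
    have hgm : Measurable (g : Conf d → ℝ) := (Lp.stronglyMeasurable g).measurable
    have hg2 : Integrable (g : Conf d → ℝ) (lebesguePoissonWeighted d (2 * C)) :=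
      (hGi _ (by positivity)).congr
        ((ae_weighted_iff (by positivity)).2 (hgG.mono fun _ h => h.symm))
    have hgc := integrable_card_mul hC0 hgm hg2
    obtain ⟨hadji, hadj⟩ := integral_vlasovExpr_mul hφm hφ hφi hC z hgm hgc u
    have hV := integrable_vlasovExpr hφm hφ hφi hC z hgm hgc
    have hVa : (hV.toL1 _ : Conf d → ℝ) =ᵐ[lebesguePoisson d] vlasovExpr φ z g :=
      (ae_weighted_iff hC0).1 (Integrable.coeFn_toL1 hV)
    have hmem : (g, hV.toL1 _) ∈ vlasovGraph φ z C := ⟨hg2, hVa⟩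
    have heq : ∫ η, hV.toL1 _ η * u.fn C η ∂(lebesguePoisson d)
        = ∫ η, g η * v.fn C η ∂(lebesguePoisson d) := h _ (subset_closure hmem)
    have heq' : ∫ η, g η * dualExpr φ z C u η ∂(lebesguePoisson d)
        = ∫ η, g η * v.fn C η ∂(lebesguePoisson d) := by
      rw [← hadj, ← heq]
      refine integral_congr_ae ?_
      filter_upwards [hVa] with η hη
      rw [hη]
    have hgv := integrable_mul_fn hC0 (L1.integrable_coeFn g) v
    have habs : (fun η => g η * v.fn C η - g η * dualExpr φ z C u η)
        =ᵐ[lebesguePoisson d] fun η => |W η| * lpExp q η := by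
      filter_upwards [hgG] with η hη
      rw [← mul_sub, hη]
      change W η / |W η| * lpExp q η * W η = _
      rcases eq_or_ne (W η) 0 with h0 | h0
      · simp [h0]
      · have : |W η| ≠ 0 := abs_ne_zero.2 h0
        field_simp
        rw [sq_abs]
    have hpos : ∀ η, 0 < lpExp q η := fun η => Finset.prod_pos fun x _ => hq0 x
    have hzero : ∫ η, |W η| * lpExp q η ∂(lebesguePoisson d) = 0 := by
      rw [← integral_congr_ae habs, integral_sub hgv hadji, heq', sub_self]
    rw [integral_eq_zero_iff_of_nonneg (fun η => mul_nonneg (abs_nonneg _) (hpos η).le)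
      ((hgv.sub hadji).congr habs)] at hzero
    filter_upwards [hzero] with η hη
    have h1 : |W η| * lpExp q η = 0 := hη
    rcases mul_eq_zero.1 h1 with h2 | h2
    · exact sub_eq_zero.1 (abs_eq_zero.1 h2)
    · exact absurd h2 (hpos η).ne'
  · intro h p hp
    set T : Set (LSpace d C × LSpace d C) := {p | ∫ η, p.2 η * u.fn C η ∂(lebesguePoisson d) =
      ∫ η, p.1 η * v.fn C η ∂(lebesguePoisson d)} with hT
    have hTc : IsClosed T := isClosed_eq ((continuous_pairing hC0 u).comp continuous_snd)
      ((continuous_pairing hC0 v).comp continuous_fst)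
    have hsub : vlasovGraph φ z C ⊆ T := by
      rintro ⟨G, H⟩ ⟨h1, h2⟩
      have hGm : Measurable (G : Conf d → ℝ) := (Lp.stronglyMeasurable G).measurable
      have hadj := integral_vlasovExpr_mul hφm hφ hφi hC z hGm (integrable_card_mul hC0 hGm h1) u
      change ∫ η, H η * u.fn C η ∂(lebesguePoisson d) = ∫ η, G η * v.fn C η ∂(lebesguePoisson d)
      refine Eq.trans (integral_congr_ae ?_) (hadj.2.trans (integral_congr_ae ?_))
      · filter_upwards [h2] with η hη
        rw [← hη]
      · filter_upwards [h] with η hη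
        rw [hη]
    exact closure_minimal hsub hTc hp

end DualGraph

/-! ### The closure of 𝓚_{αC} and well-posedness -/

section Subspace

variable {d : ℕ}

theorem mem_subK_of_ae_abs_le {C α K : ℝ} (hC : 0 < C) (hα : 0 < α) {u : KSpace d}
    (h : ∀ᵐ η ∂(lebesguePoisson d), |u η| ≤ K * α ^ η.card) : u ∈ subK d C α := by
  refine memLp_top_of_bound ((u.measurable_fn C).mul
    (measurable_comp_card fun n => ((α * C) ^ n)⁻¹)).aestronglyMeasurable K ?_
  filter_upwards [h] with η hη
  have : u.fn C η * ((α * C) ^ η.card)⁻¹ = u η / α ^ η.card := by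
    rw [KSpace.fn, mul_pow]
    field_simp
  rw [this, Real.norm_eq_abs, abs_div, abs_of_pos (a := α ^ η.card) (by positivity),
    div_le_iff₀ (by positivity)]
  exact hη

theorem exists_ae_abs_le_of_mem_subK {C α : ℝ} (hC : 0 < C) (hα : 0 < α) {u : KSpace d}
    (h : u ∈ subK d C α) :
    ∃ K : ℝ, ∀ᵐ η ∂(lebesguePoisson d), |u η| ≤ K * α ^ η.card := by
  have h' : MemLp (fun η => u.fn C η * ((α * C) ^ η.card)⁻¹) ∞ (lebesguePoisson d) := h
  refine ⟨‖h'.toLp‖, ?_⟩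
  filter_upwards [ae_abs_le_norm h'.toLp, h'.coeFn_toLp] with η h1 h2
  have : u.fn C η * ((α * C) ^ η.card)⁻¹ = u η / α ^ η.card := by
    rw [KSpace.fn, mul_pow]
    field_simp
  rw [h2, this, abs_div, abs_of_pos (a := α ^ η.card) (by positivity),
    div_le_iff₀ (by positivity)] at h1
  exact h1

/-- The closure of `𝓚_{αC}` in `𝓚_C` consists of the functions that vanish at infinity in `|η|`. -/
theorem closedSubK_eq_vanishing {C α : ℝ} (hC : 0 < C) (hα : 0 < α) (hα1 : α < 1) :
    closedSubK d C α = (vanishing (lebesguePoisson d) Conf.card : Set (KSpace d)) := by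
  refine Subset.antisymm (closure_minimal (fun u hu => ?_) isClosed_vanishing) fun u hu => ?_
  · obtain ⟨K, hK⟩ := exists_ae_abs_le_of_mem_subK hC hα hu
    refine mem_vanishing_of_ae_abs_le (a := fun n => K * α ^ n) ?_ hK
    simpa using (tendsto_pow_atTop_nhds_zero_of_lt_one hα.le hα1).const_mul K
  · rw [closedSubK, Metric.mem_closure_iff]
    intro ε hε
    obtain ⟨M, w, hwu, hw⟩ := exists_truncation measurable_card hu (half_pos hε)
    refine ⟨w, mem_subK_of_ae_abs_le (K := ‖u‖ / α ^ M) hC hα ?_, ?_⟩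
    · filter_upwards [hw] with η hη
      refine hη.trans ?_
      split_ifs with h
      · rw [div_mul_eq_mul_div, le_div_iff₀ (by positivity)]
        exact mul_le_mul_of_nonneg_left (pow_le_pow_of_le_one hα.le hα1.le h) (norm_nonneg _)
      · positivity
    · rw [dist_comm, dist_eq_norm]
      linarith

theorem fn_eq_dualExpr_iff {φ : Pt d → ℝ} {C z : ℝ} (hC : 0 < C) {u v : KSpace d} {η : Conf d} :
    v.fn C η = dualExpr φ z C u η ↔
      v η = -(η.card : ℝ) * u η + z * (C ^ η.card)⁻¹ * birthDual φ (u.fn C) η := by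
  have hp : C ^ η.card ≠ 0 := by positivity
  unfold dualExpr
  rw [KSpace.fn, KSpace.fn]
  constructor
  · intro h
    have := congrArg (fun t => (C ^ η.card)⁻¹ * t) h
    simp only [inv_mul_cancel_left₀ hp] at this
    rw [this, mul_add]
    congr 1
    · field_simp
    · ring
  · intro h
    rw [h, mul_add]
    congr 1
    · ring
    · field_simp

theorem wellPosed_vlasov [NeZero d] {φ : Pt d → ℝ} (hφm : Measurable φ) (hφ : ∀ x, 0 ≤ φ x)
    (hφi : Integrable φ) {C z α : ℝ} (hC : 1 ≤ C) (hz : 0 ≤ z)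
    (hzC : z * Real.exp (C * ∫ y, φ y) ≤ C) (hα : 0 < α) (hα1 : α < 1) :
    WellPosed (closedSubK d C α) (partGraph (vlasovDualGraph φ z C) (closedSubK d C α)) := by
  have hC0 : 0 < C := by linarith
  obtain ⟨S, hS, hSB⟩ := exists_dominated hφm hφ hφi hC hz hzC
  have hpart : partGraph (vlasovDualGraph φ z C) (closedSubK d C α)
      = (gradedGraph (lebesguePoisson d) Conf.card S : Set (KSpace d × KSpace d)) := by
    ext ⟨u, v⟩
    rw [closedSubK_eq_vanishing hC0 hα hα1]
    refine and_congr_left fun _ => ?_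
    rw [mem_vlasovDualGraph_iff hφm hφ hφi hC]
    refine eventually_congr ?_
    filter_upwards [hSB u] with η hη
    rw [fn_eq_dualExpr_iff hC0, hη]
  rw [hpart, closedSubK_eq_vanishing hC0 hα hα1]
  exact wellPosed_gradedGraph measurable_card hS

end Subspace

/-! ### The Vlasov-type equation: estimates and uniqueness -/

section VlasovEquation

variable {d : ℕ} {φ : Pt d → ℝ}

theorem integrable_mul_comp_sub (hφi : Integrable φ) {f : Pt d → ℝ} (hf : Measurable f) {D : ℝ}
    (hD : ∀ᵐ y, |f y| ≤ D) (x : Pt d) : Integrable fun y => f y * φ (x - y) :=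
  (hφi.comp_sub_left x).bdd_mul (c := D) hf.aestronglyMeasurable hD

theorem abs_integral_mul_comp_sub_le (hφ : ∀ x, 0 ≤ φ x) (hφi : Integrable φ) {f : Pt d → ℝ}
    {D : ℝ} (hD : ∀ᵐ y, |f y| ≤ D) (x : Pt d) :
    |∫ y, f y * φ (x - y)| ≤ D * ∫ y, φ y := by
  rw [← integral_sub_left_eq_self φ volume x, ← integral_const_mul, ← Real.norm_eq_abs]
  refine norm_integral_le_of_norm_le ((hφi.comp_sub_left x).const_mul D) ?_
  filter_upwards [hD] with y hy
  rw [norm_mul, Real.norm_eq_abs, Real.norm_of_nonneg (hφ _)]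
  exact mul_le_mul_of_nonneg_right hy (hφ _)

theorem abs_exp_neg_sub_exp_neg_le {a b : ℝ} (ha : 0 ≤ a) (hb : 0 ≤ b) :
    |Real.exp (-a) - Real.exp (-b)| ≤ |a - b| := by
  wlog hab : a ≤ b generalizing a b
  · rw [abs_sub_comm, abs_sub_comm a]
    exact this hb ha (le_of_not_ge hab)
  have h1 : Real.exp (-b) ≤ Real.exp (-a) := Real.exp_le_exp.2 (by linarith)
  rw [abs_of_nonneg (by linarith), abs_sub_comm, abs_of_nonneg (by linarith)]
  have h2 : Real.exp (-b) = Real.exp (-a) * Real.exp (-(b - a)) := by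
    rw [← Real.exp_add]
    ring_nf
  have h3 := Real.add_one_le_exp (-(b - a))
  have h4 : Real.exp (-a) ≤ 1 := Real.exp_le_one_iff.2 (by linarith)
  have h5 := Real.exp_pos (-a)
  rw [h2]
  nlinarith

/-- The factor `exp(-∫ f(y) φ(x - y) dy)` of the Vlasov-type equation. -/
noncomputable def damping (φ : Pt d → ℝ) (f : Pt d → ℝ) (x : Pt d) : ℝ :=
  Real.exp (-∫ y, f y * φ (x - y))

theorem integral_mul_comp_sub_nonneg (hφ : ∀ x, 0 ≤ φ x) {f : Pt d → ℝ} (hf : ∀ᵐ y, 0 ≤ f y)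
    (x : Pt d) : 0 ≤ ∫ y, f y * φ (x - y) :=
  integral_nonneg_of_ae (hf.mono fun _ hy => mul_nonneg hy (hφ _))

theorem damping_nonneg (f : Pt d → ℝ) (x : Pt d) : 0 ≤ damping φ f x := (Real.exp_pos _).le

theorem damping_le_one (hφ : ∀ x, 0 ≤ φ x) {f : Pt d → ℝ} (hf : ∀ᵐ y, 0 ≤ f y) (x : Pt d) :
    damping φ f x ≤ 1 :=
  Real.exp_le_one_iff.2 (neg_nonpos.2 (integral_mul_comp_sub_nonneg hφ hf x))

theorem abs_damping_sub_le (hφ : ∀ x, 0 ≤ φ x) (hφi : Integrable φ)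
    {f g : Pt d → ℝ} (hfm : Measurable f) (hgm : Measurable g)
    (hf : ∀ᵐ y, 0 ≤ f y) (hg : ∀ᵐ y, 0 ≤ g y) {B : ℝ} (hfB : ∀ᵐ y, f y ≤ B)
    (hgB : ∀ᵐ y, g y ≤ B) {D : ℝ} (h : ∀ᵐ y, |f y - g y| ≤ D) (x : Pt d) :
    |damping φ f x - damping φ g x| ≤ D * ∫ y, φ y := by
  refine (abs_exp_neg_sub_exp_neg_le (integral_mul_comp_sub_nonneg hφ hf x)
    (integral_mul_comp_sub_nonneg hφ hg x)).trans ?_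
  have hf' : ∀ᵐ y, |f y| ≤ B := by
    filter_upwards [hf, hfB] with y h1 h2
    rwa [abs_of_nonneg h1]
  have hg' : ∀ᵐ y, |g y| ≤ B := by
    filter_upwards [hg, hgB] with y h1 h2
    rwa [abs_of_nonneg h1]
  rw [← integral_sub (integrable_mul_comp_sub hφi hfm hf' x)
    (integrable_mul_comp_sub hφi hgm hg' x)]
  simp_rw [← sub_mul]
  exact abs_integral_mul_comp_sub_le hφ hφi h x

theorem measurable_damping (hφm : Measurable φ) {ρ : ℝ × Pt d → ℝ} (hρ : Measurable ρ) :
    Measurable fun p : ℝ × Pt d => damping φ (fun y => ρ (p.1, y)) p.2 := by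
  have h : Measurable fun q : (ℝ × Pt d) × Pt d => ρ (q.1.1, q.2) * φ (q.1.2 - q.2) :=
    (hρ.comp ((measurable_fst.comp measurable_fst).prodMk measurable_snd)).mul
      (hφm.comp ((measurable_snd.comp measurable_fst).sub measurable_snd))
  exact h.stronglyMeasurable.integral_prod_right'.measurable.neg.exp

/-- Uniqueness for the Vlasov-type equation, in the form of an a priori estimate that can be
iterated. -/
theorem vlasov_difference_step (hφ : ∀ x, 0 ≤ φ x) (hφi : Integrable φ) {z : ℝ} (hz : 0 ≤ z)
    {ρ₀ : Pt d → ℝ} {ρ σ : ℝ → Pt d → ℝ} (hρ : IsVlasovSolution φ z ρ₀ ρ)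
    (hσ : IsVlasovSolution φ z ρ₀ σ) {A : ℝ} (hA : 0 ≤ A)
    (h : ∀ t, 0 ≤ t → ∀ᵐ x, |ρ t x - σ t x| ≤ A * Real.exp (2 * (z * ∫ y, φ y) * t)) :
    ∀ t, 0 ≤ t → ∀ᵐ x, |ρ t x - σ t x| ≤ A / 2 * Real.exp (2 * (z * ∫ y, φ y) * t) := by
  intro T hT
  obtain ⟨B₁, hB₁⟩ := hρ.bounded
  obtain ⟨B₂, hB₂⟩ := hσ.bounded
  set β := ∫ y, φ y with hβ
  have hβ0 : 0 ≤ β := integral_nonneg hφ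
  have hdamp : ∀ t, 0 ≤ t → ∀ x, |damping φ (ρ t) x - damping φ (σ t) x|
      ≤ A * Real.exp (2 * (z * β) * t) * β := fun t ht x =>
    abs_damping_sub_le hφ hφi (hρ.measurable t ht) (hσ.measurable t ht) (hρ.nonneg t ht)
      (hσ.nonneg t ht) (B := max B₁ B₂) ((hB₁ t ht).mono fun _ h => h.trans (le_max_left _ _))
      ((hB₂ t ht).mono fun _ h => h.trans (le_max_right _ _)) (h t ht) x
  filter_upwards [hρ.equation, hσ.equation, hρ.initial, hσ.initial] with x h1 h2 h3 h4
  -- The factor e^t removes the linear term. The remaining difference of dampings depends on ρ and σ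
  -- only modulo null sets, so the hypothesis at each time is enough for a fixed x.
  have hd : ∀ t, 0 ≤ t → HasDerivWithinAt (fun s => Real.exp s * (ρ s x - σ s x))
      (Real.exp t * (z * (damping φ (ρ t) x - damping φ (σ t) x))) (Ici 0) t := by
    intro t ht
    refine (((Real.hasDerivAt_exp t).hasDerivWithinAt (s := Ici 0)).mul
      ((h1 t ht).sub (h2 t ht))).congr_deriv ?_
    simp only [damping, Pi.sub_apply]
    ring
  -- Comparison function: its derivative dominates zβA e^{(1 + 2zβ)t}, because the rate 2zβ
  -- compensates the factor 1/2.
  have hB : ∀ t, HasDerivAt (fun s => A / 2 * Real.exp ((1 + 2 * (z * β)) * s))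
      (A / 2 * (Real.exp ((1 + 2 * (z * β)) * t) * (1 + 2 * (z * β)))) t := by
    intro t
    have := ((hasDerivAt_id t).const_mul (1 + 2 * (z * β))).exp.const_mul (A / 2)
    simpa using this
  have key := image_norm_le_of_norm_deriv_right_le_deriv_boundary
    (f := fun s => Real.exp s * (ρ s x - σ s x)) (a := 0) (b := T)
    (f' := fun t => Real.exp t * (z * (damping φ (ρ t) x - damping φ (σ t) x)))
    (fun t ht => (hd t ht.1).continuousWithinAt.mono Icc_subset_Ici_self)
    (fun t ht => (hd t ht.1).mono (Ici_subset_Ici.2 ht.1))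
    (B := fun s => A / 2 * Real.exp ((1 + 2 * (z * β)) * s))
    (B' := fun t => A / 2 * (Real.exp ((1 + 2 * (z * β)) * t) * (1 + 2 * (z * β))))
    (by simp only [h3, h4, sub_self, mul_zero, norm_zero]; positivity) hB (fun t ht => by
      rw [norm_mul, norm_mul, Real.norm_of_nonneg (Real.exp_pos t).le, Real.norm_of_nonneg hz,
        Real.norm_eq_abs]
      calc Real.exp t * (z * |damping φ (ρ t) x - damping φ (σ t) x|)
          ≤ Real.exp t * (z * (A * Real.exp (2 * (z * β) * t) * β)) := by
            gcongr
            exact hdamp t ht.1 x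
        _ = A / 2 * (Real.exp ((1 + 2 * (z * β)) * t) * (2 * (z * β))) := by
            rw [add_mul, one_mul, Real.exp_add]
            ring
        _ ≤ _ := by
            gcongr
            linarith)
    (x := T) ⟨hT, le_rfl⟩
  rw [norm_mul, Real.norm_of_nonneg (Real.exp_pos T).le, Real.norm_eq_abs, add_mul, one_mul,
    Real.exp_add] at key
  have hp := Real.exp_pos T
  rw [mul_left_comm] at key
  exact le_of_mul_le_mul_left key hp

/-- Boundedness gives a first estimate with some A, and each step halves it. Countably many null
sets are discarded for a fixed t. -/
theorem IsVlasovSolution.unique (hφ : ∀ x, 0 ≤ φ x) (hφi : Integrable φ) {z : ℝ} (hz : 0 ≤ z)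
    {ρ₀ : Pt d → ℝ} {ρ σ : ℝ → Pt d → ℝ} (hρ : IsVlasovSolution φ z ρ₀ ρ)
    (hσ : IsVlasovSolution φ z ρ₀ σ) (t : ℝ) (ht : 0 ≤ t) : ρ t =ᵐ[volume] σ t := by
  obtain ⟨B₁, hB₁⟩ := hρ.bounded
  obtain ⟨B₂, hB₂⟩ := hσ.bounded
  have hβ0 : 0 ≤ ∫ y, φ y := integral_nonneg hφ
  set A := |B₁| + |B₂|
  have hA : 0 ≤ A := by positivity
  have hk : ∀ k : ℕ, ∀ t, 0 ≤ t → ∀ᵐ x, |ρ t x - σ t x|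
      ≤ A / 2 ^ k * Real.exp (2 * (z * ∫ y, φ y) * t) := by
    intro k
    induction k with
    | zero =>
      intro t ht
      filter_upwards [hρ.nonneg t ht, hσ.nonneg t ht, hB₁ t ht, hB₂ t ht] with x h1 h2 h3 h4
      have h5 : 1 ≤ Real.exp (2 * (z * ∫ y, φ y) * t) := Real.one_le_exp (by positivity)
      rw [pow_zero, div_one]
      refine le_trans ?_ (le_mul_of_one_le_right hA h5)
      have := le_abs_self B₁
      have := le_abs_self B₂
      rw [abs_le]
      constructor <;> simp only [A] <;> linarith [abs_nonneg B₁, abs_nonneg B₂]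
    | succ k ih =>
      have := vlasov_difference_step hφ hφi hz hρ hσ (by positivity) ih
      rwa [div_div, ← pow_succ] at this
  filter_upwards [ae_all_iff.2 fun k => hk k t ht] with x hx
  have hlim : Tendsto (fun k : ℕ => A / 2 ^ k * Real.exp (2 * (z * ∫ y, φ y) * t)) atTop (𝓝 0) := by
    have h1 : Tendsto (fun k : ℕ => ((1 : ℝ) / 2) ^ k) atTop (𝓝 0) :=
      tendsto_pow_atTop_nhds_zero_of_lt_one (by norm_num) (by norm_num)
    have h2 := (h1.const_mul A).mul_const (Real.exp (2 * (z * ∫ y, φ y) * t))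
    simp only [mul_zero, zero_mul, one_div, inv_pow] at h2
    simpa only [div_eq_mul_inv] using h2
  have := ge_of_tendsto' hlim hx
  exact sub_eq_zero.1 (abs_eq_zero.1 (le_antisymm this (abs_nonneg _)))

end VlasovEquation

/-! ### The Vlasov-type equation: existence by Picard iteration -/

section VlasovExistence

variable {d : ℕ} {φ : Pt d → ℝ}

/-- The integral operator whose fixed points solve the Vlasov-type equation; the time is cut off
at `0`. -/
noncomputable def duhamel (φ : Pt d → ℝ) (z : ℝ) (r : Pt d → ℝ) (ρ : ℝ × Pt d → ℝ)
    (p : ℝ × Pt d) : ℝ :=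
  Real.exp (-max p.1 0) *
    (r p.2 + z * ∫ s in Ioc 0 (max p.1 0), Real.exp s * damping φ (fun y => ρ (s, y)) p.2)

theorem measurable_duhamel (hφm : Measurable φ) (z : ℝ) {r : Pt d → ℝ} (hr : Measurable r)
    {ρ : ℝ × Pt d → ℝ} (hρ : Measurable ρ) : Measurable (duhamel φ z r ρ) := by
  have hτ : Measurable fun p : ℝ × Pt d => max p.1 0 := measurable_fst.max measurable_const
  have hg : Measurable fun q : (ℝ × Pt d) × ℝ =>
      Real.exp q.2 * damping φ (fun y => ρ (q.2, y)) q.1.2 :=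
    measurable_snd.exp.mul ((measurable_damping hφm hρ).comp
      (measurable_snd.prodMk (measurable_snd.comp measurable_fst)))
  have hset : MeasurableSet {q : (ℝ × Pt d) × ℝ | q.2 ∈ Ioc 0 (max q.1.1 0)} :=
    (measurableSet_lt measurable_const measurable_snd).inter
      (measurableSet_le measurable_snd (hτ.comp measurable_fst))
  have hint : Measurable fun p : ℝ × Pt d =>
      ∫ s in Ioc 0 (max p.1 0), Real.exp s * damping φ (fun y => ρ (s, y)) p.2 := by
    have h1 := (hg.indicator hset).stronglyMeasurable.integral_prod_right'
      (ν := (volume : Measure ℝ))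
    have h2 : (fun p : ℝ × Pt d =>
        ∫ s in Ioc 0 (max p.1 0), Real.exp s * damping φ (fun y => ρ (s, y)) p.2)
        = fun p => ∫ s, {q : (ℝ × Pt d) × ℝ | q.2 ∈ Ioc 0 (max q.1.1 0)}.indicator
          (fun q => Real.exp q.2 * damping φ (fun y => ρ (q.2, y)) q.1.2) (p, s) := by
      ext p
      rw [← integral_indicator measurableSet_Ioc]
      rfl
    rw [h2]
    exact h1.measurable
  exact hτ.neg.exp.mul ((hr.comp measurable_snd).add (hint.const_mul z))

theorem integrableOn_exp_damping (hφm : Measurable φ) (hφ : ∀ x, 0 ≤ φ x)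
    {ρ : ℝ × Pt d → ℝ} (hρ : Measurable ρ) (hρ0 : ∀ p, 0 ≤ ρ p) (a b : ℝ) (x : Pt d) :
    IntegrableOn (fun s => Real.exp s * damping φ (fun y => ρ (s, y)) x) (Ioc a b) := by
  have h : IntegrableOn (fun s => Real.exp s) (Ioc a b) :=
    (Real.continuous_exp.integrableOn_Icc).mono_set Ioc_subset_Icc_self
  refine h.mul_bdd (c := 1)
    ((measurable_damping hφm hρ).comp measurable_prodMk_right).aestronglyMeasurable
    (Eventually.of_forall fun s => ?_)
  rw [Real.norm_of_nonneg (damping_nonneg _ _)]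
  exact damping_le_one hφ (Eventually.of_forall fun y => hρ0 _) x

theorem integral_exp_Ioc {τ : ℝ} (hτ : 0 ≤ τ) :
    ∫ s in Ioc 0 τ, Real.exp s = Real.exp τ - 1 := by
  rw [← intervalIntegral.integral_of_le hτ, integral_exp, Real.exp_zero]

/-- The damping is at most 1, so the value is at most e^{-τ} D + z(1 - e^{-τ}), an average of D and
z. -/
theorem duhamel_mem_Icc (hφm : Measurable φ) (hφ : ∀ x, 0 ≤ φ x) {z D : ℝ} (hz : 0 ≤ z)
    (hzD : z ≤ D) {r : Pt d → ℝ} (hr : ∀ x, r x ∈ Icc 0 D) {ρ : ℝ × Pt d → ℝ}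
    (hρ : Measurable ρ) (hρ0 : ∀ p, 0 ≤ ρ p) (p : ℝ × Pt d) :
    duhamel φ z r ρ p ∈ Icc 0 D := by
  have hτ : 0 ≤ max p.1 0 := le_max_right _ _
  set τ := max p.1 0 with hτdef
  have hlow : 0 ≤ ∫ s in Ioc 0 τ, Real.exp s * damping φ (fun y => ρ (s, y)) p.2 :=
    integral_nonneg fun s => mul_nonneg (Real.exp_pos s).le (damping_nonneg _ _)
  have hup : ∫ s in Ioc 0 τ, Real.exp s * damping φ (fun y => ρ (s, y)) p.2
      ≤ Real.exp τ - 1 := by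
    rw [← integral_exp_Ioc hτ]
    refine integral_mono (integrableOn_exp_damping hφm hφ hρ hρ0 0 τ p.2)
      ((Real.continuous_exp.integrableOn_Icc).mono_set Ioc_subset_Icc_self) fun s => ?_
    exact mul_le_of_le_one_right (Real.exp_pos s).le
      (damping_le_one hφ (Eventually.of_forall fun y => hρ0 _) _)
  obtain ⟨h1, h2⟩ := hr p.2
  have he : 1 ≤ Real.exp τ := Real.one_le_exp hτ
  refine ⟨mul_nonneg (Real.exp_pos _).le (add_nonneg h1 (mul_nonneg hz hlow)), ?_⟩
  unfold duhamel
  rw [← hτdef, Real.exp_neg, inv_mul_le_iff₀ (Real.exp_pos τ)]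
  nlinarith

/-- In the weight e^{2zβt} the map halves distances, because zβ ∫₀^τ e^{2zβs} ds ≤ e^{2zβτ}/2. There
is no restriction on the length of the time interval, so solutions are global at once. -/
theorem abs_duhamel_sub_le (hφm : Measurable φ) (hφ : ∀ x, 0 ≤ φ x) (hφi : Integrable φ)
    {z D : ℝ} (hz : 0 ≤ z) (r : Pt d → ℝ) {ρ σ : ℝ × Pt d → ℝ}
    (hρm : Measurable ρ) (hρ : ∀ p, ρ p ∈ Icc 0 D) (hσm : Measurable σ) (hσ : ∀ p, σ p ∈ Icc 0 D)
    {A : ℝ} (hA : 0 ≤ A)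
    (h : ∀ p, |ρ p - σ p| ≤ A * Real.exp (2 * (z * ∫ y, φ y) * max p.1 0)) (p : ℝ × Pt d) :
    |duhamel φ z r ρ p - duhamel φ z r σ p|
      ≤ A / 2 * Real.exp (2 * (z * ∫ y, φ y) * max p.1 0) := by
  have hτ : 0 ≤ max p.1 0 := le_max_right _ _
  have hβ0 : 0 ≤ ∫ y, φ y := integral_nonneg hφ
  set β := ∫ y, φ y with hβ
  set τ := max p.1 0 with hτdef
  unfold duhamel
  rw [← hτdef, ← mul_sub, add_sub_add_left_eq_sub, ← mul_sub, ← integral_sub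
    (integrableOn_exp_damping hφm hφ hρm (fun p => (hρ p).1) 0 τ p.2)
    (integrableOn_exp_damping hφm hφ hσm (fun p => (hσ p).1) 0 τ p.2)]
  have hbound : ∀ s ∈ Ioc 0 τ, ‖Real.exp s * damping φ (fun y => ρ (s, y)) p.2
      - Real.exp s * damping φ (fun y => σ (s, y)) p.2‖
      ≤ Real.exp τ * (A * β) * Real.exp (2 * (z * β) * s) := by
    intro s hs
    have h1 := abs_damping_sub_le hφ hφi (f := fun y => ρ (s, y)) (g := fun y => σ (s, y))
      (hρm.comp measurable_prodMk_left) (hσm.comp measurable_prodMk_left)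
      (Eventually.of_forall fun y => (hρ _).1) (Eventually.of_forall fun y => (hσ _).1) (B := D)
      (Eventually.of_forall fun y => (hρ _).2) (Eventually.of_forall fun y => (hσ _).2)
      (D := A * Real.exp (2 * (z * β) * s))
      (Eventually.of_forall fun y => by simpa only [max_eq_left hs.1.le] using h (s, y)) p.2
    rw [← mul_sub, norm_mul, Real.norm_of_nonneg (Real.exp_pos s).le, Real.norm_eq_abs]
    have h2 : Real.exp s ≤ Real.exp τ := Real.exp_le_exp.2 hs.2
    calc _ ≤ Real.exp τ * (A * Real.exp (2 * (z * β) * s) * β) :=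
          mul_le_mul h2 h1 (abs_nonneg _) (Real.exp_pos _).le
      _ = _ := by ring
  have hci : IntegrableOn (fun s => Real.exp τ * (A * β) * Real.exp (2 * (z * β) * s))
      (Ioc 0 τ) := by
    refine IntegrableOn.mono_set (Continuous.integrableOn_Icc ?_) Ioc_subset_Icc_self
    fun_prop
  -- Keeping the factor zβ in front avoids a division and covers β = 0.
  have hI : z * β * ∫ s in Ioc 0 τ, Real.exp (2 * (z * β) * s)
      = (Real.exp (2 * (z * β) * τ) - 1) / 2 := by
    have hd : ∀ s ∈ uIcc 0 τ, HasDerivAt (fun s => Real.exp (2 * (z * β) * s) / 2)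
        (z * β * Real.exp (2 * (z * β) * s)) s := by
      intro s _
      have := (((hasDerivAt_id s).const_mul (2 * (z * β))).exp).div_const 2
      refine this.congr_deriv ?_
      simp only [id]
      ring
    rw [← integral_const_mul, ← intervalIntegral.integral_of_le hτ,
      intervalIntegral.integral_eq_sub_of_hasDerivAt hd
        (Continuous.intervalIntegrable (by fun_prop) _ _)]
    simp
    ring
  have hJ := norm_integral_le_of_norm_le hci
    ((ae_restrict_iff' measurableSet_Ioc).2 (Eventually.of_forall hbound))
  rw [integral_const_mul] at hJ
  rw [abs_mul, abs_mul, abs_of_nonneg (Real.exp_pos _).le, abs_of_nonneg hz, Real.exp_neg,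
    inv_mul_le_iff₀ (Real.exp_pos τ)]
  rw [Real.norm_eq_abs] at hJ
  calc _ ≤ z * (Real.exp τ * (A * β) * ∫ s in Ioc 0 τ, Real.exp (2 * (z * β) * s)) := by gcongr
    _ = Real.exp τ * A * (z * β * ∫ s in Ioc 0 τ, Real.exp (2 * (z * β) * s)) := by ring
    _ = Real.exp τ * A * ((Real.exp (2 * (z * β) * τ) - 1) / 2) := by rw [hI]
    _ ≤ _ := by
      have : 0 ≤ Real.exp τ * A := by positivity
      nlinarith

/-- The Picard iterates of the Vlasov-type equation. -/
noncomputable def picard (φ : Pt d → ℝ) (z : ℝ) (r : Pt d → ℝ) : ℕ → ℝ × Pt d → ℝ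
  | 0 => fun p => r p.2
  | n + 1 => duhamel φ z r (picard φ z r n)

/-- The iterates converge geometrically at every point, so the limit is jointly measurable and
satisfies the equation everywhere, not just almost everywhere. -/
theorem exists_duhamel_fixed (hφm : Measurable φ) (hφ : ∀ x, 0 ≤ φ x) (hφi : Integrable φ)
    {z D : ℝ} (hz : 0 ≤ z) (hzD : z ≤ D) {r : Pt d → ℝ} (hrm : Measurable r)
    (hr : ∀ x, r x ∈ Icc 0 D) :
    ∃ ρ : ℝ × Pt d → ℝ, Measurable ρ ∧ (∀ p, ρ p ∈ Icc 0 D) ∧ ∀ p, ρ p = duhamel φ z r ρ p := by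
  have hD : 0 ≤ D := hz.trans hzD
  have hβ0 : 0 ≤ ∫ y, φ y := integral_nonneg hφ
  have hP : ∀ n, Measurable (picard φ z r n) ∧ ∀ p, picard φ z r n p ∈ Icc 0 D := by
    intro n
    induction n with
    | zero => exact ⟨hrm.comp measurable_snd, fun p => hr _⟩
    | succ n ih =>
      exact ⟨measurable_duhamel hφm z hrm ih.1,
        duhamel_mem_Icc hφm hφ hz hzD hr ih.1 fun p => (ih.2 p).1⟩
  set E : ℝ × Pt d → ℝ := fun p => Real.exp (2 * (z * ∫ y, φ y) * max p.1 0) with hE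
  have hE1 : ∀ p, 1 ≤ E p := fun p =>
    Real.one_le_exp (mul_nonneg (by positivity) (le_max_right _ _))
  have hstep : ∀ n p, |picard φ z r n p - picard φ z r (n + 1) p| ≤ D / 2 ^ n * E p := by
    intro n
    induction n with
    | zero =>
      intro p
      have h1 := (hP 0).2 p
      have h2 := (hP 1).2 p
      rw [pow_zero, div_one]
      refine le_trans ?_ (le_mul_of_one_le_right hD (hE1 p))
      rw [abs_le]
      exact ⟨by linarith [h1.1, h2.2], by linarith [h1.2, h2.1]⟩
    | succ n ih =>
      intro p
      have := abs_duhamel_sub_le hφm hφ hφi hz r (hP n).1 (hP n).2 (hP (n + 1)).1 (hP (n + 1)).2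
        (A := D / 2 ^ n) (by positivity) ih p
      rwa [div_div, ← pow_succ] at this
  have hdist : ∀ p n, dist (picard φ z r n p) (picard φ z r (n + 1) p) ≤ D * E p * (1 / 2) ^ n :=
    fun p n => (hstep n p).trans_eq (by rw [one_div, inv_pow]; ring)
  have hlim : ∀ p, ∃ l, Tendsto (fun n => picard φ z r n p) atTop (𝓝 l) := fun p =>
    cauchySeq_tendsto_of_complete
      (cauchySeq_of_le_geometric (1 / 2) (D * E p) (by norm_num) (hdist p))
  choose ρ hρ using hlim
  have hρm : Measurable ρ :=
    measurable_of_tendsto_metrizable (fun n => (hP n).1) (tendsto_pi_nhds.2 hρ)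
  have hρD : ∀ p, ρ p ∈ Icc 0 D := fun p =>
    isClosed_Icc.mem_of_tendsto (hρ p) (Eventually.of_forall fun n => (hP n).2 p)
  have hclose : ∀ n p, |picard φ z r n p - ρ p| ≤ 2 * D / 2 ^ n * E p := by
    intro n p
    have := dist_le_of_le_geometric_of_tendsto (1 / 2) (D * E p) (by norm_num) (hdist p) (hρ p) n
    refine this.trans_eq ?_
    rw [one_div, inv_pow]
    ring
  refine ⟨ρ, hρm, hρD, fun p => ?_⟩
  refine tendsto_nhds_unique ((tendsto_add_atTop_iff_nat 1).2 (hρ p)) ?_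
  rw [tendsto_iff_dist_tendsto_zero]
  refine squeeze_zero (fun n => dist_nonneg) (fun n => (abs_duhamel_sub_le hφm hφ hφi hz r
    (hP n).1 (hP n).2 hρm hρD (A := 2 * D / 2 ^ n) (by positivity) (hclose n) p)) ?_
  have h1 : Tendsto (fun k : ℕ => ((1 : ℝ) / 2) ^ k) atTop (𝓝 0) :=
    tendsto_pow_atTop_nhds_zero_of_lt_one (by norm_num) (by norm_num)
  have h2 := h1.const_mul (D * E p)
  rw [mul_zero] at h2
  refine h2.congr fun n => ?_
  rw [one_div, inv_pow]
  simp only [hE]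
  ring

/-- Global existence for the Vlasov-type equation, in the interval `[0, D]` with `z ≤ D`. -/
theorem exists_vlasov_solution (hφm : Measurable φ) (hφ : ∀ x, 0 ≤ φ x) (hφi : Integrable φ)
    {z D : ℝ} (hz : 0 ≤ z) (hzD : z ≤ D) {r : Pt d → ℝ} (hrm : Measurable r)
    (hr : ∀ x, r x ∈ Icc 0 D) :
    ∃ ρ : ℝ → Pt d → ℝ, (∀ t, Measurable (ρ t)) ∧ (∀ t x, ρ t x ∈ Icc 0 D) ∧
      (∀ x, ρ 0 x = r x) ∧ ∀ x t, 0 ≤ t →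
        HasDerivWithinAt (fun s => ρ s x) (-ρ t x + z * damping φ (ρ t) x) (Ici 0) t := by
  obtain ⟨ρ, hρm, hρD, hρ⟩ := exists_duhamel_fixed hφm hφ hφi hz hzD hrm hr
  refine ⟨fun t x => ρ (t, x), fun t => hρm.comp measurable_prodMk_left, fun t x => hρD _,
    fun x => by change ρ (0, x) = r x; rw [hρ]; simp [duhamel], fun x t ht => ?_⟩
  have hint : ∀ y a b, IntervalIntegrable
      (fun s => Real.exp s * damping φ (fun y => ρ (s, y)) y) volume a b := fun y a b =>
    ⟨integrableOn_exp_damping hφm hφ hρm (fun p => (hρD p).1) _ _ _,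
      integrableOn_exp_damping hφm hφ hρm (fun p => (hρD p).1) _ _ _⟩
  have hρ' : ∀ s y, ρ (s, y) = Real.exp (-max s 0) * (r y + z * ∫ u in (0 : ℝ)..max s 0,
      Real.exp u * damping φ (fun y => ρ (u, y)) y) := by
    intro s y
    rw [hρ, duhamel, intervalIntegral.integral_of_le (le_max_right _ _)]
  have hcont : ∀ y, Continuous fun s => ρ (s, y) := by
    intro y
    have h1 : Continuous fun s : ℝ => max s 0 := continuous_id.max continuous_const
    simp_rw [hρ' _ y]
    exact (Real.continuous_exp.comp h1.neg).mul (continuous_const.add (continuous_const.mul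
      ((intervalIntegral.continuous_primitive (hint y) 0).comp h1)))
  -- Dominated convergence makes the integrand of Duhamel's formula continuous in time, so that the
  -- fundamental theorem of calculus gives a derivative at every t.
  have hK : Continuous fun s => ∫ y, ρ (s, y) * φ (x - y) := by
    refine continuous_of_dominated (bound := fun y => D * φ (x - y))
      (fun s => ((hρm.comp measurable_prodMk_left).mul
        (hφm.comp (measurable_const.sub measurable_id))).aestronglyMeasurable)
      (fun s => Eventually.of_forall fun y => ?_) ((hφi.comp_sub_left x).const_mul D)
      (Eventually.of_forall fun y => (hcont y).mul continuous_const)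
    rw [norm_mul, Real.norm_of_nonneg (hρD _).1, Real.norm_of_nonneg (hφ _)]
    exact mul_le_mul_of_nonneg_right (hρD _).2 (hφ _)
  have hg : Continuous fun s => Real.exp s * damping φ (fun y => ρ (s, y)) x :=
    Real.continuous_exp.mul (Real.continuous_exp.comp hK.neg)
  have hder := (((hasDerivAt_id t).neg.exp).mul
    (((hg.integral_hasStrictDerivAt 0 t).hasDerivAt.const_mul z).const_add (r x)))
  have hEq : ∀ s, 0 ≤ s → ρ (s, x) = Real.exp (-s) * (r x + z * ∫ u in (0 : ℝ)..s,
      Real.exp u * damping φ (fun y => ρ (u, y)) x) := fun s hs => by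
    rw [hρ', max_eq_left hs]
  refine (hder.hasDerivWithinAt (s := Ici 0)).congr_of_mem (fun s hs => hEq s hs) ht |>.congr_deriv ?_
  change _ = -ρ (t, x) + z * damping φ (fun y => ρ (t, y)) x
  rw [hEq t ht]
  have : Real.exp (-t) * Real.exp t = 1 := by rw [← Real.exp_add, neg_add_cancel, Real.exp_zero]
  simp only [id, Pi.neg_apply]
  linear_combination (z * damping φ (fun y => ρ (t, y)) x) * this

end VlasovExistence

/-! ### Lebesgue–Poisson exponents along a curve of densities -/

section LebesguePoissonExponents

variable {d : ℕ}

theorem lpExp_congr [NeZero d] {f g : Pt d → ℝ} (hf : Measurable f) (hg : Measurable g)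
    (h : f =ᵐ[volume] g) : lpExp f =ᵐ[lebesguePoisson d] lpExp g := by
  refine (ae_lebesguePoisson_iff (measurableSet_eq_fun (measurable_lpExp hf)
    (measurable_lpExp hg))).2 ?_
  filter_upwards [ae_forall_mem h, ae_seq_injective] with s h1 h2
  rw [FinSeq.lpExp_toConf h2, FinSeq.lpExp_toConf h2]
  exact Finset.prod_congr rfl fun j _ => h1 j

theorem lpExp_nonneg {f : Pt d → ℝ} (hf : ∀ x, 0 ≤ f x) (η : Conf d) : 0 ≤ lpExp f η :=
  Finset.prod_nonneg fun x _ => hf x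

theorem lpExp_le {f : Pt d → ℝ} {D : ℝ} (hf : ∀ x, f x ∈ Icc 0 D) (η : Conf d) :
    lpExp f η ≤ D ^ η.card := by
  change ∏ x ∈ η.pts, f x ≤ D ^ η.pts.card
  rw [← Finset.prod_const]
  exact Finset.prod_le_prod (fun x _ => (hf x).1) fun x _ => (hf x).2

/-- Replacing f by g one factor at a time gives n terms of size δ D^{n-1}. The factor D on the left
avoids the exponent n - 1. -/
theorem abs_lpExp_sub_le {f g : Pt d → ℝ} {D δ : ℝ} (hf : ∀ x, f x ∈ Icc 0 D)
    (hg : ∀ x, g x ∈ Icc 0 D) (h : ∀ x, |f x - g x| ≤ δ) (η : Conf d) :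
    D * |lpExp f η - lpExp g η| ≤ δ * (η.card * D ^ η.card) := by
  classical
  have hD : 0 ≤ D := (hf 0).1.trans (hf 0).2
  have hδ : 0 ≤ δ := (abs_nonneg _).trans (h 0)
  change D * |∏ x ∈ η.pts, f x - ∏ x ∈ η.pts, g x| ≤ δ * ((η.pts.card : ℝ) * D ^ η.pts.card)
  induction η.pts using Finset.induction_on with
  | empty => simp
  | insert x s hx ih =>
    rw [Finset.prod_insert hx, Finset.prod_insert hx, Finset.card_insert_of_notMem hx]
    have hP0 : 0 ≤ ∏ y ∈ s, g y := Finset.prod_nonneg fun y _ => (hg y).1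
    have hP : ∏ y ∈ s, g y ≤ D ^ s.card := by
      rw [← Finset.prod_const]
      exact Finset.prod_le_prod (fun y _ => (hg y).1) fun y _ => (hg y).2
    have hsplit : f x * ∏ y ∈ s, f y - g x * ∏ y ∈ s, g y
        = f x * (∏ y ∈ s, f y - ∏ y ∈ s, g y) + (f x - g x) * ∏ y ∈ s, g y := by ring
    calc D * |f x * ∏ y ∈ s, f y - g x * ∏ y ∈ s, g y|
        ≤ D * (|f x * (∏ y ∈ s, f y - ∏ y ∈ s, g y)| + |(f x - g x) * ∏ y ∈ s, g y|) := by
          rw [hsplit]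
          gcongr
          exact abs_add_le _ _
      _ = f x * (D * |∏ y ∈ s, f y - ∏ y ∈ s, g y|) + D * (|f x - g x| * ∏ y ∈ s, g y) := by
          rw [abs_mul, abs_mul, abs_of_nonneg (hf x).1, abs_of_nonneg hP0]
          ring
      _ ≤ D * (δ * (s.card * D ^ s.card)) + D * (δ * D ^ s.card) := by
          gcongr
          · exact (hf x).2
          · exact h x
      _ = _ := by
          push_cast
          ring

open Classical in
/-- The derivative of `e_λ(ρ, η)` along `f`. -/
noncomputable def lpExpDeriv (ρ f : Pt d → ℝ) (η : Conf d) : ℝ :=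
  ∑ x ∈ η.pts, f x * lpExp ρ (Conf.ofPts (η.pts.erase x))

theorem lpExpDeriv_toConf (ρ f : Pt d → ℝ) {n : ℕ} {w : Fin n → Pt d}
    (hw : Function.Injective w) :
    lpExpDeriv ρ f (FinSeq.mk n w).toConf
      = ∑ i, f (w i) * ∏ j, ρ ((FinSeq.remove i w).2 j) := by
  unfold lpExpDeriv
  rw [FinSeq.sum_toConf hw]
  refine Finset.sum_congr rfl fun i _ => ?_
  rw [← FinSeq.toConf_remove hw, FinSeq.lpExp_toConf (FinSeq.injective_remove hw i)]

theorem measurable_lpExpDeriv {ρ f : Pt d → ℝ} (hρ : Measurable ρ) (hf : Measurable f) :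
    Measurable (lpExpDeriv ρ f) :=
  measurable_of_toConf
    (g := fun s => ∑ i, f (s.2 i) * ∏ j, ρ ((FinSeq.remove i s.2).2 j))
    (measurable_finSeq fun n => Finset.measurable_sum
      (f := fun (i : Fin n) (x : Fin n → Pt d) => f (x i) * ∏ j, ρ ((FinSeq.remove i x).2 j))
      Finset.univ fun i _ => (hf.comp (measurable_pi_apply i)).mul
        ((measurable_prod_finSeq_apply hρ).comp (FinSeq.measurable_remove i)))
    fun _ hs => lpExpDeriv_toConf ρ f hs

theorem hasDerivWithinAt_lpExp {ρ : ℝ → Pt d → ℝ} {f : Pt d → ℝ} {t : ℝ} {s : Set ℝ}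
    (h : ∀ x, HasDerivWithinAt (fun s => ρ s x) (f x) s t) (η : Conf d) :
    HasDerivWithinAt (fun s => lpExp (ρ s) η) (lpExpDeriv (ρ t) f η) s t := by
  classical
  have := HasDerivWithinAt.fun_finsetProd (u := η.pts) (f := fun x s => ρ s x) (f' := f)
    fun x _ => h x
  refine this.congr_deriv ?_
  unfold lpExpDeriv
  refine Finset.sum_congr (by congr!) fun x _ => ?_
  rw [smul_eq_mul, mul_comm]
  congr 1

theorem card_erase {η : Conf d} {x : Pt d} (hx : x ∈ η.pts) :
    open Classical in (Conf.ofPts (η.pts.erase x)).card + 1 = η.card :=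
  Finset.card_erase_add_one hx

theorem abs_lpExpDeriv_le {ρ f : Pt d → ℝ} {D L : ℝ} (hρ : ∀ x, ρ x ∈ Icc 0 D)
    (hf : ∀ x, |f x| ≤ L) (η : Conf d) :
    D * |lpExpDeriv ρ f η| ≤ L * (η.card * D ^ η.card) := by
  classical
  have hD : 0 ≤ D := (hρ 0).1.trans (hρ 0).2
  have hL : 0 ≤ L := (abs_nonneg _).trans (hf 0)
  calc D * |lpExpDeriv ρ f η|
      ≤ D * ∑ x ∈ η.pts, |f x * lpExp ρ (Conf.ofPts (η.pts.erase x))| := by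
        gcongr
        unfold lpExpDeriv
        exact Finset.abs_sum_le_sum_abs _ _
    _ = ∑ x ∈ η.pts, |f x| * (D * lpExp ρ (Conf.ofPts (η.pts.erase x))) := by
        rw [Finset.mul_sum]
        refine Finset.sum_congr rfl fun x _ => ?_
        rw [abs_mul, abs_of_nonneg (lpExp_nonneg (fun x => (hρ x).1) _)]
        ring
    _ ≤ ∑ x ∈ η.pts, L * D ^ η.card := by
        refine Finset.sum_le_sum fun x hx => ?_
        have h1 := lpExp_le hρ (Conf.ofPts (η.pts.erase x))
        have h2 := card_erase hx
        have h3 : D * D ^ (Conf.ofPts (η.pts.erase x)).card = D ^ η.card := by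
          rw [← pow_succ']
          rw [h2]
        rw [← h3]
        gcongr
        · exact mul_nonneg hD (lpExp_nonneg (fun x => (hρ x).1) _)
        · exact hf x
    _ = _ := by
        rw [Finset.sum_const, nsmul_eq_mul]
        change (η.card : ℝ) * _ = _
        ring

/-- The change of direction costs n terms with one point removed, the change of density about n²
terms with two points removed; hence the factors D² and n². -/
theorem abs_lpExpDeriv_sub_le {ρ f ρ' f' : Pt d → ℝ} {D L δ δ' : ℝ} (hρ : ∀ x, ρ x ∈ Icc 0 D)
    (hρ' : ∀ x, ρ' x ∈ Icc 0 D) (hf : ∀ x, |f' x| ≤ L) (h : ∀ x, |ρ x - ρ' x| ≤ δ)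
    (h' : ∀ x, |f x - f' x| ≤ δ') (η : Conf d) :
    D ^ 2 * |lpExpDeriv ρ f η - lpExpDeriv ρ' f' η|
      ≤ (D * δ' + L * δ) * ((η.card : ℝ) ^ 2 * D ^ η.card) := by
  classical
  have hD : 0 ≤ D := (hρ 0).1.trans (hρ 0).2
  have hL : 0 ≤ L := (abs_nonneg _).trans (hf 0)
  have hδ : 0 ≤ δ := (abs_nonneg _).trans (h 0)
  have hsplit : lpExpDeriv ρ f η - lpExpDeriv ρ' f' η = lpExpDeriv ρ (fun x => f x - f' x) η
      + ∑ x ∈ η.pts, f' x * (lpExp ρ (Conf.ofPts (η.pts.erase x))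
        - lpExp ρ' (Conf.ofPts (η.pts.erase x))) := by
    unfold lpExpDeriv
    rw [← Finset.sum_sub_distrib, ← Finset.sum_add_distrib]
    refine Finset.sum_congr rfl fun x _ => ?_
    ring
  have h1 := abs_lpExpDeriv_le hρ h' η
  have h2 : D ^ 2 * |∑ x ∈ η.pts, f' x * (lpExp ρ (Conf.ofPts (η.pts.erase x))
        - lpExp ρ' (Conf.ofPts (η.pts.erase x)))| ≤ L * δ * ((η.card : ℝ) ^ 2 * D ^ η.card) := by
    calc _ ≤ D ^ 2 * ∑ x ∈ η.pts, |f' x * (lpExp ρ (Conf.ofPts (η.pts.erase x))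
        - lpExp ρ' (Conf.ofPts (η.pts.erase x)))| := by
          gcongr
          exact Finset.abs_sum_le_sum_abs _ _
      _ = ∑ x ∈ η.pts, |f' x| * (D * (D * |lpExp ρ (Conf.ofPts (η.pts.erase x))
        - lpExp ρ' (Conf.ofPts (η.pts.erase x))|)) := by
          rw [Finset.mul_sum]
          refine Finset.sum_congr rfl fun x _ => ?_
          rw [abs_mul]
          ring
      _ ≤ ∑ x ∈ η.pts, L * (δ * (η.card * D ^ η.card)) := by
          refine Finset.sum_le_sum fun x hx => ?_
          have h3 := abs_lpExp_sub_le hρ hρ' h (Conf.ofPts (η.pts.erase x))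
          have h4 : (Conf.ofPts (η.pts.erase x)).card + 1 = η.card := by
            convert card_erase hx
          refine mul_le_mul (hf x) ?_ (by positivity) hL
          calc _ ≤ D * (δ * ((Conf.ofPts (η.pts.erase x)).card
                * D ^ (Conf.ofPts (η.pts.erase x)).card)) := by gcongr
            _ = δ * ((Conf.ofPts (η.pts.erase x)).card * D ^ η.card) := by
                rw [← h4, pow_succ]
                ring
            _ ≤ _ := by
                gcongr
                omega
      _ = _ := by
          rw [Finset.sum_const, nsmul_eq_mul]
          change (η.card : ℝ) * _ = _
          ring
  have hcard : (η.card : ℝ) ≤ (η.card : ℝ) ^ 2 := by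
    exact_mod_cast Nat.le_self_pow two_ne_zero _
  have hδ' : 0 ≤ δ' := (abs_nonneg _).trans (h' 0)
  rw [hsplit]
  calc _ ≤ D ^ 2 * (|lpExpDeriv ρ (fun x => f x - f' x) η| + _) := by
        gcongr
        exact abs_add_le _ _
    _ ≤ D * (δ' * (η.card * D ^ η.card)) + L * δ * ((η.card : ℝ) ^ 2 * D ^ η.card) := by
        rw [mul_add]
        refine add_le_add ?_ h2
        rw [sq, mul_assoc]
        gcongr
    _ ≤ D * (δ' * ((η.card : ℝ) ^ 2 * D ^ η.card)) + L * δ * ((η.card : ℝ) ^ 2 * D ^ η.card) := by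
        gcongr
    _ = _ := by ring

/-- The dual operator maps `e_λ(ρ)` to the derivative of `e_λ` at `ρ` along the right hand side of
the Vlasov-type equation. -/
theorem dual_lpExp [NeZero d] {φ : Pt d → ℝ} (hφm : Measurable φ) (hφi : Integrable φ) (z : ℝ)
    {ρ : Pt d → ℝ} (hρ : Measurable ρ) {D : ℝ} (hρD : ∀ x, ρ x ∈ Icc 0 D) :
    (fun η => -(η.card : ℝ) * lpExp ρ η + z * birthDual φ (lpExp ρ) η)
      =ᵐ[lebesguePoisson d] lpExpDeriv ρ fun x => -ρ x + z * damping φ ρ x := by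
  have hdm : Measurable (damping φ ρ) :=
    (measurable_damping hφm (hρ.comp measurable_snd)).comp (measurable_prodMk_left (x := (0 : ℝ)))
  have hbd := measurable_birthDual hφm (measurable_lpExp hρ)
  refine (ae_lebesguePoisson_iff (measurableSet_eq_fun
    (((measurable_comp_card fun n => -(n : ℝ)).mul (measurable_lpExp hρ)).add (hbd.const_mul z))
    (measurable_lpExpDeriv hρ (hρ.neg.add (hdm.const_mul z))))).2
    (ae_seqMeasure_iff.2 fun n => ?_)
  filter_upwards [ae_remove (ae_append ae_seq_injective) n, ae_injective n] with w h1 hw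
  change -((FinSeq.mk n w).toConf.card : ℝ) * lpExp ρ (FinSeq.mk n w).toConf
    + z * birthDual φ (lpExp ρ) (FinSeq.mk n w).toConf
    = lpExpDeriv ρ (fun x => -ρ x + z * damping φ ρ x) (FinSeq.mk n w).toConf
  rw [birthDual_toConf φ _ hw, lpExpDeriv_toConf ρ _ hw,
    FinSeq.card_toConf (s := FinSeq.mk n w) hw, FinSeq.lpExp_toConf (s := FinSeq.mk n w) hw]
  -- For an exponent the union factorizes, and the integral over y is that of a product of -ρ(yⱼ)
  -- φ(x - yⱼ), which the exponential formula evaluates as the damping.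
  have hker : ∀ i : Fin n, dualKernel φ (lpExp ρ) (w i, FinSeq.remove i w)
      = damping φ ρ (w i) * ∏ j, ρ ((FinSeq.remove i w).2 j) := by
    intro i
    have hint := integral_seqMeasure_prod (integrable_mul_comp_sub hφi hρ (D := D)
      (Eventually.of_forall fun y => by rw [abs_of_nonneg (hρD y).1]; exact (hρD y).2) (w i)).neg
    rw [damping, ← integral_neg]
    simp only [Pi.neg_apply] at hint
    rw [← hint.2, mul_comm, ← integral_const_mul]
    refine integral_congr_ae ?_
    filter_upwards [h1 i] with y hy
    rw [FinSeq.lpExp_toConf hy]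
    change (∏ j : Fin ((FinSeq.remove i w).1 + y.1), ρ (Fin.append (FinSeq.remove i w).2 y.2 j))
      * mayer φ (w i) y = _
    rw [Fin.prod_univ_add, mul_assoc, mayer, ← Finset.prod_mul_distrib]
    simp only [Fin.append_left, Fin.append_right]
    congr 1
    refine Finset.prod_congr rfl fun j _ => ?_
    ring
  have hprod : ∀ i : Fin n, ∏ j, ρ (w j) = ρ (w i) * ∏ j, ρ ((FinSeq.remove i w).2 j) := by
    intro i
    cases n with
    | zero => exact i.elim0
    | succ n => exact Fin.prod_univ_succAbove (fun j => ρ (w j)) i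
  change -(n : ℝ) * ∏ j, ρ (w j) + _ = _
  simp_rw [hker, add_mul, Finset.sum_add_distrib, neg_mul, Finset.sum_neg_distrib, ← hprod]
  rw [Finset.sum_const, Finset.card_univ, Fintype.card_fin, nsmul_eq_mul, Finset.mul_sum]
  simp_rw [mul_assoc]

end LebesguePoissonExponents

/-! ### The exponents as a classical solution -/

section ClassicalSolution

/-- A curve in `L^∞` is differentiable in norm if it is pointwise differentiable with derivatives
that are Lipschitz continuous in time, uniformly in the space variable. -/
theorem hasDerivWithinAt_linfty {Ω : Type*} [MeasurableSpace Ω] {μ : Measure Ω}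
    {u v : ℝ → Lp ℝ ∞ μ} {U V : ℝ → Ω → ℝ} (hu : ∀ t, u t =ᵐ[μ] U t) (hv : ∀ t, v t =ᵐ[μ] V t)
    (hUV : ∀ η, ∀ t ∈ Ici (0 : ℝ), HasDerivWithinAt (fun s => U s η) (V t η) (Ici 0) t)
    {M : ℝ} (hM : 0 ≤ M)
    (hV : ∀ η, ∀ t ∈ Ici (0 : ℝ), ∀ s ∈ Ici (0 : ℝ), |V t η - V s η| ≤ M * |t - s|) :
    ContinuousOn v (Ici 0) ∧ ∀ t ∈ Ici (0 : ℝ), HasDerivWithinAt u (v t) (Ici 0) t := by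
  constructor
  · refine (LipschitzOnWith.of_dist_le_mul (K := M.toNNReal) fun t ht s hs => ?_).continuousOn
    rw [Real.coe_toNNReal _ hM, dist_eq_norm, Real.dist_eq]
    refine norm_le_of_ae_abs_le (by positivity) ?_
    filter_upwards [Lp.coeFn_sub (v t) (v s), hv t, hv s] with η h1 h2 h3
    rw [h1, Pi.sub_apply, h2, h3]
    exact hV η t ht s hs
  · intro t ht
    -- The mean value inequality for r ↦ U r η - r V t η, whose derivative V r η - V t η is at most
    -- M|s - t|, gives a remainder quadratic in s - t and uniform in η.
    have hquad : ∀ s ∈ Ici (0 : ℝ), ‖u s - u t - (s - t) • v t‖ ≤ M * |s - t| ^ 2 := by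
      intro s hs
      refine norm_le_of_ae_abs_le (by positivity) ?_
      filter_upwards [Lp.coeFn_sub (u s - u t) ((s - t) • v t), Lp.coeFn_sub (u s) (u t),
        Lp.coeFn_smul (s - t) (v t), hu s, hu t, hv t] with η h1 h2 h3 h4 h5 h6
      rw [h1, Pi.sub_apply, h2, Pi.sub_apply, h3, Pi.smul_apply, h4, h5, h6, smul_eq_mul]
      have hsub : uIcc t s ⊆ Ici (0 : ℝ) := fun r hr => (le_min ht hs).trans hr.1
      have hd : ∀ r ∈ uIcc t s, HasDerivWithinAt (fun r => U r η - r * V t η)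
          (V r η - V t η) (uIcc t s) r := by
        intro r hr
        refine (((hUV η r (hsub hr)).mono hsub).sub
          (((hasDerivAt_id r).mul_const (V t η)).hasDerivWithinAt (s := uIcc t s))).congr_deriv ?_
        rw [one_mul]
      have hb : ∀ r ∈ uIcc t s, ‖V r η - V t η‖ ≤ M * |s - t| := by
        intro r hr
        rw [Real.norm_eq_abs]
        refine (hV η r (hsub hr) t ht).trans ?_
        gcongr 1
        exact abs_sub_left_of_mem_uIcc hr
      have := (convex_uIcc t s).norm_image_sub_le_of_norm_hasDerivWithin_le hd hb
        left_mem_uIcc right_mem_uIcc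
      rw [Real.norm_eq_abs, Real.norm_eq_abs] at this
      calc _ = |U s η - s * V t η - (U t η - t * V t η)| := by ring_nf
        _ ≤ _ := this
        _ = _ := by ring
    rw [hasDerivWithinAt_iff_isLittleO]
    have h1 : (fun s => u s - u t - (s - t) • v t) =O[𝓝[Ici 0] t] fun s => ‖s - t‖ ^ 2 := by
      refine Asymptotics.IsBigO.of_bound M ?_
      filter_upwards [self_mem_nhdsWithin] with s hs
      rw [norm_pow, norm_norm, Real.norm_eq_abs]
      exact hquad s hs
    exact h1.trans_isLittleO
      ((Asymptotics.isLittleO_pow_sub_sub t one_lt_two).mono nhdsWithin_le_nhds)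

variable {d : ℕ}

theorem exists_classical_lpExp [NeZero d] {φ : Pt d → ℝ} (hφm : Measurable φ)
    (hφ : ∀ x, 0 ≤ φ x) (hφi : Integrable φ) {C z α : ℝ} (hC : 1 ≤ C) (hz : 0 ≤ z)
    (hα : 0 < α) (hα1 : α < 1) {ρ : ℝ → Pt d → ℝ} (hρm : ∀ t, Measurable (ρ t))
    (hρD : ∀ t x, ρ t x ∈ Icc 0 (α * C)) (hρ : ∀ x t, 0 ≤ t →
      HasDerivWithinAt (fun s => ρ s x) (-ρ t x + z * damping φ (ρ t) x) (Ici 0) t) :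
    ∃ k : ℝ → KSpace d,
      IsClassicalSolution (partGraph (vlasovDualGraph φ z C) (closedSubK d C α)) (k 0) k ∧
      ∀ t, (k t).fn C =ᵐ[lebesguePoisson d] lpExp (ρ t) ∧ k t ∈ subK d C α := by
  have hC0 : 0 < C := by linarith
  set D := α * C with hD
  have hD0 : 0 < D := by positivity
  set β := ∫ y, φ y with hβ
  have hβ0 : 0 ≤ β := integral_nonneg hφ
  set f : ℝ → Pt d → ℝ := fun t x => -ρ t x + z * damping φ (ρ t) x with hf
  -- Bounds the velocity, since 0 ≤ ρ ≤ D and 0 ≤ damping ≤ 1; it is also the Lipschitz constant of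
  -- ρ in time.
  set L := D + z with hL
  have hL0 : 0 ≤ L := by positivity
  have hdm : ∀ t, Measurable (damping φ (ρ t)) := fun t =>
    (measurable_damping hφm ((hρm t).comp measurable_snd)).comp
      (measurable_prodMk_left (x := (0 : ℝ)))
  have hfm : ∀ t, Measurable (f t) := fun t => (hρm t).neg.add ((hdm t).const_mul z)
  have hfL : ∀ t x, |f t x| ≤ L := by
    intro t x
    have h1 := damping_nonneg (φ := φ) (ρ t) x
    have h2 := damping_le_one hφ (Eventually.of_forall fun y => (hρD t y).1) x
    obtain ⟨h3, h4⟩ := hρD t x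
    simp only [hf]
    rw [abs_le]
    constructor <;> nlinarith
  have hρLip : ∀ t ∈ Ici (0 : ℝ), ∀ s ∈ Ici (0 : ℝ), ∀ x, |ρ t x - ρ s x| ≤ L * |t - s| :=
    fun t ht s hs x => (convex_Ici (0 : ℝ)).norm_image_sub_le_of_norm_hasDerivWithin_le
      (f := fun s => ρ s x) (fun r hr => hρ x r hr) (fun r _ => hfL r x) hs ht
  have hfLip : ∀ t ∈ Ici (0 : ℝ), ∀ s ∈ Ici (0 : ℝ), ∀ x,
      |f t x - f s x| ≤ (L + z * (L * β)) * |t - s| := by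
    intro t ht s hs x
    have h1 := hρLip t ht s hs x
    have h2 := abs_damping_sub_le hφ hφi (hρm t) (hρm s)
      (Eventually.of_forall fun y => (hρD t y).1) (Eventually.of_forall fun y => (hρD s y).1)
      (Eventually.of_forall fun y => (hρD t y).2) (Eventually.of_forall fun y => (hρD s y).2)
      (Eventually.of_forall (hρLip t ht s hs)) x
    have h3 : f t x - f s x = -(ρ t x - ρ s x) + z * (damping φ (ρ t) x - damping φ (ρ s) x) := by
      simp only [hf]
      ring
    rw [h3]
    refine (abs_add_le _ _).trans ?_
    rw [abs_neg, abs_mul, abs_of_nonneg hz]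
    calc _ ≤ L * |t - s| + z * (L * |t - s| * β) := by gcongr
      _ = _ := by ring
  have hpow : ∀ n : ℕ, D ^ n = C ^ n * α ^ n := fun n => by rw [hD, mul_pow, mul_comm]
  set U : ℝ → Conf d → ℝ := fun t η => (C ^ η.card)⁻¹ * lpExp (ρ t) η with hU
  set V : ℝ → Conf d → ℝ := fun t η => (C ^ η.card)⁻¹ * lpExpDeriv (ρ t) (f t) η with hV
  have hUb : ∀ t η, |U t η| ≤ 1 * α ^ η.card := by
    intro t η
    rw [hU]
    simp only
    rw [abs_mul, abs_of_nonneg (a := (C ^ η.card)⁻¹) (by positivity),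
      abs_of_nonneg (lpExp_nonneg (fun x => (hρD t x).1) η), inv_mul_le_iff₀ (by positivity),
      one_mul, ← hpow]
    exact lpExp_le (hρD t) η
  have hVb : ∀ t η, |V t η| ≤ L / D * ((η.card : ℝ) ^ 1 * α ^ η.card) := by
    intro t η
    have h1 := abs_lpExpDeriv_le (hρD t) (hfL t) η
    rw [hV]
    simp only
    rw [abs_mul, abs_of_nonneg (a := (C ^ η.card)⁻¹) (by positivity),
      inv_mul_le_iff₀ (by positivity)]
    rw [hpow] at h1
    rw [div_mul_eq_mul_div, mul_div_assoc', le_div_iff₀ hD0]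
    nlinarith
  have hdecay : ∀ k : ℕ, Tendsto (fun n : ℕ => (n : ℝ) ^ k * α ^ n) atTop (𝓝 0) := fun k =>
    tendsto_pow_const_mul_const_pow_of_abs_lt_one k (by rwa [abs_of_pos hα])
  -- Here α < 1 enters: it makes n αⁿ and n² αⁿ bounded, which controls the velocity and its
  -- Lipschitz constant uniformly over all configurations.
  have hbdd : ∀ k : ℕ, ∃ κ : ℝ, ∀ n : ℕ, (n : ℝ) ^ k * α ^ n ≤ κ := fun k => by
    obtain ⟨κ, hκ⟩ := (hdecay k).bddAbove_range
    exact ⟨κ, fun n => hκ ⟨n, rfl⟩⟩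
  obtain ⟨κ₁, hκ₁⟩ := hbdd 1
  obtain ⟨κ, hκ⟩ := hbdd 2
  have hκ0 : 0 ≤ κ := by simpa using hκ 0
  have hVLip : ∀ η, ∀ t ∈ Ici (0 : ℝ), ∀ s ∈ Ici (0 : ℝ), |V t η - V s η|
      ≤ (D * (L + z * (L * β)) + L * L) * κ / D ^ 2 * |t - s| := by
    intro η t ht s hs
    have h1 := abs_lpExpDeriv_sub_le (hρD t) (hρD s) (hfL s) (hρLip t ht s hs)
      (hfLip t ht s hs) η
    rw [hV]
    simp only
    rw [← mul_sub, abs_mul, abs_of_nonneg (a := (C ^ η.card)⁻¹) (by positivity),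
      inv_mul_le_iff₀ (by positivity), div_mul_eq_mul_div, mul_div_assoc',
      le_div_iff₀ (by positivity), mul_comm _ (D ^ 2)]
    refine h1.trans ?_
    have h2 := hκ η.card
    calc _ = C ^ η.card * ((D * (L + z * (L * β)) + L * L) * |t - s|)
          * ((η.card : ℝ) ^ 2 * α ^ η.card) := by
          rw [hpow]
          ring
      _ ≤ C ^ η.card * ((D * (L + z * (L * β)) + L * L) * |t - s|) * κ := by gcongr
      _ = _ := by ring
  have hUm : ∀ t, Measurable (U t) := fun t =>
    (measurable_comp_card fun n => (C ^ n)⁻¹).mul (measurable_lpExp (hρm t))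
  have hVm : ∀ t, Measurable (V t) := fun t =>
    (measurable_comp_card fun n => (C ^ n)⁻¹).mul (measurable_lpExpDeriv (hρm t) (hfm t))
  have hexU : ∀ t, ∃ u : KSpace d, u =ᵐ[lebesguePoisson d] U t := fun t =>
    exists_linfty_of_ae_abs_le (hUm t).aestronglyMeasurable (K := 1)
      (Eventually.of_forall fun η => (hUb t η).trans (by
        rw [one_mul]
        exact pow_le_one₀ hα.le hα1.le))
  have hexV : ∀ t, ∃ v : KSpace d, v =ᵐ[lebesguePoisson d] V t := fun t =>
    exists_linfty_of_ae_abs_le (hVm t).aestronglyMeasurable (K := L / D * κ₁)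
      (Eventually.of_forall fun η => (hVb t η).trans
        (mul_le_mul_of_nonneg_left (hκ₁ _) (by positivity)))
  choose u hu using hexU
  choose v hv using hexV
  have hderiv := hasDerivWithinAt_linfty hu hv
    (fun η t ht => (hasDerivWithinAt_lpExp (fun x => hρ x t ht) η).const_mul _)
    (M := (D * (L + z * (L * β)) + L * L) * κ / D ^ 2) (by positivity) hVLip
  have hfn : ∀ t, (u t).fn C =ᵐ[lebesguePoisson d] lpExp (ρ t) := by
    intro t
    filter_upwards [hu t] with η hη
    rw [KSpace.fn, hη]
    exact mul_inv_cancel_left₀ (by positivity) _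
  have hgraph : ∀ t, (u t, v t) ∈ vlasovDualGraph φ z C := by
    intro t
    rw [mem_vlasovDualGraph_iff hφm hφ hφi hC]
    filter_upwards [hfn t, hv t, dual_lpExp hφm hφi z (hρm t) (hρD t),
      birthDual_congr hφm ((u t).measurable_fn C) (measurable_lpExp (hρm t)) (hfn t)]
      with η h1 h2 h3 h4
    rw [dualExpr, h1, h4, h3, KSpace.fn, h2]
    exact mul_inv_cancel_left₀ (by positivity) _
  have hsub : ∀ t, u t ∈ subK d C α := fun t =>
    mem_subK_of_ae_abs_le hC0 hα ((hu t).mono fun η hη => by rw [hη]; exact hUb t η)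
  have hvmem : ∀ t, v t ∈ closedSubK d C α := fun t => by
    rw [closedSubK_eq_vanishing hC0 hα hα1]
    refine mem_vanishing_of_ae_abs_le (a := fun n => L / D * ((n : ℝ) ^ 1 * α ^ n)) ?_
      ((hv t).mono fun η hη => by rw [hη]; exact hVb t η)
    simpa only [mul_zero] using (hdecay 1).const_mul (L / D)
  exact ⟨u, ⟨rfl, v, hderiv.1, fun t ht =>
    ⟨hderiv.2 t ht, hgraph t, subset_closure (hsub t), hvmem t⟩⟩, fun t => ⟨hfn t, hsub t⟩⟩

end ClassicalSolution

end Glauber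

/-! ### The theorem -/

theorem theorem3p12 (d : ℕ) (hd : 1 ≤ d) (φ : Glauber.Pt d → ℝ)
    (hφ_meas : Measurable φ) (hφ_nonneg : ∀ x, 0 ≤ φ x) (hφ_even : ∀ x, φ (-x) = φ x)
    (hφ_int : Integrable φ)
    (β : ℝ) (hβ : β = ∫ x, φ x)
    (C z : ℝ) (hC : 1 < C) (hz : 0 < z)
    (hz_small : z ≤ min (C * Real.exp (-(C * β))) (2 * C * Real.exp (-(2 * C * β))))
    (hz_log : C * β = Real.log 2 → z < C / 2)
    (α : ℝ) (hα : z / C < α) (hα_one : α < 1)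
    (ρ₀ : Glauber.Pt d → ℝ) (hρ₀_meas : Measurable ρ₀)
    (hρ₀ : ∀ᵐ x, 0 ≤ ρ₀ x ∧ ρ₀ x ≤ α * C) :
    Glauber.WellPosed (Glauber.closedSubK d C α)
      (Glauber.partGraph (Glauber.vlasovDualGraph φ z C) (Glauber.closedSubK d C α)) ∧
    ∃ ρ : ℝ → Glauber.Pt d → ℝ,
      Glauber.IsVlasovSolution φ z ρ₀ ρ ∧
      (∀ t, 0 ≤ t → ∀ᵐ x, ρ t x ≤ α * C) ∧
      (∀ ρ' : ℝ → Glauber.Pt d → ℝ, Glauber.IsVlasovSolution φ z ρ₀ ρ' →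
        ∀ t, 0 ≤ t → ρ' t =ᵐ[volume] ρ t) ∧
      ∃ (k₀ : Glauber.KSpace d) (k : ℝ → Glauber.KSpace d),
        k₀.fn C =ᵐ[Glauber.lebesguePoisson d] Glauber.lpExp ρ₀ ∧
        Glauber.IsClassicalSolution
          (Glauber.partGraph (Glauber.vlasovDualGraph φ z C) (Glauber.closedSubK d C α)) k₀ k ∧
        ∀ t, 0 ≤ t →
          (k t).fn C =ᵐ[Glauber.lebesguePoisson d] Glauber.lpExp (ρ t) ∧
          k t ∈ Glauber.subK d C α := by
  have : NeZero d := ⟨by omega⟩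
  have hC0 : 0 < C := by linarith
  have hα0 : 0 < α := (div_pos hz hC0).trans hα
  have hzD : z ≤ α * C := ((div_lt_iff₀ hC0).1 hα).le
  have hzC : z * Real.exp (C * ∫ y, φ y) ≤ C := by
    have h := hz_small.trans (min_le_left _ _)
    rw [hβ, Real.exp_neg, ← div_eq_mul_inv, le_div_iff₀ (Real.exp_pos _)] at h
    exact h
  refine ⟨Glauber.wellPosed_vlasov hφ_meas hφ_nonneg hφ_int hC.le hz.le hzC hα0 hα_one, ?_⟩
  -- Clamping changes ρ₀ only on a null set and yields bounds at every point, as the construction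
  -- needs; the initial condition and e_λ(ρ₀) are insensitive to it.
  have hrm : Measurable fun x => max 0 (min (ρ₀ x) (α * C)) :=
    measurable_const.max (hρ₀_meas.min measurable_const)
  have hD0 : 0 ≤ α * C := by positivity
  obtain ⟨ρ, hρm, hρD, hρ_init, hρ⟩ := Glauber.exists_vlasov_solution hφ_meas hφ_nonneg hφ_int hz.le
    hzD hrm fun x => ⟨le_max_left _ _, max_le hD0 (min_le_right _ _)⟩
  have hr : ρ 0 =ᵐ[MeasureTheory.volume] ρ₀ := by
    filter_upwards [hρ₀] with x hx
    rw [hρ_init, min_eq_left hx.2, max_eq_right hx.1]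
  have hsol : Glauber.IsVlasovSolution φ z ρ₀ ρ :=
    { measurable := fun t _ => hρm t
      nonneg := fun t _ => Filter.Eventually.of_forall fun x => (hρD t x).1
      bounded := ⟨α * C, fun t _ => Filter.Eventually.of_forall fun x => (hρD t x).2⟩
      initial := hr
      equation := Filter.Eventually.of_forall fun x t ht => hρ x t ht }
  obtain ⟨k, hk, hkt⟩ := Glauber.exists_classical_lpExp hφ_meas hφ_nonneg hφ_int hC.le hz.le hα0
    hα_one hρm hρD hρ
  refine ⟨ρ, hsol, fun t _ => Filter.Eventually.of_forall fun x => (hρD t x).2,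
    fun ρ' hρ' t ht => hρ'.unique hφ_nonneg hφ_int hz.le hsol t ht, k 0, k,
    (hkt 0).1.trans (Glauber.lpExp_congr (hρm 0) hρ₀_meas hr), hk, fun t _ => hkt t⟩
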